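/- Let $\mu$ be a finite positive Borel measure on the bicircle $\mathbb T^2=\{|z|=|w|=1\}$, and let $n,m\ge 0$ be integers. Put $\mathcal L(f)=\frac1{(2\pi)^2}\int_{\mathbb T^2} f\,d\mu$ and $\langle X,Y\rangle=\mathcal L(XY^\dagger)$, where for a column vector $Y$ of polynomials $Y^\dagger$ is its conjugate transpose on $\mathbb T^2$. Call $\mathcal L$ positive definite if $\mathcal L(|p|^2)>0$ for every nonzero polynomial $p$. A polynomial $p(z,w)=\sum_{i\le n,\,j\le m}k_{i,j}z^iw^j$ has degree $(n,m)$ if $k_{n,m}\neq 0$; its reverse is $\overleftarrow p(z,w)=z^nw^m\,\overline{p}(1/z,1/w)=\sum_{i\le n,\,j\le m}\overline{k_{i,j}}\,z^{n-i}w^{m-j}$; a polynomial is stable if it has no zeros in $\{|z|\le 1,|w|\le 1\}$. If $\mathcal L$ is positive definite, define the following for $i,j\ge 0$. * For $0\le l\le j$, $\phi^l_{i,j}$ is the polynomial, with leading term a positive multiple of $z^iw^l$, obtained by orthonormalizing $z^iw^l$ with respect to $\mathcal L$ against all $z^aw^b$ with $0\le a<i$, $0\le b\le j$ or $a=i$,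 $0\le b<l$. Put $\Phi_{i,j}=[\phi^j_{i,j},\dots,\phi^0_{i,j}]^T$. For $0\le l\le i$, $\tilde\phi^l_{i,j}$ is obtained in the same way from $z^lw^j$ and all $z^aw^b$ with $0\le b<j$, $0\le a\le i$ or $b=j$, $0\le a<l$. Put $\tilde\Phi_{i,j}=[\tilde\phi^i_{i,j},\dots,\tilde\phi^0_{i,j}]^T$. $\overleftarrow\Phi_{i,j}$ and $\overleftarrow{\tilde\Phi}_{i,j}$ are the row vectors of the reverses (as polynomials of degree at most $(i,j)$) of the entries. * $\mathcal K_{i,j}=\langle\Phi_{i,j-1},\tilde\Phi_{i-1,j}\rangle$ and $\mathcal K^1_{i,j}=\langle w\Phi_{i,j-1},\overleftarrow{\tilde\Phi}{}^T_{i-1,j}\rangle$ ($j\times i$ matrices, empty if $i=0$ or $j=0$); $\hat E_{i,j}=\langle z\Phi_{i-1,j},\overleftarrow\Phi{}^T_{i-1,j}\rangle$ for $i\ge1$, and $\hat{\tilde E}_{i,j}=\langle w\tilde\Phi_{i,j-1},\overleftarrow{\tilde\Phi}{}^T_{i,j-1}\rangle$ for $j\ge1$. * $u_{i,0}=\hat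 E_{i,0}$ and $u_{-i,0}=\overline{u_{i,0}}$ for $i\ge1$; $u_{0,j}=\hat{\tilde E}_{0,j}$ for $j\ge1$; and for $i,j\ge1$, $u_{i,j}=\overline{(\mathcal K^1_{i,j})_{1,1}}$, while $u_{-i,j}$ is the entry in the last row and last column of $(\Phi^{j-1}_{i,i})^{-1}\mathcal K_{i,j}\big((\tilde\Phi^{i-1}_{j,j})^\dagger\big)^{-1}$, except that $u_{-1,1}=\mathcal K_{1,1}$. Here $\Phi^{j-1}_{i,i}$ is the coefficient matrix of $z^i[w^{j-1},\dots,1]^T$ in $\Phi_{i,j-1}$, and $\tilde\Phi^{i-1}_{j,j}$ that of $w^j[z^{i-1},\dots,1]^T$ in $\tilde\Phi_{i-1,j}$. **Theorem.** The measure $\mu$ is absolutely continuous with respect to Lebesgue measure with $$d\mu=\frac{d\theta\,d\phi}{|p(e^{i\theta},e^{i\phi})|^2}$$ for some polynomial $p$ of degree $(n,m)$ with $\overleftarrow p$ stable if and only if $\mathcal L$ is positive definite and * (a) $\mathcal K_{n,j}=0$, $\hat{\tilde E}_{n-1,j+1}=0$ and $u_{n,j+1}=0$ for all $j\ge m$;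 * (b) $\mathcal K_{i,m}=0$, $\hat E_{i,m-1}=0$ and $u_{i,m}=0$ for all $i>n$; * (c) $u_{i,j}=0$ and $u_{-i,j}=0$ for all $i>n$, $j>m$. (The condition on $\hat{\tilde E}_{n-1,j+1}$ is void if $n=0$, and that on $\hat E_{i,m-1}$ is void if $m=0$.) -/

import Mathlib

open MeasureTheory
open scoped ComplexConjugate

/-! The bicircle, Lebesgue measure on it, and the functional of a measure -/

noncomputable instance instMeasurableSpaceCircle : MeasurableSpace Circle := borel Circle

instance instBorelSpaceCircle : BorelSpace Circle := ⟨rfl⟩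

namespace Bicircle

/-- Arc length `dθ` on the unit circle (total mass `2π`). -/
noncomputable def arcLength : Measure Circle :=
  (volume.restrict (Set.Ioc (-Real.pi) Real.pi)).map Circle.exp

/-- Lebesgue measure `dθ dφ` on the bicircle (total mass `4π²`). -/
noncomputable def lebesgue : Measure (Circle × Circle) := arcLength.prod arcLength

/-- `𝓛(f) = (1/2π)² ∫ f dμ`. -/
noncomputable def functional (μ : Measure (Circle × Circle)) (f : Circle × Circle → ℂ) : ℂ :=
  (1 / (2 * (Real.pi : ℂ))) ^ 2 * ∫ x, f x ∂μ

/-- `⟨X, Y⟩ = 𝓛(X Y†)`; on the bicircle `Y†` is the pointwise complex conjugate of `Y`. -/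
noncomputable def pairing (μ : Measure (Circle × Circle)) (f g : Circle × Circle → ℂ) : ℂ :=
  functional μ (fun x => f x * conj (g x))

/-! Bivariate polynomials; the variable `0` is `z` and the variable `1` is `w` -/

/-- The exponent of `z^i w^j`. -/
noncomputable def expo (i j : ℕ) : Fin 2 →₀ ℕ := Finsupp.single 0 i + Finsupp.single 1 j

/-- The coefficient of `z^i w^j`. -/
noncomputable def cf (p : MvPolynomial (Fin 2) ℂ) (i j : ℕ) : ℂ := p.coeff (expo i j)

/-- The value `p(z, w)`. -/
noncomputable def val (p : MvPolynomial (Fin 2) ℂ) (z w : ℂ) : ℂ := MvPolynomial.eval ![z, w] p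

/-- The restriction of `p` to the bicircle. -/
noncomputable def onTorus (p : MvPolynomial (Fin 2) ℂ) : Circle × Circle → ℂ :=
  fun x => val p x.1 x.2

/-- The monomial `z^i w^j` on the bicircle. -/
noncomputable def mono (i j : ℕ) : Circle × Circle → ℂ :=
  fun x => (x.1 : ℂ) ^ i * (x.2 : ℂ) ^ j

/-- `p = ∑_{i ≤ n, j ≤ m} k_{i,j} z^i w^j` with `k_{n,m} ≠ 0`. -/
def HasDegree (p : MvPolynomial (Fin 2) ℂ) (n m : ℕ) : Prop :=
  (∀ i j, n < i ∨ m < j → cf p i j = 0) ∧ cf p n m ≠ 0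

/-- The reverse `z^n w^m p̄(1/z, 1/w)` of a polynomial of degree at most `(n, m)`. -/
noncomputable def reverse (n m : ℕ) (p : MvPolynomial (Fin 2) ℂ) : MvPolynomial (Fin 2) ℂ :=
  ∑ i ∈ Finset.range (n + 1), ∑ j ∈ Finset.range (m + 1),
    MvPolynomial.monomial (expo (n - i) (m - j)) (conj (cf p i j))

/-- `p` has no zeros in the closed bidisk. -/
def IsStable (p : MvPolynomial (Fin 2) ℂ) : Prop :=
  ∀ z w : ℂ, ‖z‖ ≤ 1 → ‖w‖ ≤ 1 → val p z w ≠ 0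

/-- `𝓛(|p|²) > 0` for every nonzero polynomial `p`. (A Laurent polynomial is a monomial times a
polynomial, and monomials have modulus one on the bicircle.) -/
def IsPosDef (μ : Measure (Circle × Circle)) : Prop :=
  ∀ p : MvPolynomial (Fin 2) ℂ, p ≠ 0 → 0 < (pairing μ (onTorus p) (onTorus p)).re

/-! Orthonormal polynomials in the lexicographical and reverse lexicographical orderings -/

/-- `φ` is a positive multiple of the monomial with exponent `e` plus a linear combination of the
monomials with exponents in `S`, is orthogonal to the latter, and has norm one. -/
def IsOrthonormalStep (μ : Measure (Circle × Circle)) (S : Finset (ℕ × ℕ)) (e : ℕ × ℕ)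
    (φ : MvPolynomial (Fin 2) ℂ) : Prop :=
  (∀ i j, (i, j) ∉ S → (i, j) ≠ e → cf φ i j = 0) ∧
  (∃ k : ℝ, 0 < k ∧ cf φ e.1 e.2 = k) ∧
  (∀ s ∈ S, pairing μ (onTorus φ) (mono s.1 s.2) = 0) ∧
  pairing μ (onTorus φ) (onTorus φ) = 1

open Classical in
/-- The polynomial of `IsOrthonormalStep` (unique when `μ` is positive definite and `e ∉ S`). -/
noncomputable def orthonormalStep (μ : Measure (Circle × Circle)) (S : Finset (ℕ × ℕ))
    (e : ℕ × ℕ) : MvPolynomial (Fin 2) ℂ :=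
  if h : ∃ φ, IsOrthonormalStep μ S e φ then h.choose else 0

/-- Exponents `(i, j)` with `i ≤ n`, `j ≤ m` and `(i, j) <_lex (n, l)`. -/
def lexBelow (n m l : ℕ) : Finset (ℕ × ℕ) :=
  (Finset.range (n + 1) ×ˢ Finset.range (m + 1)).filter
    fun s => s.1 < n ∨ (s.1 = n ∧ s.2 < l)

/-- Exponents `(i, j)` with `i ≤ n`, `j ≤ m` and `(i, j) <_revlex (l, m)`. -/
def revlexBelow (n m l : ℕ) : Finset (ℕ × ℕ) :=
  (Finset.range (n + 1) ×ˢ Finset.range (m + 1)).filter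
    fun s => s.2 < m ∨ (s.2 = m ∧ s.1 < l)

/-- `φ^l_{n,m}`, with leading monomial `z^n w^l` (`0 ≤ l ≤ m`). -/
noncomputable def phi (μ : Measure (Circle × Circle)) (n m l : ℕ) : MvPolynomial (Fin 2) ℂ :=
  orthonormalStep μ (lexBelow n m l) (n, l)

/-- `φ̃^l_{n,m}`, with leading monomial `z^l w^m` (`0 ≤ l ≤ n`). -/
noncomputable def phiTilde (μ : Measure (Circle × Circle)) (n m l : ℕ) :
    MvPolynomial (Fin 2) ℂ :=
  orthonormalStep μ (revlexBelow n m l) (l, m)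

/-! Recurrence coefficients. The vectors `Φ_{n,m} = [φ^m_{n,m}, …, φ^0_{n,m}]ᵀ` and
`Φ̃_{n,m} = [φ̃^n_{n,m}, …, φ̃^0_{n,m}]ᵀ` list their entries with decreasing upper index. -/

/-- `𝒦_{n,m} = ⟨Φ_{n,m-1}, Φ̃_{n-1,m}⟩`; it has no entries if `n = 0` or `m = 0`. -/
noncomputable def K (μ : Measure (Circle × Circle)) (n m : ℕ) : Matrix (Fin m) (Fin n) ℂ :=
  Matrix.of fun a b =>
    pairing μ (onTorus (phi μ n (m - 1) (m - 1 - a)))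
      (onTorus (phiTilde μ (n - 1) m (n - 1 - b)))

/-- `𝒦¹_{n,m} = ⟨w Φ_{n,m-1}, (reverse of Φ̃_{n-1,m})ᵀ⟩`. -/
noncomputable def K1 (μ : Measure (Circle × Circle)) (n m : ℕ) : Matrix (Fin m) (Fin n) ℂ :=
  Matrix.of fun a b =>
    pairing μ (fun x => (x.2 : ℂ) * onTorus (phi μ n (m - 1) (m - 1 - a)) x)
      (onTorus (reverse (n - 1) m (phiTilde μ (n - 1) m (n - 1 - b))))

/-- `Ê_{n,m} = ⟨z Φ_{n-1,m}, (reverse of Φ_{n-1,m})ᵀ⟩`, for `n ≥ 1`. -/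
noncomputable def Ehat (μ : Measure (Circle × Circle)) (n m : ℕ) :
    Matrix (Fin (m + 1)) (Fin (m + 1)) ℂ :=
  Matrix.of fun a b =>
    pairing μ (fun x => (x.1 : ℂ) * onTorus (phi μ (n - 1) m (m - a)) x)
      (onTorus (reverse (n - 1) m (phi μ (n - 1) m (m - b))))

/-- The tilde counterpart `⟨w Φ̃_{n,m-1}, (reverse of Φ̃_{n,m-1})ᵀ⟩` of `Ê_{n,m}`, for `m ≥ 1`. -/
noncomputable def EhatTilde (μ : Measure (Circle × Circle)) (n m : ℕ) :
    Matrix (Fin (n + 1)) (Fin (n + 1)) ℂ :=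
  Matrix.of fun a b =>
    pairing μ (fun x => (x.2 : ℂ) * onTorus (phiTilde μ n (m - 1) (n - a)) x)
      (onTorus (reverse n (m - 1) (phiTilde μ n (m - 1) (n - b))))

/-- The coefficient of `z^n` in `Φ_{n,m}` with respect to `[w^m, …, 1]ᵀ`. -/
noncomputable def leadCoeff (μ : Measure (Circle × Circle)) (n m : ℕ) :
    Matrix (Fin (m + 1)) (Fin (m + 1)) ℂ :=
  Matrix.of fun a b => cf (phi μ n m (m - a)) n (m - b)

/-- The coefficient of `w^m` in `Φ̃_{n,m}` with respect to `[z^n, …, 1]ᵀ`. -/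
noncomputable def leadCoeffTilde (μ : Measure (Circle × Circle)) (n m : ℕ) :
    Matrix (Fin (n + 1)) (Fin (n + 1)) ℂ :=
  Matrix.of fun a b => cf (phiTilde μ n m (n - a)) (n - b) m

/-- The parameters `u_{i,j}`, `i ∈ ℤ`, `j ≥ 0`: `u_{0,0} = 𝓛(1)`, `u_{i,0} = Ê_{i,0}`, `u_{0,j}` is
the tilde counterpart of the latter, `u_{i,j}` is the conjugate of the `(1,1)` entry of `𝒦¹_{i,j}`,
and `u_{-i,j}` is the last entry of `(Φ^{j-1}_{i,i})⁻¹ 𝒦_{i,j} ((Φ̃^{i-1}_{j,j})†)⁻¹`, except that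
`u_{-1,1} = 𝒦_{1,1}` (`i, j ≥ 1`). -/
noncomputable def u (μ : Measure (Circle × Circle)) : ℤ → ℕ → ℂ
  | .ofNat 0, 0 => functional μ (fun _ => 1)
  | .ofNat (i + 1), 0 => Ehat μ (i + 1) 0 0 0
  | .negSucc i, 0 => conj (Ehat μ (i + 1) 0 0 0)
  | .ofNat 0, j + 1 => EhatTilde μ 0 (j + 1) 0 0
  | .ofNat (i + 1), j + 1 => conj (K1 μ (i + 1) (j + 1) 0 0)
  | .negSucc i, j + 1 =>
      if i = 0 ∧ j = 0 then K μ (i + 1) (j + 1) (Fin.last j) (Fin.last i)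
      else ((leadCoeff μ (i + 1) j)⁻¹ * K μ (i + 1) (j + 1) *
        ((leadCoeffTilde μ i (j + 1)).conjTranspose)⁻¹) (Fin.last j) (Fin.last i)

/-! Well-definedness of the orthonormal polynomials -/

theorem continuous_onTorus (p : MvPolynomial (Fin 2) ℂ) : Continuous (onTorus p) := by
  suffices h : Continuous fun x : Circle × Circle => (![(x.1 : ℂ), (x.2 : ℂ)] : Fin 2 → ℂ) from
    (MvPolynomial.continuous_eval p).comp h
  refine continuous_pi fun i => ?_
  fin_cases i
  · exact continuous_subtype_val.comp continuous_fst
  · exact continuous_subtype_val.comp continuous_snd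

/-- The pairing of polynomials as a sesquilinear map, conjugate-linear in the second argument. -/
noncomputable def form (μ : Measure (Circle × Circle)) (p q : MvPolynomial (Fin 2) ℂ) : ℂ :=
  pairing μ (onTorus p) (onTorus q)

theorem integrable_form (μ : Measure (Circle × Circle)) [IsFiniteMeasure μ]
    (p q : MvPolynomial (Fin 2) ℂ) :
    Integrable (fun x => onTorus p x * conj (onTorus q x)) μ := by
  have hc : Continuous (fun x => onTorus p x * conj (onTorus q x)) :=
    (continuous_onTorus p).mul (Complex.continuous_conj.comp (continuous_onTorus q))
  rw [← integrableOn_univ]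
  exact hc.continuousOn.integrableOn_compact isCompact_univ

theorem form_add_left (μ : Measure (Circle × Circle)) [IsFiniteMeasure μ]
    (p p' q : MvPolynomial (Fin 2) ℂ) : form μ (p + p') q = form μ p q + form μ p' q := by
  have h : ∀ x, onTorus (p + p') x * conj (onTorus q x)
      = onTorus p x * conj (onTorus q x) + onTorus p' x * conj (onTorus q x) := fun x => by
    simp [onTorus, val, add_mul]
  simp only [form, pairing, functional, h]
  rw [integral_add (integrable_form μ p q) (integrable_form μ p' q), mul_add]

theorem form_smul_left (μ : Measure (Circle × Circle)) (c : ℂ)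
    (p q : MvPolynomial (Fin 2) ℂ) : form μ (c • p) q = c * form μ p q := by
  have h : ∀ x, onTorus (c • p) x * conj (onTorus q x)
      = c * (onTorus p x * conj (onTorus q x)) := fun x => by
    simp [onTorus, val, mul_assoc]
  simp only [form, pairing, functional, h]
  rw [integral_const_mul]
  ring

theorem form_conj (μ : Measure (Circle × Circle)) (p q : MvPolynomial (Fin 2) ℂ) :
    conj (form μ p q) = form μ q p := by
  simp only [form, pairing, functional, map_mul, ← integral_conj]
  simp [mul_comm, Complex.conj_ofNat]

theorem onTorus_monomial (i j : ℕ) :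
    onTorus (MvPolynomial.monomial (expo i j) 1) = mono i j := by
  funext x
  simp only [onTorus, val, mono, MvPolynomial.eval_monomial, expo, one_mul]
  rw [Finsupp.prod_add_index' (by simp) (by intros; simp [pow_add])]
  simp

theorem expo_injective {i j i' j' : ℕ} (h : expo i j = expo i' j') : (i, j) = (i', j') := by
  have h0 := DFunLike.congr_fun h 0
  have h1 := DFunLike.congr_fun h 1
  simp [expo] at h0 h1
  simp [h0, h1]

theorem ext_cf {p q : MvPolynomial (Fin 2) ℂ} (h : ∀ i j, cf p i j = cf q i j) : p = q := by
  ext e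
  have he : e = expo (e 0) (e 1) := by
    ext a; fin_cases a <;> simp [expo]
  rw [he]; exact h _ _

/-- A polynomial with exponents in `S` that is orthogonal to the monomials in `S` vanishes. -/
theorem eq_zero_of_orthogonal (μ : Measure (Circle × Circle)) [IsFiniteMeasure μ]
    (hμ : IsPosDef μ) (S : Finset (ℕ × ℕ)) (p : MvPolynomial (Fin 2) ℂ)
    (hS : ∀ i j, (i, j) ∉ S → cf p i j = 0)
    (ho : ∀ s ∈ S, form μ p (MvPolynomial.monomial (expo s.1 s.2) 1) = 0) : p = 0 := by
  classical
  have hp : p = ∑ s ∈ S, cf p s.1 s.2 • MvPolynomial.monomial (expo s.1 s.2) (1 : ℂ) := by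
    apply ext_cf
    intro i j
    have : ∀ s : ℕ × ℕ, expo s.1 s.2 = expo i j ↔ s = (i, j) := fun s =>
      ⟨fun h => expo_injective h, fun h => by rw [h]⟩
    simp only [cf, MvPolynomial.coeff_sum, MvPolynomial.coeff_smul, MvPolynomial.coeff_monomial,
      this]
    by_cases hij : (i, j) ∈ S
    · rw [Finset.sum_eq_single (i, j)] <;> simp_all
    · have := hS i j hij
      rw [Finset.sum_eq_zero]
      · exact this
      · intro s hs
        rw [if_neg (by rintro rfl; exact hij hs)]; simp
  by_contra hne
  have hpos := hμ p hne
  have hz : form μ p p = 0 := by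
    have hsum : ∀ T : Finset (ℕ × ℕ), T ⊆ S →
        form μ (∑ s ∈ T, cf p s.1 s.2 • MvPolynomial.monomial (expo s.1 s.2) (1 : ℂ)) p = 0 := by
      intro T
      induction T using Finset.induction_on with
      | empty =>
        intro _
        have := form_smul_left μ 0 0 p
        simpa using this
      | insert a T ha ih =>
        intro hT
        rw [Finset.sum_insert ha, form_add_left, form_smul_left,
          ih ((Finset.subset_insert a T).trans hT), ← form_conj,
          ho a (hT (Finset.mem_insert_self a T))]
        simp
    have := hsum S subset_rfl
    rwa [← hp] at this
  change 0 < (form μ p p).re at hpos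
  rw [hz] at hpos
  simp at hpos

/-- The orthonormal polynomials are well defined. -/
theorem existsUnique_isOrthonormalStep (μ : Measure (Circle × Circle)) [IsFiniteMeasure μ]
    (hμ : IsPosDef μ) (S : Finset (ℕ × ℕ)) (e : ℕ × ℕ) (he : e ∉ S) :
    ∃! φ, IsOrthonormalStep μ S e φ := by
  classical
  have hcm : ∀ (s : ℕ × ℕ) (i j : ℕ),
      cf (MvPolynomial.monomial (expo s.1 s.2) (1 : ℂ)) i j = if s = (i, j) then 1 else 0 := by
    intro s i j
    have : expo s.1 s.2 = expo i j ↔ s = (i, j) :=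
      ⟨fun h => expo_injective h, fun h => by rw [h]⟩
    simp only [cf, MvPolynomial.coeff_monomial, this]
  let P : (S → ℂ) →ₗ[ℂ] MvPolynomial (Fin 2) ℂ :=
    { toFun := fun c => ∑ s : S, c s • MvPolynomial.monomial (expo s.1.1 s.1.2) (1 : ℂ)
      map_add' := fun c d => by simp only [Pi.add_apply, add_smul, Finset.sum_add_distrib]
      map_smul' := fun a c => by
        simp only [Pi.smul_apply, smul_eq_mul, RingHom.id_apply, Finset.smul_sum, mul_smul] }
  have hP : ∀ c i j, cf (P c) i j = if h : (i, j) ∈ S then c ⟨(i, j), h⟩ else 0 := by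
    intro c i j
    have h1 : cf (P c) i j = ∑ s : S, c s *
        cf (MvPolynomial.monomial (expo s.1.1 s.1.2) (1 : ℂ)) i j := by
      simp [P, cf, MvPolynomial.coeff_sum]
    rw [h1]
    split_ifs with h
    · rw [Finset.sum_eq_single ⟨(i, j), h⟩]
      · rw [hcm]; simp
      · intro s _ hs
        rw [hcm, if_neg (fun h' => hs (Subtype.ext h'))]; simp
      · simp
    · refine Finset.sum_eq_zero fun s _ => ?_
      rw [hcm, if_neg (fun h' : s.1 = (i, j) => h (h' ▸ s.2))]; simp
  let T : (S → ℂ) →ₗ[ℂ] (S → ℂ) :=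
    { toFun := fun c s => form μ (P c) (MvPolynomial.monomial (expo s.1.1 s.1.2) 1)
      map_add' := fun c d => by
        funext s; simp only [map_add, form_add_left, Pi.add_apply]
      map_smul' := fun a c => by
        funext s; simp only [map_smul, form_smul_left, Pi.smul_apply, smul_eq_mul,
          RingHom.id_apply] }
  have hT : Function.Injective T := by
    rw [injective_iff_map_eq_zero]
    intro c hc
    have h0 : P c = 0 := by
      refine eq_zero_of_orthogonal μ hμ S _ (fun i j hij => ?_) (fun s hs => ?_)
      · rw [hP, dif_neg hij]
      · exact congrFun hc ⟨s, hs⟩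
    funext s
    have := hP c s.1.1 s.1.2
    rw [h0, dif_pos s.2] at this
    simpa [cf] using this.symm
  obtain ⟨c, hc⟩ := (LinearMap.injective_iff_surjective.mp hT)
    (fun s => form μ (MvPolynomial.monomial (expo e.1 e.2) 1)
      (MvPolynomial.monomial (expo s.1.1 s.1.2) 1))
  set q : MvPolynomial (Fin 2) ℂ :=
    MvPolynomial.monomial (expo e.1 e.2) 1 + (-1 : ℂ) • P c with hq
  have hqcf : ∀ i j, cf q i j = (if e = (i, j) then 1 else 0) - cf (P c) i j := by
    intro i j
    rw [← hcm]
    simp [hq, cf, sub_eq_add_neg]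
  have hqS : ∀ s ∈ S, form μ q (MvPolynomial.monomial (expo s.1 s.2) 1) = 0 := by
    intro s hs
    have := congrFun hc ⟨s, hs⟩
    rw [hq, form_add_left, form_smul_left]
    change form μ (P c) _ = _ at this
    rw [this]; ring
  have hqe : cf q e.1 e.2 = 1 := by rw [hqcf, hP]; simp [he]
  have hq0 : q ≠ 0 := by
    intro h; rw [h] at hqe; simp [cf] at hqe
  have hNpos : 0 < (form μ q q).re := hμ q hq0
  have hNre : form μ q q = ((form μ q q).re : ℂ) :=
    (Complex.conj_eq_iff_re.mp (form_conj μ q q)).symm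
  set N := (form μ q q).re
  set r : ℝ := (Real.sqrt N)⁻¹ with hr
  have hrpos : 0 < r := inv_pos.mpr (Real.sqrt_pos.mpr hNpos)
  have hrN : r * r * N = 1 := by
    rw [hr, ← mul_inv, Real.mul_self_sqrt hNpos.le, inv_mul_cancel₀ hNpos.ne']
  have hform : ∀ φ, (∀ s ∈ S, pairing μ (onTorus φ) (mono s.1 s.2) = 0) →
      ∀ s ∈ S, form μ φ (MvPolynomial.monomial (expo s.1 s.2) 1) = 0 := by
    intro φ h s hs
    rw [form, onTorus_monomial]; exact h s hs
  have hright : ∀ (a : ℝ) φ ψ, form μ φ ((a : ℂ) • ψ) = a * form μ φ ψ := by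
    intro a φ ψ
    rw [← form_conj, form_smul_left, map_mul, form_conj, Complex.conj_ofReal]
  refine ⟨(r : ℂ) • q, ⟨?_, ⟨r, hrpos, ?_⟩, ?_, ?_⟩, ?_⟩
  · intro i j hij hne
    have : cf q i j = 0 := by
      rw [hqcf, hP, dif_neg hij, if_neg (Ne.symm hne)]; simp
    simp only [cf, MvPolynomial.coeff_smul] at this ⊢
    rw [this]; simp
  · simp only [cf, MvPolynomial.coeff_smul] at hqe ⊢
    rw [hqe]; simp
  · intro s hs
    rw [← onTorus_monomial]
    change form μ _ _ = 0
    rw [form_smul_left, hqS s hs, mul_zero]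
  · change form μ _ _ = 1
    rw [form_smul_left, hright, hNre]
    rw [← mul_assoc]; exact_mod_cast hrN
  · rintro φ ⟨h1, ⟨k, hk, hke⟩, h3, h4⟩
    have hz : φ + (-(k : ℂ)) • q = 0 := by
      refine eq_zero_of_orthogonal μ hμ S _ (fun i j hij => ?_) (fun s hs => ?_)
      · by_cases hije : (i, j) = e
        · subst hije
          simp only [cf, MvPolynomial.coeff_add, MvPolynomial.coeff_smul] at hke hqe ⊢
          rw [hke, hqe]; simp
        · have a := h1 i j hij hije
          have b : cf q i j = 0 := by
            rw [hqcf, hP, dif_neg hij, if_neg (Ne.symm hije)]; simp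
          simp only [cf, MvPolynomial.coeff_add, MvPolynomial.coeff_smul] at a b ⊢
          rw [a, b]; simp
      · rw [form_add_left, form_smul_left, hqS s hs, hform φ h3 s hs]; simp
    have hφ : φ = (k : ℂ) • q := by
      rw [neg_smul] at hz; exact add_neg_eq_zero.mp hz
    change form μ φ φ = 1 at h4
    rw [hφ, form_smul_left, hright, hNre, ← mul_assoc] at h4
    have h5 : k * k * N = 1 := by exact_mod_cast h4
    have h6 : k = r := by
      have h7 : (k * k - r * r) * N = 0 := by linarith
      have h8 : k * k - r * r = 0 := (mul_eq_zero.mp h7).resolve_right hNpos.ne'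
      exact (mul_self_inj_of_nonneg hk.le hrpos.le).mp (by linarith)
    rw [hφ, h6]

end Bicircle

/-! Laurent polynomials with the inner product of μ form a space with a basis `e` indexed by ℤ × ℤ
whose Gram matrix is translation invariant (`IsStationary`). Apart from the passage to and from
measures, the argument takes place there. Let P_{i,j} be the span of the box 0 ≤ a ≤ i, 0 ≤ b ≤ j.
Then 𝒦_{i,j} = 0 says that P_{i,j-1} and P_{i-1,j} are orthogonal modulo P_{i-1,j-1} (`Decoupled`).
The vanishing of Ê_{i+1,j} says that z(P_{i,j} ⊖ P_{i-1,j}) is orthogonal to P_{i,j} (`ShiftsLex`,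
with mirror image `ShiftsRevlex`). For i, j ≥ 1, u_{i,j} = 0 is one relation between two leading
polynomials (`LeadOrthogonal`), and u_{-i,j} = 0 gives one relation between the residuals of z^i and
w^j (`MixedOrthogonal`).

Sufficiency. Let p be the leading orthonormal polynomial of degree (n, m). By induction over the
degrees, z^a w^b p is a leading polynomial of degree (n+a, m+b), and decoupling holds at every such
degree (`VanishingConditions.decoupled_and_sh`). At a new interior degree, stationarity and the
neighbouring degrees give all the orthogonality relations but one for the leading polynomial, which
is u_{i,j} = 0, and one for decoupling, which is u_{-i,j} = 0. Hence p is orthogonal to every z^a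
w^b with a < n or b < m, so its monomial multiples are orthonormal. Thus |p|² dμ has the moments of
Lebesgue measure, and a finite measure on the bicircle is determined by its moments. Stability of
the reverse needs only 𝒦_{n,m} = 0: the Christoffel–Darboux formula expresses |reverse of p|² - |p|²
through reproducing kernels, and at a zero in the closed bidisk positivity makes kernels vanish that
cannot vanish.

Necessity. Let q be the stable reverse of p. Cauchy's theorem for 1/q makes q orthogonal to every
monomial with a positive exponent, and the monomial multiples of q are orthonormal. These properties
(`IsBernsteinSzego`) survive an increase of (n, m), so each condition need only be proved at the
bounding degree or next to it. In the strip 0 ≤ a < n, q and its reverse give a Gohberg–Semencul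
type formula for vectors biorthogonal to the monomials, supported in |b| ≤ m. This banded structure
yields a Markov property: P_{n-1,m} ⊖ P_{n-1,m-1} is orthogonal to the whole strip below row m
(`revlexSpace_le_perp_strip`). In the adjacent column a = n the inner products form a bounded
solution of a recurrence with characteristic polynomial q(0, w), which has no zeros in the closed
disk, so they vanish too. Decoupling and the shift conditions follow; the remaining conditions come
directly from the orthogonality of q. -/

open Filter Topology

namespace Bicircle

/-! ### Stationary families indexed by `ℤ × ℤ` -/

section Stationary

variable {H : Type*} [NormedAddCommGroup H] [InnerProductSpace ℂ H]
  (e : Module.Basis (ℤ × ℤ) ℂ H)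

/-- The Gram matrix of `e` is invariant under translations. -/
def IsStationary : Prop :=
  ∀ s a b, inner ℂ (e (a + s)) (e (b + s)) = inner ℂ (e a) (e b)

/-- The span of the basis vectors with index in `S`. -/
def sp (S : Set (ℤ × ℤ)) : Submodule ℂ H := Submodule.span ℂ (e '' S)

/-- The vectors orthogonal to the basis vectors with index in `S`. -/
noncomputable def perp (S : Set (ℤ × ℤ)) : Submodule ℂ H := (sp e S)ᗮ

/-- The orthogonal complement of `sp e T` in `sp e S`. -/
noncomputable def inn (S T : Set (ℤ × ℤ)) : Submodule ℂ H := sp e S ⊓ perp e T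

variable {e}

theorem mem_sp {S : Set (ℤ × ℤ)} {f : H} : f ∈ sp e S ↔ ∀ s, s ∉ S → e.repr f s = 0 := by
  rw [sp, Module.Basis.mem_span_image]
  constructor
  · intro h s hs
    by_contra h0
    exact hs (h (by simpa using h0))
  · intro h s hs
    by_contra h0
    exact (by simpa using hs : e.repr f s ≠ 0) (h s h0)

theorem mem_perp {S : Set (ℤ × ℤ)} {f : H} :
    f ∈ perp e S ↔ ∀ s ∈ S, inner ℂ (e s) f = 0 := by
  rw [perp, Submodule.mem_orthogonal]
  constructor
  · intro h s hs
    exact h _ (Submodule.subset_span ⟨s, hs, rfl⟩)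
  · intro h u hu
    induction hu using Submodule.span_induction with
    | mem x hx => obtain ⟨s, hs, rfl⟩ := hx; exact h s hs
    | zero => simp
    | add x y _ _ hx hy => rw [inner_add_left, hx, hy, add_zero]
    | smul c x _ hx => rw [inner_smul_left, hx, mul_zero]

theorem inner_eq_zero_of_perp {S : Set (ℤ × ℤ)} {f g : H} (hf : f ∈ perp e S)
    (hg : g ∈ sp e S) : inner ℂ g f = 0 :=
  (Submodule.mem_orthogonal _ _).1 hf g hg

theorem inner_eq_zero_of_perp' {S : Set (ℤ × ℤ)} {f g : H} (hf : f ∈ perp e S)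
    (hg : g ∈ sp e S) : inner ℂ f g = 0 :=
  (Submodule.mem_orthogonal' _ _).1 hf g hg

theorem mem_sp_self {S : Set (ℤ × ℤ)} {s : ℤ × ℤ} (hs : s ∈ S) : e s ∈ sp e S :=
  Submodule.subset_span ⟨s, hs, rfl⟩

theorem sp_mono {S T : Set (ℤ × ℤ)} (h : S ⊆ T) : sp e S ≤ sp e T :=
  Submodule.span_mono (Set.image_mono h)

theorem perp_anti {S T : Set (ℤ × ℤ)} (h : S ⊆ T) : perp e T ≤ perp e S :=
  Submodule.orthogonal_le (sp_mono h)

theorem perp_union {S T U : Set (ℤ × ℤ)} {f : H} (hU : U ⊆ S ∪ T) (hS : f ∈ perp e S)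
    (hT : f ∈ perp e T) : f ∈ perp e U := by
  rw [mem_perp] at *
  exact fun s hs => (hU hs).elim (hS s) (hT s)

theorem eq_zero_of_mem_of_perp {S : Set (ℤ × ℤ)} {f : H} (h : f ∈ sp e S)
    (h' : f ∈ perp e S) : f = 0 :=
  inner_self_eq_zero.1 (inner_eq_zero_of_perp h' h)

theorem exists_add_of_mem_union {S T U : Set (ℤ × ℤ)} {f : H} (hU : U ⊆ S ∪ T)
    (h : f ∈ sp e U) : ∃ x ∈ sp e S, ∃ y ∈ sp e T, x + y = f := by
  have := sp_mono hU h
  rw [sp, Set.image_union, Submodule.span_union, Submodule.mem_sup] at this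
  exact this

theorem finiteDimensional_sp {S : Set (ℤ × ℤ)} (hS : S.Finite) : FiniteDimensional ℂ (sp e S) :=
  FiniteDimensional.span_of_finite ℂ (hS.image e)

theorem exists_residual {S : Set (ℤ × ℤ)} (hS : S.Finite) (f : H) :
    ∃ g ∈ sp e S, f - g ∈ perp e S := by
  have := finiteDimensional_sp (e := e) hS
  obtain ⟨y, hy, z, hz, h⟩ := Submodule.exists_add_mem_mem_orthogonal (K := sp e S) f
  exact ⟨y, hy, by rw [h, add_sub_cancel_left]; exact hz⟩

/-! ### Translations and reversals of the index lattice -/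

variable (e)

/-- The translation `e a ↦ e (a + s)`. -/
noncomputable def sh (s : ℤ × ℤ) : H →ₗ[ℂ] H := e.constr ℂ fun a => e (a + s)

/-- The reversal `∑ c_a e a ↦ ∑ conj c_a e (N - a)`. -/
noncomputable def rev (N : ℤ × ℤ) (f : H) : H :=
  (e.repr f).sum fun a c => conj c • e (N - a)

variable {e}

@[simp] theorem sh_basis (s a : ℤ × ℤ) : sh e s (e a) = e (a + s) := by simp [sh]

theorem induction_basis (P : H → Prop) (h0 : P 0) (hadd : ∀ f g, P f → P g → P (f + g))
    (hs : ∀ (c : ℂ) a, P (c • e a)) (f : H) : P f := by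
  rw [← e.linearCombination_repr f]
  induction e.repr f using Finsupp.induction_linear with
  | zero => simpa using h0
  | add f g hf hg => rw [map_add]; exact hadd _ _ hf hg
  | single a c => rw [Finsupp.linearCombination_single]; exact hs c a

theorem repr_sh (s a : ℤ × ℤ) (f : H) : e.repr (sh e s f) a = e.repr f (a - s) := by
  induction f using induction_basis (e := e) with
  | h0 => simp
  | hadd f g hf hg => simp [hf, hg]
  | hs c b =>
    simp only [map_smul, sh_basis, Module.Basis.repr_self, Finsupp.smul_apply,
      Finsupp.single_apply, eq_sub_iff_add_eq]

theorem sh_sh (s t : ℤ × ℤ) (f : H) : sh e s (sh e t f) = sh e (s + t) f := by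
  apply e.ext_elem; intro a
  rw [repr_sh, repr_sh, repr_sh, sub_sub]

@[simp] theorem sh_zero (f : H) : sh e 0 f = f := by
  apply e.ext_elem; intro a
  rw [repr_sh, sub_zero]

theorem rev_zero (N : ℤ × ℤ) : rev e N 0 = 0 := by simp [rev]

theorem rev_add (N : ℤ × ℤ) (f g : H) : rev e N (f + g) = rev e N f + rev e N g := by
  rw [rev, map_add, Finsupp.sum_add_index'] <;> simp [rev, add_smul]

theorem rev_smul (N : ℤ × ℤ) (c : ℂ) (f : H) : rev e N (c • f) = conj c • rev e N f := by
  rw [rev, map_smul, Finsupp.sum_smul_index (by simp), rev, Finsupp.smul_sum]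
  simp [mul_smul]

@[simp] theorem rev_basis (N a : ℤ × ℤ) : rev e N (e a) = e (N - a) := by
  rw [rev, Module.Basis.repr_self, Finsupp.sum_single_index] <;> simp

theorem repr_rev (N a : ℤ × ℤ) (f : H) : e.repr (rev e N f) a = conj (e.repr f (N - a)) := by
  induction f using induction_basis (e := e) with
  | h0 => simp [rev_zero]
  | hadd f g hf hg => simp [rev_add, hf, hg]
  | hs c b =>
    simp only [rev_smul, rev_basis, map_smul, Module.Basis.repr_self, Finsupp.smul_apply,
      Finsupp.single_apply, smul_eq_mul, map_mul]
    have : N - b = a ↔ b = N - a := by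
      constructor <;> (rintro rfl; simp)
    simp only [this]; split_ifs <;> simp

theorem rev_rev (N : ℤ × ℤ) (f : H) : rev e N (rev e N f) = f := by
  apply e.ext_elem; intro a
  simp [repr_rev]

theorem rev_sh (N s : ℤ × ℤ) (f : H) : rev e N (sh e s f) = rev e (N - s) f := by
  apply e.ext_elem; intro a
  rw [repr_rev, repr_sh, repr_rev, sub_right_comm]

theorem sh_rev (N s : ℤ × ℤ) (f : H) : sh e s (rev e N f) = rev e (N + s) f := by
  apply e.ext_elem; intro a
  rw [repr_rev, repr_sh, repr_rev]
  congr 2; abel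

theorem inner_sh (he : IsStationary e) (s : ℤ × ℤ) (f g : H) :
    inner ℂ (sh e s f) (sh e s g) = inner ℂ f g := by
  induction f using induction_basis (e := e) with
  | h0 => simp
  | hadd f f' hf hf' => simp [hf, hf']
  | hs c a =>
    induction g using induction_basis (e := e) with
    | h0 => simp
    | hadd f f' hf hf' => rw [map_add, inner_add_right, hf, hf', inner_add_right]
    | hs d b => simp only [map_smul, sh_basis, inner_smul_left, inner_smul_right, he s a b]

theorem inner_sh_left (he : IsStationary e) (s : ℤ × ℤ) (f g : H) :
    inner ℂ (sh e s f) g = inner ℂ f (sh e (-s) g) := by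
  rw [← inner_sh he s f, sh_sh, add_neg_cancel, sh_zero]

/-- Reversal is antiunitary: translation by a + b - N carries N - a and N - b to b and a, so on
basis vectors reversal exchanges the two arguments. -/
theorem inner_rev (he : IsStationary e) (N : ℤ × ℤ) (f g : H) :
    inner ℂ (rev e N f) (rev e N g) = inner ℂ g f := by
  induction f using induction_basis (e := e) with
  | h0 => simp [rev_zero]
  | hadd f f' hf hf' => rw [rev_add, inner_add_left, hf, hf', inner_add_right]
  | hs c a =>
    induction g using induction_basis (e := e) with
    | h0 => simp [rev_zero]
    | hadd f f' hf hf' => rw [rev_add, inner_add_right, hf, hf', inner_add_left]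
    | hs d b =>
      simp only [rev_smul, rev_basis, inner_smul_left, inner_smul_right]
      rw [← he (a + b - N) (N - a) (N - b)]
      have h1 : N - a + (a + b - N) = b := by abel
      have h2 : N - b + (a + b - N) = a := by abel
      rw [h1, h2]; simp; ring

theorem norm_sh (he : IsStationary e) (s : ℤ × ℤ) (f : H) : ‖sh e s f‖ = ‖f‖ := by
  rw [@norm_eq_sqrt_re_inner ℂ, @norm_eq_sqrt_re_inner ℂ, inner_sh he]

theorem sh_mem_sp {S T : Set (ℤ × ℤ)} {s : ℤ × ℤ} {f : H} (hf : f ∈ sp e S)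
    (h : ∀ a ∈ S, a + s ∈ T) : sh e s f ∈ sp e T := by
  rw [mem_sp] at *
  intro a ha
  rw [repr_sh]
  refine hf _ fun h' => ha ?_
  simpa using h _ h'

theorem sh_mem_perp (he : IsStationary e) {S T : Set (ℤ × ℤ)} {s : ℤ × ℤ} {f : H}
    (hf : f ∈ perp e S) (h : ∀ a ∈ T, a - s ∈ S) : sh e s f ∈ perp e T := by
  rw [mem_perp] at *
  intro a ha
  rw [← hf _ (h a ha), ← inner_sh he s (e (a - s)), sh_basis, sub_add_cancel]

theorem rev_mem_sp {S T : Set (ℤ × ℤ)} {N : ℤ × ℤ} {f : H} (hf : f ∈ sp e S)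
    (h : ∀ a ∈ S, N - a ∈ T) : rev e N f ∈ sp e T := by
  rw [mem_sp] at *
  intro a ha
  rw [repr_rev, hf _ fun h' => ha ?_, map_zero]
  simpa using h _ h'

theorem rev_mem_perp (he : IsStationary e) {S T : Set (ℤ × ℤ)} {N : ℤ × ℤ} {f : H}
    (hf : f ∈ perp e S) (h : ∀ a ∈ T, N - a ∈ S) : rev e N f ∈ perp e T := by
  rw [mem_perp] at *
  intro a ha
  have : e a = rev e N (e (N - a)) := by simp
  rw [this, inner_rev he, ← inner_conj_symm, hf _ (h a ha), map_zero]

/-- If translation by `s` maps `inn e T T₀` to vectors orthogonal to `S₀`, then it maps onto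
`inn e S S₀` as soon as it maps `T \ T₀` onto `S \ S₀`. -/
theorem exists_sh_eq {S S₀ T T₀ : Set (ℤ × ℤ)} {s : ℤ × ℤ}
    (hT₀f : T₀.Finite) (hT₀T : T₀ ⊆ T) (hS : ∀ a ∈ S, a ∈ S₀ ∨ a - s ∈ T)
    (hTS : ∀ a ∈ T₀, a + s ∈ S₀)
    (h : ∀ f ∈ inn e T T₀, sh e s f ∈ perp e S₀) {f : H} (hf : f ∈ inn e S S₀) :
    ∃ g ∈ inn e T T₀, sh e s g = f := by
  obtain ⟨y, hy, x, hx, rfl⟩ := exists_add_of_mem_union (S := S₀) (T := {a | a - s ∈ T})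
    (fun a ha => hS a ha) hf.1
  -- The residual of the translated-back `x` is the candidate. Its translate and `y + x` are both
  -- orthogonal to `S₀` and differ by an element of `sp e S₀`, so they agree.
  obtain ⟨g, hg, hg'⟩ := exists_residual (e := e) hT₀f (sh e (-s) x)
  have hx' : sh e (-s) x ∈ sp e T := sh_mem_sp hx (fun a ha => by simpa [sub_eq_add_neg] using ha)
  have hm : sh e (-s) x - g ∈ inn e T T₀ := ⟨sub_mem hx' (sp_mono hT₀T hg), hg'⟩
  refine ⟨_, hm, ?_⟩
  have h1 := h _ hm
  have h2 : sh e s (sh e (-s) x - g) = x - sh e s g := by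
    rw [map_sub, sh_sh]; simp
  have h3 : (y + x) - (x - sh e s g) = 0 := by
    refine eq_zero_of_mem_of_perp (e := e) (S := S₀) ?_ (sub_mem hf.2 (h2 ▸ h1))
    have : (y + x) - (x - sh e s g) = y + sh e s g := by abel
    rw [this]
    exact add_mem hy (sh_mem_sp hg hTS)
  rw [h2]; exact (sub_eq_zero.1 h3).symm

/-! ### Boxes -/

/-- The index set `0 ≤ a ≤ i`, `0 ≤ b ≤ j`. -/
def box (i j : ℤ) : Set (ℤ × ℤ) := {s | 0 ≤ s.1 ∧ s.1 ≤ i ∧ 0 ≤ s.2 ∧ s.2 ≤ j}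

theorem mem_box {i j : ℤ} {s : ℤ × ℤ} :
    s ∈ box i j ↔ 0 ≤ s.1 ∧ s.1 ≤ i ∧ 0 ≤ s.2 ∧ s.2 ≤ j := Iff.rfl

theorem finite_box (i j : ℤ) : (box i j).Finite :=
  (Set.finite_Icc (0 : ℤ × ℤ) (i, j)).subset fun _ hs =>
    ⟨⟨hs.1, hs.2.2.1⟩, ⟨hs.2.1, hs.2.2.2⟩⟩

theorem box_mono {i j i' j' : ℤ} (hi : i ≤ i') (hj : j ≤ j') : box i j ⊆ box i' j' :=
  fun _ hs => ⟨hs.1, hs.2.1.trans hi, hs.2.2.1, hs.2.2.2.trans hj⟩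

variable (e)

/-- `P_{i,j} ⊖ P_{i-1,j}`. -/
noncomputable def lexSpace (i j : ℤ) : Submodule ℂ H := inn e (box i j) (box (i - 1) j)

/-- `P_{i,j} ⊖ P_{i,j-1}`. -/
noncomputable def revlexSpace (i j : ℤ) : Submodule ℂ H := inn e (box i j) (box i (j - 1))

/-- The part of `P_{i,j}` orthogonal to all monomials but the leading one. -/
noncomputable def leadSpace (i j : ℤ) : Submodule ℂ H := inn e (box i j) (box i j \ {(i, j)})

/-- `P_{i,j-1} ⊖ P_{i-1,j-1}` is orthogonal to `P_{i-1,j}`. -/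
def Decoupled (i j : ℤ) : Prop := ∀ f ∈ lexSpace e i (j - 1), f ∈ perp e (box (i - 1) j)

/-- `z (P_{i,j} ⊖ P_{i-1,j})` is orthogonal to `P_{i,j}`. -/
def ShiftsLex (i j : ℤ) : Prop := ∀ f ∈ lexSpace e i j, sh e (1, 0) f ∈ perp e (box i j)

/-- `w (P_{i,j} ⊖ P_{i,j-1})` is orthogonal to `P_{i,j}`. -/
def ShiftsRevlex (i j : ℤ) : Prop := ∀ f ∈ revlexSpace e i j, sh e (0, 1) f ∈ perp e (box i j)

variable {e}

/-- Decoupling says that two complements of P_{i-1,j-1}, in P_{i,j-1} and in P_{i-1,j}, are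
orthogonal, and this is symmetric. A monomial is tested through its residual against the common part
P_{i-1,j-1}. -/
theorem Decoupled.symm {i j : ℤ} (h : Decoupled e i j) :
    ∀ g ∈ revlexSpace e (i - 1) j, g ∈ perp e (box i (j - 1)) := by
  intro g hg
  rw [mem_perp]
  intro s hs
  obtain ⟨x, hx, hx'⟩ := exists_residual (e := e) (finite_box (i - 1) (j - 1)) (e s)
  have h1 : e s - x ∈ lexSpace e i (j - 1) :=
    ⟨sub_mem (mem_sp_self hs) (sp_mono (box_mono (by omega) le_rfl) hx), hx'⟩
  have h2 := inner_eq_zero_of_perp' (h _ h1) hg.1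
  have h3 := inner_eq_zero_of_perp hg.2 hx
  rwa [inner_sub_left, h3, sub_zero] at h2

theorem decoupled_of_symm {i j : ℤ} (h : ∀ g ∈ revlexSpace e (i - 1) j, g ∈ perp e (box i (j - 1))) :
    Decoupled e i j := by
  intro g hg
  rw [mem_perp]
  intro s hs
  obtain ⟨x, hx, hx'⟩ := exists_residual (e := e) (finite_box (i - 1) (j - 1)) (e s)
  have h1 : e s - x ∈ revlexSpace e (i - 1) j :=
    ⟨sub_mem (mem_sp_self hs) (sp_mono (box_mono le_rfl (by omega)) hx), hx'⟩
  have h2 := inner_eq_zero_of_perp' (h _ h1) hg.1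
  have h3 := inner_eq_zero_of_perp hg.2 hx
  rwa [inner_sub_left, h3, sub_zero] at h2

/-! ### Exchanging the two coordinates -/

variable (e)

/-- The basis with the two coordinates of the index exchanged. -/
noncomputable def swapped : Module.Basis (ℤ × ℤ) ℂ H := e.reindex (Equiv.prodComm ℤ ℤ)

variable {e}

@[simp] theorem swapped_apply (s : ℤ × ℤ) : swapped e s = e s.swap := by
  simp [swapped]

theorem repr_swapped (f : H) (s : ℤ × ℤ) : (swapped e).repr f s = e.repr f s.swap := by
  rw [swapped, Module.Basis.repr_reindex_apply]; rfl

theorem IsStationary.swapped (he : IsStationary e) : IsStationary (swapped e) := by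
  intro s a b
  simpa using he s.swap a.swap b.swap

theorem sp_swapped (S : Set (ℤ × ℤ)) : sp (swapped e) S = sp e (Prod.swap ⁻¹' S) := by
  ext f
  rw [mem_sp, mem_sp]
  constructor
  · intro h s hs
    simpa [repr_swapped] using h s.swap hs
  · intro h s hs
    rw [repr_swapped]; exact h _ (by simpa using hs)

theorem perp_swapped (S : Set (ℤ × ℤ)) : perp (swapped e) S = perp e (Prod.swap ⁻¹' S) := by
  rw [perp, sp_swapped, perp]

theorem inn_swapped (S T : Set (ℤ × ℤ)) :
    inn (swapped e) S T = inn e (Prod.swap ⁻¹' S) (Prod.swap ⁻¹' T) := by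
  rw [inn, sp_swapped, perp_swapped, inn]

theorem swap_box (i j : ℤ) : Prod.swap ⁻¹' box i j = box j i := by
  ext s; simp only [box, Set.mem_preimage, Set.mem_ofPred_eq, Prod.fst_swap, Prod.snd_swap]
  tauto

theorem lexSpace_swapped (i j : ℤ) : lexSpace (swapped e) i j = revlexSpace e j i := by
  rw [lexSpace, revlexSpace, inn_swapped, swap_box, swap_box]

theorem revlexSpace_swapped (i j : ℤ) : revlexSpace (swapped e) i j = lexSpace e j i := by
  rw [lexSpace, revlexSpace, inn_swapped, swap_box, swap_box]

theorem leadSpace_swapped (i j : ℤ) : leadSpace (swapped e) i j = leadSpace e j i := by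
  rw [leadSpace, leadSpace, inn_swapped, Set.preimage_sdiff, swap_box]
  congr 2
  ext s
  simp [Prod.ext_iff, and_comm]

theorem sh_swapped (s : ℤ × ℤ) (f : H) : sh (swapped e) s f = sh e s.swap f := by
  apply e.ext_elem; intro a
  rw [repr_sh, ← Prod.swap_swap a, ← repr_swapped, repr_sh, repr_swapped]
  simp

theorem rev_swapped (s : ℤ × ℤ) (f : H) : rev (swapped e) s f = rev e s.swap f := by
  apply e.ext_elem; intro a
  rw [repr_rev, ← Prod.swap_swap a, ← repr_swapped, repr_rev, repr_swapped]
  simp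

theorem decoupled_swapped {i j : ℤ} : Decoupled (swapped e) i j ↔ Decoupled e j i := by
  constructor
  · intro h
    refine decoupled_of_symm fun g hg => ?_
    have := h g (by rwa [lexSpace_swapped])
    rwa [perp_swapped, swap_box] at this
  · intro h f hf
    rw [perp_swapped, swap_box]
    rw [lexSpace_swapped] at hf
    exact h.symm f hf

theorem shiftsLex_swapped {i j : ℤ} : ShiftsLex (swapped e) i j ↔ ShiftsRevlex e j i := by
  simp only [ShiftsLex, ShiftsRevlex, lexSpace_swapped, sh_swapped, perp_swapped, swap_box, Prod.swap]

theorem shiftsRevlex_swapped {i j : ℤ} : ShiftsRevlex (swapped e) i j ↔ ShiftsLex e j i := by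
  simp only [ShiftsLex, ShiftsRevlex, revlexSpace_swapped, sh_swapped, perp_swapped, swap_box, Prod.swap]

end Stationary

section Stationary

variable {H : Type*} [NormedAddCommGroup H] [InnerProductSpace ℂ H]
  {e : Module.Basis (ℤ × ℤ) ℂ H}

/-! ### Leading polynomials -/

theorem mem_sp_diff {S : Set (ℤ × ℤ)} {s : ℤ × ℤ} {f : H} (hf : f ∈ sp e S)
    (h : e.repr f s = 0) : f ∈ sp e (S \ {s}) := by
  rw [mem_sp] at *
  intro t ht
  by_cases hts : t = s
  · rw [hts, h]
  · exact hf t fun h' => ht ⟨h', hts⟩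

theorem exists_leadSpace {i j : ℤ} (hi : 0 ≤ i) (hj : 0 ≤ j) :
    ∃ p ∈ leadSpace e i j, e.repr p (i, j) = 1 := by
  obtain ⟨x, hx, hx'⟩ := exists_residual (e := e) ((finite_box i j).sdiff (t := {(i, j)})) (e (i, j))
  refine ⟨e (i, j) - x, ⟨sub_mem (mem_sp_self ⟨hi, le_rfl, hj, le_rfl⟩)
    (sp_mono Set.sdiff_subset hx), hx'⟩, ?_⟩
  rw [mem_sp] at hx
  rw [map_sub, Finsupp.sub_apply, hx (i, j) (by simp)]
  simp

/-- A member without the monomial z^i w^j is orthogonal to itself, so the leading space is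
one-dimensional. -/
theorem eq_smul_of_mem_leadSpace {i j : ℤ} {p f : H} (hp : p ∈ leadSpace e i j) (h0 : p ≠ 0)
    (hf : f ∈ leadSpace e i j) : ∃ c : ℂ, f = c • p := by
  have key : ∀ g ∈ leadSpace e i j, e.repr g (i, j) = 0 → g = 0 := fun g hg h =>
    eq_zero_of_mem_of_perp (mem_sp_diff hg.1 h) hg.2
  have hk : e.repr p (i, j) ≠ 0 := fun h => h0 (key p hp h)
  refine ⟨e.repr f (i, j) / e.repr p (i, j), sub_eq_zero.1 (key _ (sub_mem hf
    (Submodule.smul_mem _ _ hp)) ?_)⟩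
  simp [hk]

variable (e)

/-- `w` times the leading polynomials of degree `(i, j-1)` are orthogonal to the reverses of those
of degree `(i-1, j)`. -/
def LeadOrthogonal (i j : ℤ) : Prop :=
  ∀ p ∈ leadSpace e i (j - 1), ∀ p' ∈ leadSpace e (i - 1) j,
    inner ℂ (rev e (i - 1, j) p') (sh e (0, 1) p) = 0

/-- The residuals of `z^i` and `w^j` with respect to `P_{i-1,j-1}` are orthogonal. -/
def MixedOrthogonal (i j : ℤ) : Prop :=
  ∀ f ∈ perp e (box (i - 1) (j - 1)), ∀ g ∈ perp e (box (i - 1) (j - 1)),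
    f - e (i, 0) ∈ sp e (box (i - 1) (j - 1)) → g - e (0, j) ∈ sp e (box (i - 1) (j - 1)) →
    inner ℂ g f = 0

variable {e}

/-- Reversal at (i, j) turns w p into the reverse of p and the reverse of p' into z p', which is the
same relation with the coordinates exchanged. -/
theorem LeadOrthogonal.swapped (he : IsStationary e) {i j : ℤ} (h : LeadOrthogonal e i j) :
    LeadOrthogonal (swapped e) j i := by
  intro p hp p' hp'
  rw [leadSpace_swapped] at hp hp'
  have h1 := h p' hp' p hp
  rw [← inner_rev he (i, j), rev_sh] at h1
  have h2 : rev e (i - 1, j) p = rev e (i, j) (sh e (1, 0) p) := by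
    rw [rev_sh]; congr 1; simp
  rw [h2, rev_rev] at h1
  rw [sh_swapped, rev_swapped]
  simpa using h1

theorem MixedOrthogonal.swapped {i j : ℤ} (h : MixedOrthogonal e i j) :
    MixedOrthogonal (swapped e) j i := by
  intro f hf g hg hf' hg'
  rw [perp_swapped, swap_box] at hf hg
  rw [sp_swapped, swap_box] at hf' hg'
  have := h g hg f hf (by simpa using hg') (by simpa using hf')
  rw [← inner_conj_symm, this, map_zero]

/-- The reverse of a monic leading polynomial of degree (i-1, j) is 1 plus other monomials of its
box. Once w p is orthogonal to those, `LeadOrthogonal` amounts to orthogonality to 1. -/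
theorem LeadOrthogonal.inner_basis_zero {i j : ℤ} (h : LeadOrthogonal e i j) (hi : 1 ≤ i)
    (hj : 0 ≤ j) {p : H} (hp : p ∈ leadSpace e i (j - 1))
    (h' : sh e (0, 1) p ∈ perp e (box (i - 1) j \ {0})) :
    inner ℂ (e 0) (sh e (0, 1) p) = 0 := by
  obtain ⟨p', hp', hp1⟩ := exists_leadSpace (e := e) (i := i - 1) (j := j) (by omega) hj
  have h1 := h p hp p' hp'
  have h2 : rev e (i - 1, j) p' - e 0 ∈ sp e (box (i - 1) j \ {0}) := by
    refine mem_sp_diff (sub_mem (rev_mem_sp hp'.1 fun s hs => ?_) (mem_sp_self ?_)) ?_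
    · simp only [mem_box, Prod.fst_sub, Prod.snd_sub] at *; omega
    · simp only [mem_box, Prod.fst_zero, Prod.snd_zero]; omega
    · simp [repr_rev, hp1]
  have h4 := inner_eq_zero_of_perp h' h2
  rwa [inner_sub_left, h1, zero_sub, neg_eq_zero] at h4

/-- Multiplication by `w` maps leading polynomials to leading polynomials. -/
theorem sh_mem_leadSpace (he : IsStationary e) {i j : ℤ} (hi : 0 ≤ i) (hj : 0 ≤ j)
    (hK : Decoupled e i (j + 1)) (hB : ShiftsRevlex e (i - 1) j)
    (hU : 1 ≤ i → LeadOrthogonal e i (j + 1)) (h0 : i = 0 → ShiftsRevlex e 0 j) {p : H}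
    (hp : p ∈ leadSpace e i j) : sh e (0, 1) p ∈ leadSpace e i (j + 1) := by
  have hsp : sh e (0, 1) p ∈ sp e {s | s.1 ≤ i ∧ 0 ≤ s.1 ∧ 1 ≤ s.2 ∧ s.2 ≤ j + 1} := by
    refine sh_mem_sp hp.1 fun s hs => ?_
    simp only [mem_box, Set.mem_ofPred_eq, Prod.fst_add, Prod.snd_add] at *
    omega
  refine ⟨sp_mono (fun s hs => ?_) hsp, ?_⟩
  · simp only [mem_box, Set.mem_ofPred_eq] at *; omega
  -- Stationarity alone handles the monomials divisible by w; only the bottom row b = 0 remains.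
  have hup : sh e (0, 1) p ∈ perp e {s | s.1 ≤ i ∧ 0 ≤ s.1 ∧ 1 ≤ s.2 ∧ s.2 ≤ j + 1 ∧
      s ≠ (i, j + 1)} := by
    refine sh_mem_perp he hp.2 fun s hs => ?_
    obtain ⟨a, b⟩ := s
    simp only [mem_box, Set.mem_ofPred_eq, Set.mem_sdiff, Set.mem_singleton_iff, ne_eq,
      Prod.mk.injEq, Prod.mk_sub_mk] at *
    omega
  rcases eq_or_lt_of_le hi with hi0 | hi1
  · subst hi0
    refine perp_union (S := box 0 j) ?_ (h0 rfl p ⟨hp.1, perp_anti ?_ hp.2⟩) hup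
    · rintro ⟨a, b⟩ hs
      simp only [mem_box, Set.mem_ofPred_eq, Set.mem_sdiff, Set.mem_singleton_iff, ne_eq,
        Prod.mk.injEq, Set.mem_union] at *
      omega
    · rintro ⟨a, b⟩ hs
      simp only [mem_box, Set.mem_sdiff, Set.mem_singleton_iff, Prod.mk.injEq] at *
      omega
  -- The bottom row without its corner. Let g be the residual of z^a against rows 1, …, j. Its
  -- reverse lies in P_{i-1,j} ⊖ P_{i-1,j-1}, `hB` moves w times it to level j + 1, and there `hK`
  -- makes it orthogonal to P_{i,j}. Reversing back, z g is orthogonal to rows 1, …, j + 1, hence to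
  -- w p, and the correction z x is orthogonal to w p by `hup`.
  have hbot : ∀ a, 0 ≤ a → a ≤ i - 1 → inner ℂ (e (a + 1, 0)) (sh e (0, 1) p) = 0 := by
    intro a ha ha'
    set S : Set (ℤ × ℤ) := {s | 0 ≤ s.1 ∧ s.1 ≤ i - 1 ∧ 1 ≤ s.2 ∧ s.2 ≤ j} with hS
    have hSsub : S ⊆ box (i - 1) j := fun s hs => by
      simp only [mem_box, hS, Set.mem_ofPred_eq] at *; omega
    obtain ⟨x, hx, hx'⟩ := exists_residual (e := e) ((finite_box _ _).subset hSsub) (e (a, 0))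
    have hg : e (a, 0) - x ∈ sp e (box (i - 1) j) :=
      sub_mem (mem_sp_self ⟨ha, ha', le_rfl, hj⟩) (sp_mono hSsub hx)
    set g := e (a, 0) - x with hgdef
    have hf : rev e (i - 1, j) g ∈ revlexSpace e (i - 1) j := by
      refine ⟨rev_mem_sp hg fun s hs => ?_, rev_mem_perp he hx' fun s hs => ?_⟩ <;>
      · simp only [mem_box, hS, Set.mem_ofPred_eq, Prod.fst_sub, Prod.snd_sub] at *
        omega
    have hVf : sh e (0, 1) (rev e (i - 1, j) g) ∈ revlexSpace e (i - 1) (j + 1) := by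
      refine ⟨sh_mem_sp hf.1 fun s hs => ?_, ?_⟩
      · simp only [mem_box, Prod.fst_add, Prod.snd_add] at *; omega
      · rw [add_sub_cancel_right]; exact hB _ hf
    have h1 := hK.symm _ hVf
    rw [add_sub_cancel_right] at h1
    have h2 := rev_mem_perp he (N := (i, j + 1)) (T := {s | s.1 ≤ i ∧ 0 ≤ s.1 ∧ 1 ≤ s.2 ∧
      s.2 ≤ j + 1}) h1 fun s hs => by
        simp only [mem_box, Set.mem_ofPred_eq, Prod.fst_sub, Prod.snd_sub] at *; omega
    have h3 : rev e (i, j + 1) (sh e (0, 1) (rev e (i - 1, j) g)) = sh e (1, 0) g := by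
      rw [rev_sh]
      have : (i, j + 1) - ((0, 1) : ℤ × ℤ) = (i - 1, j) + (1, 0) := by simp
      rw [this, ← sh_rev, rev_rev]
    rw [h3] at h2
    have h4 := inner_eq_zero_of_perp' h2 hsp
    have h5 : inner ℂ (sh e (1, 0) x) (sh e (0, 1) p) = 0 := by
      refine inner_eq_zero_of_perp hup (sh_mem_sp hx fun s hs => ?_)
      obtain ⟨c, d⟩ := s
      simp only [hS, Set.mem_ofPred_eq, ne_eq, Prod.mk.injEq, Prod.mk_add_mk] at *; omega
    rw [hgdef, map_sub, inner_sub_left, h5, sub_zero, sh_basis] at h4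
    simpa using h4
  have hne : ∀ s ∈ box i (j + 1), s ≠ (i, j + 1) → s ≠ 0 →
      inner ℂ (e s) (sh e (0, 1) p) = 0 := by
    rintro ⟨a, b⟩ hs hs1 hs0
    by_cases hb : 1 ≤ b
    · exact mem_perp.1 hup _ ⟨hs.2.1, hs.1, hb, hs.2.2.2, hs1⟩
    · simp only [mem_box, ne_eq, Prod.mk_eq_zero] at hs hs0
      have hb0 : b = 0 := by omega
      subst hb0
      have := hbot (a - 1) (by omega) (by omega)
      rwa [sub_add_cancel] at this
  -- The corner is the one relation not obtained so far; `LeadOrthogonal` supplies it.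
  have h0 : inner ℂ (e 0) (sh e (0, 1) p) = 0 := by
    refine LeadOrthogonal.inner_basis_zero (hU (by omega)) (by omega) (by omega)
      (by simpa using hp) (mem_perp.2 ?_)
    rintro ⟨a, b⟩ ⟨hs, hs0⟩
    refine hne _ (box_mono (by omega) le_rfl hs) (fun h => ?_) hs0
    simp only [mem_box, Prod.mk.injEq] at *; omega
  refine mem_perp.2 ?_
  rintro s ⟨hs, hs'⟩
  by_cases hs0 : s = 0
  · rw [hs0]; exact h0
  · exact hne s hs hs' hs0

end Stationary

/-! ### Propagation of the orthogonality relations to higher degrees -/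

section Stationary

variable {H : Type*} [NormedAddCommGroup H] [InnerProductSpace ℂ H]
  {e : Module.Basis (ℤ × ℤ) ℂ H}

theorem leadSpace_le_perp {i j : ℤ} {S : Set (ℤ × ℤ)} (hS : S ⊆ box i j) (h : (i, j) ∉ S) :
    leadSpace e i j ≤ perp e S := fun f hf => by
  have hsub : S ⊆ box i j \ {(i, j)} := fun s hs => ⟨hS hs, fun h' => h (h' ▸ hs)⟩
  exact perp_anti hsub hf.2

/-- Under decoupling P_{i,j} ⊖ P_{i-1,j} is the sum of its predecessor P_{i,j-1} ⊖ P_{i-1,j-1} and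
the leading line. Without its leading term, f is a sum from P_{i,j-1} and P_{i-1,j}, and the
residual of the first summand is already orthogonal to P_{i-1,j}. -/
theorem Decoupled.exists_add {i j : ℤ} (hi : 0 ≤ i) (hj : 0 ≤ j) (hK : Decoupled e i j) {f : H}
    (hf : f ∈ lexSpace e i j) :
    ∃ x ∈ lexSpace e i (j - 1), ∃ y ∈ leadSpace e i j, x + y = f := by
  obtain ⟨p, hp, hp1⟩ := exists_leadSpace (e := e) hi hj
  set c := e.repr f (i, j)
  have hcp := Submodule.smul_mem _ c hp
  have hh : f - c • p ∈ sp e (box i j \ {(i, j)}) :=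
    mem_sp_diff (sub_mem hf.1 hcp.1) (by simp [hp1, c])
  have hh' : f - c • p ∈ perp e (box (i - 1) j) :=
    sub_mem hf.2 (leadSpace_le_perp (box_mono (by omega) le_rfl) (by simp [mem_box]) hcp)
  obtain ⟨x, hx, y, hy, hxy⟩ := exists_add_of_mem_union (S := box i (j - 1)) (T := box (i - 1) j)
    (by
      rintro ⟨a, b⟩ hs
      simp only [mem_box, Set.mem_sdiff, Set.mem_singleton_iff, Prod.mk.injEq,
        Set.mem_union] at *
      omega) hh
  obtain ⟨u, hu, hu'⟩ := exists_residual (e := e) (finite_box (i - 1) (j - 1)) x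
  have hxu : x - u ∈ lexSpace e i (j - 1) :=
    ⟨sub_mem hx (sp_mono (box_mono (by omega) le_rfl) hu), hu'⟩
  refine ⟨x - u, hxu, c • p, hcp, ?_⟩
  have h0 : (f - c • p) - (x - u) = 0 := by
    refine eq_zero_of_mem_of_perp (e := e) (S := box (i - 1) j) ?_ (sub_mem hh' (hK _ hxu))
    rw [← hxy]
    have : x + y - (x - u) = y + u := by abel
    rw [this]
    exact add_mem hy (sp_mono (box_mono le_rfl (by omega)) hu)
  rw [sub_eq_zero] at h0
  rw [← h0]; abel

/-- In the splitting of `Decoupled.exists_add`, z times the lower part lies in P_{i+1,j-1} ⊖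
P_{i,j-1}, which `hK'` makes orthogonal to P_{i,j}; z times the leading part is covered by `hC`. -/
theorem shiftsLex_of_shiftsLex {i j : ℤ} (hi : 0 ≤ i) (hj : 0 ≤ j)
    (h : ShiftsLex e i (j - 1)) (hK : Decoupled e i j) (hK' : Decoupled e (i + 1) j)
    (hC : ∀ p ∈ leadSpace e i j, sh e (1, 0) p ∈ leadSpace e (i + 1) j) : ShiftsLex e i j := by
  intro f hf
  obtain ⟨x, hx, y, hy, rfl⟩ := hK.exists_add hi hj hf
  rw [map_add]
  refine add_mem ?_ (leadSpace_le_perp (box_mono (by omega) le_rfl) (by simp [mem_box]) (hC y hy))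
  have h1 : sh e (1, 0) x ∈ lexSpace e (i + 1) (j - 1) := by
    refine ⟨sh_mem_sp hx.1 fun s hs => ?_, ?_⟩
    · simp only [mem_box, Prod.fst_add, Prod.snd_add] at *; omega
    · rw [add_sub_cancel_right]; exact h x hx
  simpa using hK' _ h1

theorem shiftsRevlex_of_shiftsRevlex {i j : ℤ} (hi : 0 ≤ i) (hj : 0 ≤ j)
    (h : ShiftsRevlex e (i - 1) j) (hK : Decoupled e i j) (hK' : Decoupled e i (j + 1))
    (hC : ∀ p ∈ leadSpace e i j, sh e (0, 1) p ∈ leadSpace e i (j + 1)) :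
    ShiftsRevlex e i j := by
  rw [← shiftsLex_swapped] at *
  refine shiftsLex_of_shiftsLex hj hi h (decoupled_swapped.2 hK)
    (decoupled_swapped.2 hK') fun p hp => ?_
  rw [leadSpace_swapped] at *
  rw [sh_swapped]
  exact hC p hp

/-- By `ShiftsLex` every such f is z g with g one degree lower in z. Decoupling at (i-1, j) extends
the orthogonality of g up to row j, and translation by z carries this to columns 1, …, i-1. -/
theorem lexSpace_le_perp_of_shiftsLex (he : IsStationary e) {i j : ℤ} (hi : 1 ≤ i)
    (h : ShiftsLex e (i - 1) (j - 1)) (hK : Decoupled e (i - 1) j) {f : H}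
    (hf : f ∈ lexSpace e i (j - 1)) :
    f ∈ perp e {s | 1 ≤ s.1 ∧ s.1 ≤ i - 1 ∧ 0 ≤ s.2 ∧ s.2 ≤ j} := by
  obtain ⟨g, hg, rfl⟩ := exists_sh_eq (e := e) (T := box (i - 1) (j - 1))
    (T₀ := box (i - 1 - 1) (j - 1)) (s := (1, 0)) (finite_box _ _)
    (box_mono (by omega) le_rfl) (by
      intro a ha
      simp only [mem_box, Prod.fst_sub, Prod.snd_sub] at *; omega) (by
      intro a ha
      simp only [mem_box, Prod.fst_add, Prod.snd_add] at *; omega) h hf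
  refine sh_mem_perp he (hK g hg) fun s hs => ?_
  simp only [mem_box, Set.mem_ofPred_eq, Prod.fst_sub, Prod.snd_sub] at *; omega

theorem revlexSpace_le_perp_of_shiftsRevlex (he : IsStationary e) {i j : ℤ} (hj : 1 ≤ j)
    (h : ShiftsRevlex e (i - 1) (j - 1)) (hK : Decoupled e i (j - 1)) {f : H}
    (hf : f ∈ revlexSpace e (i - 1) j) :
    f ∈ perp e {s | 0 ≤ s.1 ∧ s.1 ≤ i ∧ 1 ≤ s.2 ∧ s.2 ≤ j - 1} := by
  have := lexSpace_le_perp_of_shiftsLex (e := swapped e) he.swapped (i := j) (j := i)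
    hj (shiftsLex_swapped.2 h) (decoupled_swapped.2 hK) (f := f) (by rwa [lexSpace_swapped])
  rw [perp_swapped] at this
  refine perp_anti (fun s hs => ?_) this
  simp only [Set.mem_preimage, Set.mem_ofPred_eq, Prod.fst_swap, Prod.snd_swap] at *; omega

/-- The neighbouring degrees leave a single relation. In the top row, f can fail to be orthogonal
only to w^j; the residual g of w^j is orthogonal to P_{i,j-1} except for z^i. Thus ⟨g, f⟩ is a
multiple of the product of the residuals of w^j and z^i. -/
theorem decoupled_of_mixedOrthogonal (he : IsStationary e) {i j : ℤ} (hi : 1 ≤ i) (hj : 1 ≤ j)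
    (hA : ShiftsLex e (i - 1) (j - 1)) (hKA : Decoupled e (i - 1) j)
    (hB : ShiftsRevlex e (i - 1) (j - 1)) (hKB : Decoupled e i (j - 1))
    (hM : MixedOrthogonal e i j) : Decoupled e i j := by
  intro f hf
  have hf1 := lexSpace_le_perp_of_shiftsLex he hi hA hKA hf
  obtain ⟨x, hx, hx'⟩ := exists_residual (e := e) (finite_box (i - 1) (j - 1)) (e (0, j))
  obtain ⟨y, hy, hy'⟩ := exists_residual (e := e) (finite_box (i - 1) (j - 1)) (e (i, 0))
  have hg : e (0, j) - x ∈ revlexSpace e (i - 1) j :=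
    ⟨sub_mem (mem_sp_self (by simp [mem_box]; omega))
      (sp_mono (box_mono le_rfl (by omega)) hx), hx'⟩
  have hg1 := revlexSpace_le_perp_of_shiftsRevlex he hj hB hKB hg
  have h0 := hM _ hy' _ hx' (by simpa using neg_mem hy) (by simpa using neg_mem hx)
  set c := e.repr f (i, 0)
  have hy0 : e.repr y (i, 0) = 0 := mem_sp.1 hy _ (by simp [mem_box])
  have hfc : f - c • (e (i, 0) - y) ∈ sp e (box i (j - 1) \ {(i, 0)}) := by
    refine mem_sp_diff (sub_mem hf.1 (Submodule.smul_mem _ _ (sub_mem (mem_sp_self ?_)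
      (sp_mono (box_mono (by omega) le_rfl) hy)))) ?_
    · simp only [mem_box]; omega
    · simp [hy0, c]
  have hgp : e (0, j) - x ∈ perp e (box i (j - 1) \ {(i, 0)}) := by
    refine perp_union ?_ hg1 hx'
    rintro ⟨a, b⟩ hs
    simp only [mem_box, Set.mem_sdiff, Set.mem_singleton_iff, Prod.mk.injEq,
        Set.mem_union, Set.mem_ofPred_eq] at *
    omega
  have h1 := inner_eq_zero_of_perp' hgp hfc
  rw [inner_sub_right, inner_smul_right, h0, mul_zero, sub_zero, inner_sub_left,
    inner_eq_zero_of_perp hf.2 hx, sub_zero] at h1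
  rw [mem_perp]
  rintro ⟨a, b⟩ hs
  by_cases hb : b ≤ j - 1
  · exact mem_perp.1 hf.2 _ ⟨hs.1, hs.2.1, hs.2.2.1, hb⟩
  · simp only [mem_box] at hs
    have hbj : b = j := by omega
    subst hbj
    by_cases ha : 1 ≤ a
    · exact mem_perp.1 hf1 _ ⟨ha, hs.2.1, hs.2.2.1, le_rfl⟩
    · have ha0 : a = 0 := by omega
      subst ha0; exact h1

/-- Written as w y, the polynomial is orthogonal to the lower monomials divisible by w; written as z
x, to those divisible by z. Only the constant is left for `LeadOrthogonal`. -/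
theorem sh_mem_leadSpace_of_leadOrthogonal (he : IsStationary e) {i j : ℤ} (hi : 1 ≤ i)
    (hj : 1 ≤ j) (hL : LeadOrthogonal e i j) {x y : H} (hx : x ∈ leadSpace e (i - 1) j)
    (hy : y ∈ leadSpace e i (j - 1)) (hxy : sh e (1, 0) x = sh e (0, 1) y) :
    sh e (0, 1) y ∈ leadSpace e i j := by
  have hne : ∀ s ∈ box i j, s ≠ (i, j) → s ≠ 0 → inner ℂ (e s) (sh e (0, 1) y) = 0 := by
    rintro ⟨a, b⟩ hs hs1 hs0
    simp only [mem_box, ne_eq, Prod.mk.injEq, Prod.mk_eq_zero] at hs hs1 hs0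
    by_cases hb : 1 ≤ b
    · refine mem_perp.1 (sh_mem_perp he (T := {(a, b)}) hy.2 ?_) _ rfl
      rintro _ rfl
      simp only [mem_box, Set.mem_sdiff, Set.mem_singleton_iff, Prod.mk.injEq, Prod.mk_sub_mk]
      omega
    · rw [← hxy]
      refine mem_perp.1 (sh_mem_perp he (T := {(a, b)}) hx.2 ?_) _ rfl
      rintro _ rfl
      simp only [mem_box, Set.mem_sdiff, Set.mem_singleton_iff, Prod.mk.injEq, Prod.mk_sub_mk]
      omega
  refine ⟨sh_mem_sp hy.1 fun s hs => ?_, mem_perp.2 ?_⟩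
  · simp only [mem_box, Prod.fst_add, Prod.snd_add] at *; omega
  rintro s ⟨hs, hs'⟩
  by_cases hs0 : s = 0
  · rw [hs0]
    refine hL.inner_basis_zero hi (by omega) hy (mem_perp.2 ?_)
    rintro ⟨a, b⟩ ⟨hs, hs0⟩
    refine hne _ (box_mono (by omega) le_rfl hs) (fun h => ?_) hs0
    simp only [mem_box, Prod.mk.injEq] at *; omega
  · exact hne s hs hs' hs0

variable (e) in
/-- The vanishing conditions on the recurrence coefficients beyond the level `(n, m)`. -/
structure VanishingConditions (n m : ℤ) : Prop where
  decoupled_right : ∀ j, m ≤ j → Decoupled e n j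
  decoupled_left : ∀ i, n ≤ i → Decoupled e i m
  shiftsRevlex : ∀ j, m ≤ j → ShiftsRevlex e (n - 1) j
  shiftsLex : ∀ i, n ≤ i → ShiftsLex e i (m - 1)
  leadOrthogonal_right : 1 ≤ n → ∀ j, m ≤ j → LeadOrthogonal e n (j + 1)
  leadOrthogonal_left : 1 ≤ m → ∀ i, n ≤ i → LeadOrthogonal e (i + 1) m
  shiftsRevlex_zero : n = 0 → ∀ j, m ≤ j → ShiftsRevlex e 0 j
  shiftsLex_zero : m = 0 → ∀ i, n ≤ i → ShiftsLex e i 0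
  leadOrthogonal : ∀ i j, n < i → m < j → LeadOrthogonal e i j
  mixedOrthogonal : ∀ i j, n < i → m < j → MixedOrthogonal e i j

theorem VanishingConditions.sh_right (he : IsStationary e) {n m : ℤ} (hn : 0 ≤ n) (hm : 0 ≤ m)
    (h : VanishingConditions e n m) {p : H} (hp : p ∈ leadSpace e n m) (b : ℕ) :
    sh e (0, (b : ℤ)) p ∈ leadSpace e n (m + b) := by
  induction b with
  | zero => simpa [← Prod.zero_eq_mk] using hp
  | succ b ih =>
    have := sh_mem_leadSpace he hn (by omega) (h.decoupled_right (m + b + 1) (by omega))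
      (h.shiftsRevlex (m + b) (by omega))
      (fun h1 => h.leadOrthogonal_right h1 (m + b) (by omega))
      (fun h1 => h.shiftsRevlex_zero h1 (m + b) (by omega)) ih
    rw [sh_sh] at this
    push_cast
    rw [← add_assoc]
    convert this using 3
    simp [add_comm]

theorem VanishingConditions.swapped (he : IsStationary e) {n m : ℤ}
    (h : VanishingConditions e n m) : VanishingConditions (swapped e) m n where
  decoupled_right j hj := decoupled_swapped.2 (h.decoupled_left j hj)
  decoupled_left i hi := decoupled_swapped.2 (h.decoupled_right i hi)
  shiftsRevlex j hj := shiftsRevlex_swapped.2 (h.shiftsLex j hj)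
  shiftsLex i hi := shiftsLex_swapped.2 (h.shiftsRevlex i hi)
  leadOrthogonal_right h1 j hj := (h.leadOrthogonal_left h1 j hj).swapped he
  leadOrthogonal_left h1 i hi := (h.leadOrthogonal_right h1 i hi).swapped he
  shiftsRevlex_zero h1 j hj := shiftsRevlex_swapped.2 (h.shiftsLex_zero h1 j hj)
  shiftsLex_zero h1 i hi := shiftsLex_swapped.2 (h.shiftsRevlex_zero h1 i hi)
  leadOrthogonal i j hi hj := (h.leadOrthogonal j i hj hi).swapped he
  mixedOrthogonal i j hi hj := (h.mixedOrthogonal j i hj hi).swapped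

theorem VanishingConditions.sh_left (he : IsStationary e) {n m : ℤ} (hn : 0 ≤ n) (hm : 0 ≤ m)
    (h : VanishingConditions e n m) {p : H} (hp : p ∈ leadSpace e n m) (a : ℕ) :
    sh e ((a : ℤ), 0) p ∈ leadSpace e (n + a) m := by
  have := (h.swapped he).sh_right he.swapped hm hn (by rwa [leadSpace_swapped]) a
  rwa [leadSpace_swapped, sh_swapped] at this

theorem sh_mem_of_generator {i j i' j' : ℤ} {s t : ℤ × ℤ} {p : H} (h0 : p ≠ 0)
    (h : sh e t p ∈ leadSpace e i j) (h' : sh e (s + t) p ∈ leadSpace e i' j') :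
    ∀ f ∈ leadSpace e i j, sh e s f ∈ leadSpace e i' j' := by
  intro f hf
  have hne : sh e t p ≠ 0 := fun hz => h0 (by
    have := congrArg (sh e (-t)) hz
    simpa [sh_sh] using this)
  obtain ⟨c, rfl⟩ := eq_smul_of_mem_leadSpace h hne hf
  rw [map_smul, sh_sh]
  exact Submodule.smul_mem _ _ h'

/-- Induction on the column a, and inside each column on b. A complete column a gives `ShiftsRevlex`
along it (`hR`). At (a+1, b+1) the neighbours (a, b+1) and (a+1, b) supply the hypotheses of the two
preceding reductions, so u_{-i,j} = 0 yields decoupling and u_{i,j} = 0 the leading polynomial. The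
first row and column come from `sh_left` and `sh_right`. -/
theorem VanishingConditions.decoupled_and_sh (he : IsStationary e) {n m : ℤ} (hn : 0 ≤ n)
    (hm : 0 ≤ m) (h : VanishingConditions e n m) {p : H} (hp : p ∈ leadSpace e n m)
    (h0 : p ≠ 0) (a : ℕ) : ∀ b : ℕ, Decoupled e (n + a) (m + b) ∧
      sh e ((a : ℤ), (b : ℤ)) p ∈ leadSpace e (n + a) (m + b) ∧
      ShiftsRevlex e (n + a - 1) (m + b) := by
  induction a with
  | zero =>
    intro b
    simp only [Nat.cast_zero, add_zero]
    exact ⟨h.decoupled_right _ (by omega), h.sh_right he hn hm hp b, h.shiftsRevlex _ (by omega)⟩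
  | succ a ih =>
    have hR : ∀ b : ℕ, ShiftsRevlex e (n + a) (m + b) := by
      intro b
      obtain ⟨hK, hC, hS⟩ := ih b
      obtain ⟨hK', hC', -⟩ := ih (b + 1)
      push_cast at hK' hC'
      rw [← add_assoc] at hK' hC'
      refine shiftsRevlex_of_shiftsRevlex (by omega) (by omega) hS hK hK'
        (sh_mem_of_generator h0 hC ?_)
      simpa [add_comm] using hC'
    suffices hb : ∀ b : ℕ, Decoupled e (n + a + 1) (m + b) ∧
        sh e ((a : ℤ) + 1, (b : ℤ)) p ∈ leadSpace e (n + a + 1) (m + b) ∧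
        ShiftsLex e (n + a) (m + b - 1) by
      intro b
      push_cast
      rw [← add_assoc, add_sub_cancel_right]
      exact ⟨(hb b).1, (hb b).2.1, hR b⟩
    intro b
    induction b with
    | zero =>
      have := h.sh_left he hn hm hp (a + 1)
      push_cast at this
      rw [← add_assoc] at this
      simp only [Nat.cast_zero, add_zero]
      exact ⟨h.decoupled_left _ (by omega), this, h.shiftsLex _ (by omega)⟩
    | succ b ihb =>
      obtain ⟨hK, hC, hS⟩ := ihb
      obtain ⟨hK1, hC1, -⟩ := ih b
      obtain ⟨hK2, hC2, -⟩ := ih (b + 1)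
      push_cast at hK2 hC2 ⊢
      rw [← add_assoc] at hK2 hC2 ⊢
      have hS' : ShiftsLex e (n + a) (m + b) := by
        refine shiftsLex_of_shiftsLex (by omega) (by omega) hS hK1 hK
          (sh_mem_of_generator h0 hC1 ?_)
        simpa [add_comm] using hC
      refine ⟨?_, ?_, ?_⟩
      · exact decoupled_of_mixedOrthogonal he (by omega) (by omega) (by simpa using hS')
          (by simpa using hK2) (by simpa using hR b) (by simpa using hK)
          (h.mixedOrthogonal _ _ (by omega) (by omega))
      · have := sh_mem_leadSpace_of_leadOrthogonal he (i := n + a + 1) (j := m + b + 1)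
          (by omega) (by omega) (h.leadOrthogonal _ _ (by omega) (by omega))
          (by simpa using hC2) (by simpa using hC) (by simp [sh_sh, add_comm])
        rw [sh_sh] at this
        simpa [add_comm] using this
      · simpa using hS'

/-- The leading polynomial of degree `(n, m)` is orthogonal to all monomials `z^a w^b` with
`a < n` or `b < m`. -/
theorem VanishingConditions.mem_perp_left (he : IsStationary e) {n m : ℤ} (hn : 0 ≤ n)
    (hm : 0 ≤ m) (h : VanishingConditions e n m) {p : H} (hp : p ∈ leadSpace e n m)
    (h0 : p ≠ 0) : p ∈ perp e {s | s.1 < n} := by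
  rw [mem_perp]
  rintro ⟨a, b⟩ hab
  simp only [Set.mem_ofPred_eq] at hab
  obtain ⟨k, hk⟩ := Int.eq_ofNat_of_zero_le (a := max 0 (-a)) (by omega)
  obtain ⟨l, hl⟩ := Int.eq_ofNat_of_zero_le (a := max 0 (-b)) (by omega)
  -- Translation by (k, l) makes the exponents nonnegative. Decoupling then raises the height of the
  -- box by one for each c, without changing the polynomial, until the translated exponent fits
  -- inside.
  have key : ∀ c : ℕ, sh e ((k : ℤ), (l : ℤ)) p ∈ lexSpace e (n + k) (m + l + c) := by
    intro c
    induction c with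
    | zero =>
      have := (h.decoupled_and_sh he hn hm hp h0 k l).2.1
      simp only [Nat.cast_zero, add_zero]
      exact ⟨this.1, leadSpace_le_perp (box_mono (by omega) le_rfl) (by simp [mem_box]) this⟩
    | succ c ih =>
      have hK := (h.decoupled_and_sh he hn hm hp h0 k (l + c + 1)).1
      push_cast at hK ⊢
      simp only [← add_assoc] at hK ⊢
      exact ⟨sp_mono (box_mono le_rfl (by omega)) ih.1, hK _ (by simpa using ih)⟩
  obtain ⟨c, hc⟩ := Int.eq_ofNat_of_zero_le (a := max 0 b) (by omega)
  have h1 := mem_perp.1 (key c).2 (a + k, b + l) ⟨by omega, by omega, by omega, by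
    simp only; omega⟩
  rw [← inner_sh he ((k : ℤ), (l : ℤ)), sh_basis]
  exact h1

theorem VanishingConditions.mem_perp (he : IsStationary e) {n m : ℤ} (hn : 0 ≤ n)
    (hm : 0 ≤ m) (h : VanishingConditions e n m) {p : H} (hp : p ∈ leadSpace e n m)
    (h0 : p ≠ 0) : p ∈ perp e {s | s.1 < n ∨ s.2 < m} := by
  refine perp_union (fun s hs => hs) (h.mem_perp_left he hn hm hp h0) ?_
  have := (h.swapped he).mem_perp_left he.swapped hm hn (by rwa [leadSpace_swapped]) h0
  rwa [perp_swapped] at this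

end Stationary

section Stationary

variable {H : Type*} [NormedAddCommGroup H] [InnerProductSpace ℂ H]
  {e : Module.Basis (ℤ × ℤ) ℂ H}

/-! ### Evaluation and reproducing kernels -/

variable (e) in
/-- The value at `(z, w)` of `∑ c_{a,b} z^a w^b` (for nonnegative exponents). -/
noncomputable def evalAt (z w : ℂ) : H →ₗ[ℂ] ℂ :=
  e.constr ℂ fun s => z ^ s.1.toNat * w ^ s.2.toNat

theorem evalAt_basis (z w : ℂ) (s : ℤ × ℤ) :
    evalAt e z w (e s) = z ^ s.1.toNat * w ^ s.2.toNat := by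
  simp [evalAt]

theorem evalAt_swapped (z w : ℂ) (f : H) : evalAt (swapped e) w z f = evalAt e z w f := by
  induction f using induction_basis (e := e) with
  | h0 => simp
  | hadd f g hf hg => simp [hf, hg]
  | hs c a =>
    have : e a = swapped e a.swap := by simp
    rw [map_smul, map_smul, evalAt_basis, this, evalAt_basis]
    simp [mul_comm]

theorem eqOn_sp {S : Set (ℤ × ℤ)} {L L' : H →ₗ[ℂ] ℂ} (h : ∀ s ∈ S, L (e s) = L' (e s)) {f : H}
    (hf : f ∈ sp e S) : L f = L' f := by
  refine LinearMap.eqOn_span (f := L) (g := L') ?_ hf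
  rintro _ ⟨s, hs, rfl⟩
  exact h s hs

theorem evalAt_sh_fst {S : Set (ℤ × ℤ)} (z w : ℂ) {f : H} (hf : f ∈ sp e S)
    (hS : ∀ s ∈ S, 0 ≤ s.1) : evalAt e z w (sh e (1, 0) f) = z * evalAt e z w f := by
  refine eqOn_sp (L := (evalAt e z w).comp (sh e (1, 0))) (L' := z • evalAt e z w) ?_ hf
  intro s hs
  have : (s.1 + 1).toNat = s.1.toNat + 1 := by have := hS s hs; omega
  simp [evalAt_basis, this, pow_succ]; ring

theorem evalAt_sh_snd {S : Set (ℤ × ℤ)} (z w : ℂ) {f : H} (hf : f ∈ sp e S)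
    (hS : ∀ s ∈ S, 0 ≤ s.2) : evalAt e z w (sh e (0, 1) f) = w * evalAt e z w f := by
  refine eqOn_sp (L := (evalAt e z w).comp (sh e (0, 1))) (L' := w • evalAt e z w) ?_ hf
  intro s hs
  have : (s.2 + 1).toNat = s.2.toNat + 1 := by have := hS s hs; omega
  simp [evalAt_basis, this, pow_succ]; ring

variable (e) in
/-- `r` represents the evaluation at `(z, w)` on `sp e S`. -/
def IsRepresenter (z w : ℂ) (S : Set (ℤ × ℤ)) (r : H) : Prop :=
  r ∈ sp e S ∧ ∀ f ∈ sp e S, inner ℂ r f = evalAt e z w f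

theorem exists_isRepresenter (z w : ℂ) {S : Set (ℤ × ℤ)} (hS : S.Finite) :
    ∃ r, IsRepresenter e z w S r := by
  have := finiteDimensional_sp (e := e) hS
  let L : sp e S →L[ℂ] ℂ := LinearMap.toContinuousLinearMap ((evalAt e z w).domRestrict (sp e S))
  have : CompleteSpace (sp e S) := FiniteDimensional.complete ℂ _
  refine ⟨((InnerProductSpace.toDual ℂ (sp e S)).symm L : sp e S), Subtype.coe_prop _,
    fun f hf => ?_⟩
  have := InnerProductSpace.toDual_symm_apply (𝕜 := ℂ) (x := (⟨f, hf⟩ : sp e S)) (y := L)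
  rw [Submodule.coe_inner] at this
  exact this

namespace IsRepresenter

variable {z w : ℂ} {S S' T : Set (ℤ × ℤ)} {r r' : H}

theorem swapped (h : IsRepresenter e z w S r) :
    IsRepresenter (swapped e) w z (Prod.swap ⁻¹' S) r := by
  have hS : sp (Bicircle.swapped e) (Prod.swap ⁻¹' S) = sp e S := by
    rw [sp_swapped, ← Set.preimage_comp]; simp
  rw [IsRepresenter, hS]
  exact ⟨h.1, fun f hf => by rw [evalAt_swapped]; exact h.2 f hf⟩

theorem inner_basis (h : IsRepresenter e z w S r) {s : ℤ × ℤ} (hs : s ∈ S) :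
    inner ℂ (e s) r = conj (evalAt e z w (e s)) := by
  rw [← h.2 _ (mem_sp_self hs), inner_conj_symm]

theorem sub_mem_perp (h : IsRepresenter e z w S r) (h' : IsRepresenter e z w S' r')
    (hT : ∀ s ∈ T, s ∈ S ∧ s ∈ S') : r - r' ∈ perp e T :=
  mem_perp.2 fun s hs => by
    rw [inner_sub_right, h.inner_basis (hT s hs).1, h'.inner_basis (hT s hs).2, sub_self]

/-- On monomials divisible by z, pairing with conj z · (z r') also represents evaluation at (z, w):
divide by z, evaluate with r', and multiply back. -/
theorem sub_smul_sh_mem_perp (he : IsStationary e) (h : IsRepresenter e z w S r)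
    (h' : IsRepresenter e z w S' r')
    (hT : ∀ s ∈ T, s ∈ S ∧ s - (1, 0) ∈ S' ∧ 1 ≤ s.1) :
    r - conj z • sh e (1, 0) r' ∈ perp e T :=
  mem_perp.2 fun s hs => by
    have h1 : e s = sh e (1, 0) (e (s - (1, 0))) := by simp
    have h2 : evalAt e z w (e s) = z * evalAt e z w (e (s - (1, 0))) := by
      rw [h1]
      refine evalAt_sh_fst z w (mem_sp_self (Set.mem_singleton _)) ?_
      rintro _ rfl
      have := (hT s hs).2.2
      simpa using this
    rw [inner_sub_right, inner_smul_right, h.inner_basis (hT s hs).1, h2]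
    conv_lhs => rw [h1]
    rw [inner_sh he, h'.inner_basis (hT s hs).2.1, map_mul, sub_self]

theorem evalAt_self (h : IsRepresenter e z w S r) : evalAt e z w r = (‖r‖ ^ 2 : ℝ) := by
  rw [← h.2 _ h.1, inner_self_eq_norm_sq_to_K]; norm_num

end IsRepresenter

/-- This is decoupling read after reversal: orthogonality to columns 1, …, n becomes membership in
P_{n,m-1} ⊖ P_{n-1,m-1}, and reversing at (n, m) instead of (n, m-1) produces the factor w. -/
theorem Decoupled.sh_mem_perp (he : IsStationary e) {n m : ℤ} (hK : Decoupled e n m) {y : H}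
    (hy : y ∈ sp e (box n (m - 1)))
    (hy' : y ∈ perp e {s | 1 ≤ s.1 ∧ s.1 ≤ n ∧ 0 ≤ s.2 ∧ s.2 ≤ m - 1}) :
    sh e (0, 1) y ∈ perp e {s | 1 ≤ s.1 ∧ s.1 ≤ n ∧ 0 ≤ s.2 ∧ s.2 ≤ m} := by
  have h1 : rev e (n, m - 1) y ∈ lexSpace e n (m - 1) := by
    refine ⟨rev_mem_sp hy fun s hs => ?_, rev_mem_perp he hy' fun s hs => ?_⟩ <;>
    · simp only [mem_box, Set.mem_ofPred_eq, Prod.fst_sub, Prod.snd_sub] at *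
      omega
  have h2 := rev_mem_perp he (N := (n, m)) (T := {s | 1 ≤ s.1 ∧ s.1 ≤ n ∧ 0 ≤ s.2 ∧ s.2 ≤ m})
    (hK _ h1) fun s hs => by
      simp only [mem_box, Set.mem_ofPred_eq, Prod.fst_sub, Prod.snd_sub] at *; omega
  have h3 : ((n, m) : ℤ × ℤ) = (n, m - 1) + (0, 1) := by simp
  rwa [h3, ← sh_rev, rev_rev] at h2

/-- The Christoffel–Darboux formula. -/
theorem Decoupled.christoffel_darboux (he : IsStationary e) {n m : ℤ}
    (hK : Decoupled e n m) {p : H} (hp : p ∈ leadSpace e n m) (hp1 : ‖p‖ = 1) {z₀ w₀ : ℂ}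
    {r₀ r₁ r₂ : H} (h₀ : IsRepresenter e z₀ w₀ (box (n - 1) (m - 1)) r₀)
    (h₁ : IsRepresenter e z₀ w₀ (box (n - 1) m) r₁)
    (h₂ : IsRepresenter e z₀ w₀ (box n (m - 1)) r₂) (z w : ℂ) :
    evalAt e z w (rev e (n, m) p) * conj (evalAt e z₀ w₀ (rev e (n, m) p))
        - evalAt e z w p * conj (evalAt e z₀ w₀ p) =
      (1 - z * conj z₀) * evalAt e z w r₁ + (1 - w * conj w₀) * evalAt e z w r₂
        - (1 - z * conj z₀ * (w * conj w₀)) * evalAt e z w r₀ := by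
  -- The kernel r of P_{n,m} is expanded twice: as r₁ + r₂ - r₀ plus a multiple of p, and as the
  -- analogous combination X of translated kernels plus a multiple of the reverse of p. Evaluating
  -- both at (z, w) and subtracting eliminates r.
  obtain ⟨r, hr⟩ := exists_isRepresenter (e := e) z₀ w₀ (finite_box n m)
  have hp0 : p ≠ 0 := by rintro rfl; simp at hp1
  have hpp : inner ℂ p p = (1 : ℂ) := by rw [inner_self_eq_norm_sq_to_K, hp1]; norm_num
  have hrp : inner ℂ p r = conj (evalAt e z₀ w₀ p) := by rw [← hr.2 p hp.1, inner_conj_symm]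
  have hq : rev e (n, m) p ∈ sp e (box n m) := rev_mem_sp hp.1 fun s hs => by
    simp only [mem_box, Prod.fst_sub, Prod.snd_sub] at *; omega
  have hrq : inner ℂ (rev e (n, m) p) r = conj (evalAt e z₀ w₀ (rev e (n, m) p)) := by
    rw [← hr.2 _ hq, inner_conj_symm]
  have hpperp : ∀ S ⊆ box n m, (n, m) ∉ S → ∀ g ∈ sp e S, inner ℂ p g = 0 := fun S hS hS' g hg =>
    inner_eq_zero_of_perp' (leadSpace_le_perp hS hS' hp) hg
  -- first expansion of the representer
  have e1 : r - (r₁ + r₂ - r₀) = conj (evalAt e z₀ w₀ p) • p := by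
    have hmem : r - (r₁ + r₂ - r₀) ∈ leadSpace e n m := by
      refine ⟨sub_mem hr.1 (sub_mem (add_mem ?_ ?_) ?_), ?_⟩
      · exact sp_mono (box_mono (by omega) le_rfl) h₁.1
      · exact sp_mono (box_mono le_rfl (by omega)) h₂.1
      · exact sp_mono (box_mono (by omega) (by omega)) h₀.1
      refine perp_union (S := box (n - 1) m) (T := box n (m - 1)) ?_ ?_ ?_
      · rintro ⟨a, b⟩ hs
        simp only [mem_box, Set.mem_sdiff, Set.mem_singleton_iff, Prod.mk.injEq,
          Set.mem_union] at *
        omega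
      · have : r - (r₁ + r₂ - r₀) = (r - r₁) - (r₂ - r₀) := by abel
        rw [this]
        refine sub_mem (hr.sub_mem_perp h₁ fun s hs => ⟨box_mono (by omega) le_rfl hs, hs⟩)
          (hK _ ⟨sub_mem h₂.1 (sp_mono (box_mono (by omega) le_rfl) h₀.1),
            h₂.sub_mem_perp h₀ fun s hs => ⟨box_mono (by omega) le_rfl hs, hs⟩⟩)
      · have : r - (r₁ + r₂ - r₀) = (r - r₂) - (r₁ - r₀) := by abel
        rw [this]
        refine sub_mem (hr.sub_mem_perp h₂ fun s hs => ⟨box_mono le_rfl (by omega) hs, hs⟩)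
          (hK.symm _ ⟨sub_mem h₁.1 (sp_mono (box_mono le_rfl (by omega)) h₀.1),
            h₁.sub_mem_perp h₀ fun s hs => ⟨box_mono le_rfl (by omega) hs, hs⟩⟩)
    obtain ⟨c, hc⟩ := eq_smul_of_mem_leadSpace hp hp0 hmem
    have hin := congrArg (inner ℂ p) hc
    rw [inner_smul_right, hpp, mul_one, inner_sub_right, inner_sub_right, inner_add_right, hrp,
      hpperp _ (box_mono (by omega) le_rfl) (by simp [mem_box]) _ h₁.1,
      hpperp _ (box_mono le_rfl (by omega)) (by simp [mem_box]) _ h₂.1,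
      hpperp _ (box_mono (by omega) (by omega)) (by simp [mem_box]) _ h₀.1] at hin
    rw [hc, ← hin]; simp
  -- second expansion of the representer
  set X := conj z₀ • sh e (1, 0) r₁ + conj w₀ • sh e (0, 1) r₂
    - (conj z₀ * conj w₀) • sh e (1, 1) r₀ with hX
  have hX1 : X = conj z₀ • sh e (1, 0) r₁ +
      conj w₀ • sh e (0, 1) (r₂ - conj z₀ • sh e (1, 0) r₀) := by
    rw [hX, map_sub, map_smul, sh_sh, smul_sub, smul_smul, mul_comm (conj w₀) (conj z₀)]
    simp only [Prod.mk_add_mk, zero_add, add_zero]; abel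
  have hX2 : X = conj w₀ • sh e (0, 1) r₂ +
      conj z₀ • sh e (1, 0) (r₁ - conj w₀ • sh e (0, 1) r₀) := by
    rw [hX, map_sub, map_smul, sh_sh, smul_sub, smul_smul]
    simp only [Prod.mk_add_mk, zero_add, add_zero]; abel
  have hXsp : X ∈ sp e (box n m \ {0}) := by
    refine sub_mem (add_mem ?_ ?_) ?_ <;> refine Submodule.smul_mem _ _ ?_
    · refine sh_mem_sp h₁.1 ?_
      rintro ⟨a, b⟩ hs
      simp only [mem_box, Set.mem_sdiff, Set.mem_singleton_iff, Prod.mk_eq_zero,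
        Prod.mk_add_mk] at *; omega
    · refine sh_mem_sp h₂.1 ?_
      rintro ⟨a, b⟩ hs
      simp only [mem_box, Set.mem_sdiff, Set.mem_singleton_iff, Prod.mk_eq_zero,
        Prod.mk_add_mk] at *; omega
    · refine sh_mem_sp h₀.1 ?_
      rintro ⟨a, b⟩ hs
      simp only [mem_box, Set.mem_sdiff, Set.mem_singleton_iff, Prod.mk_eq_zero,
        Prod.mk_add_mk] at *; omega
  -- On columns 1, …, n the kernels r and conj z₀ · (z r₁) agree. The rest of X is w times a kernel
  -- difference orthogonal to these columns, to which decoupling applies after reversal.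
  have hperp1 : r - X ∈ perp e {s | 1 ≤ s.1 ∧ s.1 ≤ n ∧ 0 ≤ s.2 ∧ s.2 ≤ m} := by
    rw [hX1, ← sub_sub]
    refine sub_mem (hr.sub_smul_sh_mem_perp he h₁ fun s hs => ?_)
      (Submodule.smul_mem _ _ (hK.sh_mem_perp he ?_ (h₂.sub_smul_sh_mem_perp he h₀ fun s hs => ?_)))
    · simp only [mem_box, Set.mem_ofPred_eq, Prod.fst_sub, Prod.snd_sub] at *; omega
    · refine sub_mem h₂.1 (Submodule.smul_mem _ _ (sh_mem_sp h₀.1 fun s hs => ?_))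
      simp only [mem_box, Prod.fst_add, Prod.snd_add] at *; omega
    · simp only [mem_box, Set.mem_ofPred_eq, Prod.fst_sub, Prod.snd_sub] at *; omega
  have hperp2 : r - X ∈ perp e {s | 1 ≤ s.2 ∧ s.2 ≤ m ∧ 0 ≤ s.1 ∧ s.1 ≤ n} := by
    have hr' := hr.swapped
    have h₀' := h₀.swapped
    have h₁' := h₁.swapped
    have h₂' := h₂.swapped
    rw [swap_box] at hr' h₀' h₁' h₂'
    have hsw : sh e (0, 1) = sh (swapped e) (1, 0) := by
      ext f; rw [sh_swapped]; rfl
    have hsw' : sh e (1, 0) = sh (swapped e) (0, 1) := by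
      ext f; rw [sh_swapped]; rfl
    rw [hX2, ← sub_sub]
    have hd : r - conj w₀ • sh e (0, 1) r₂
        - conj z₀ • sh e (1, 0) (r₁ - conj w₀ • sh e (0, 1) r₀) ∈
        perp (swapped e) {s | 1 ≤ s.1 ∧ s.1 ≤ m ∧ 0 ≤ s.2 ∧ s.2 ≤ n} := by
      rw [hsw, hsw']
      refine sub_mem (hr'.sub_smul_sh_mem_perp he.swapped h₂' fun s hs => ?_)
        (Submodule.smul_mem _ _ ((decoupled_swapped.2 hK).sh_mem_perp he.swapped ?_
          (h₁'.sub_smul_sh_mem_perp he.swapped h₀' fun s hs => ?_)))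
      · simp only [mem_box, Set.mem_ofPred_eq, Prod.fst_sub, Prod.snd_sub] at *; omega
      · refine sub_mem h₁'.1 (Submodule.smul_mem _ _ (sh_mem_sp h₀'.1 fun s hs => ?_))
        simp only [mem_box, Prod.fst_add, Prod.snd_add] at *; omega
      · simp only [mem_box, Set.mem_ofPred_eq, Prod.fst_sub, Prod.snd_sub] at *; omega
    rwa [perp_swapped] at hd
  have hperp : r - X ∈ perp e (box n m \ {0}) := by
    refine perp_union ?_ hperp1 hperp2
    rintro ⟨a, b⟩ hs
    simp only [mem_box, Set.mem_sdiff, Set.mem_singleton_iff, Prod.mk_eq_zero,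
        Set.mem_union, Set.mem_ofPred_eq] at *
    omega
  have e2 : r - X = conj (evalAt e z₀ w₀ (rev e (n, m) p)) • rev e (n, m) p := by
    have hmem : rev e (n, m) (r - X) ∈ leadSpace e n m := by
      refine ⟨rev_mem_sp (sub_mem hr.1 (sp_mono Set.sdiff_subset hXsp)) fun s hs => ?_,
        rev_mem_perp he hperp ?_⟩
      · simp only [mem_box, Prod.fst_sub, Prod.snd_sub] at *; omega
      · rintro ⟨a, b⟩ hs
        simp only [mem_box, Set.mem_sdiff, Set.mem_singleton_iff, Prod.mk_eq_zero,
          Prod.mk_sub_mk, Prod.mk.injEq] at *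
        omega
    obtain ⟨c, hc⟩ := eq_smul_of_mem_leadSpace hp hp0 hmem
    have hc' := congrArg (rev e (n, m)) hc
    rw [rev_rev, rev_smul] at hc'
    have hin := congrArg (inner ℂ (rev e (n, m) p)) hc'
    have hqX : inner ℂ (rev e (n, m) p) X = 0 := by
      refine inner_eq_zero_of_perp' (rev_mem_perp he hp.2 ?_) hXsp
      rintro ⟨a, b⟩ hs
      simp only [mem_box, Set.mem_sdiff, Set.mem_singleton_iff, Prod.mk_eq_zero,
        Prod.mk_sub_mk, Prod.mk.injEq] at *
      omega
    rw [inner_smul_right, inner_rev he, hpp, mul_one, inner_sub_right, hrq, hqX, sub_zero] at hin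
    rw [hc', hin]
  have v1 := congrArg (evalAt e z w) e1
  have v2 := congrArg (evalAt e z w) e2
  have f1 := evalAt_sh_fst z w h₁.1 fun s hs => hs.1
  have f2 := evalAt_sh_snd z w h₂.1 fun s hs => hs.2.2.1
  have f0 : evalAt e z w (sh e (1, 1) r₀) = z * (w * evalAt e z w r₀) := by
    have : sh e (1, 1) r₀ = sh e (1, 0) (sh e (0, 1) r₀) := by rw [sh_sh]; simp
    rw [this, evalAt_sh_fst z w (S := {s | 0 ≤ s.1}) (sh_mem_sp h₀.1 fun s hs => ?_) fun s hs => hs,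
      evalAt_sh_snd z w h₀.1 fun s hs => hs.2.2.1]
    simp only [mem_box, Set.mem_ofPred_eq, Prod.fst_add] at *; omega
  rw [hX] at v2
  simp only [map_sub, map_add, map_smul, smul_eq_mul, f1, f2, f0] at v1 v2
  linear_combination v1 - v2

end Stationary

section Stationary

variable {H : Type*} [NormedAddCommGroup H] [InnerProductSpace ℂ H]
  {e : Module.Basis (ℤ × ℤ) ℂ H}

/-! ### Stability of the reversed leading polynomial -/

/-- The smaller kernel is the orthogonal projection of the larger one, so the difference on the
diagonal is a squared norm. -/
theorem IsRepresenter.evalAt_sub {z w : ℂ} {S S' : Set (ℤ × ℤ)} {r r' : H}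
    (h : IsRepresenter e z w S r) (h' : IsRepresenter e z w S' r') (hS : S' ⊆ S) :
    evalAt e z w r - evalAt e z w r' = (‖r - r'‖ ^ 2 : ℝ) := by
  have h1 := h.2 (r - r') (sub_mem h.1 (sp_mono hS h'.1))
  have h2 : inner ℂ r' (r - r') = (0 : ℂ) :=
    inner_eq_zero_of_perp (h.sub_mem_perp h' fun s hs => ⟨hS hs, hs⟩) h'.1
  have h3 : inner ℂ (r - r') (r - r') = (‖r - r'‖ ^ 2 : ℂ) := inner_self_eq_norm_sq_to_K _
  rw [inner_sub_left, h1, h2, map_sub, sub_zero] at h3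
  rw [h3]; push_cast; rfl

theorem IsRepresenter.ne_zero {z w : ℂ} {S : Set (ℤ × ℤ)} {r : H}
    (h : IsRepresenter e z w S r) (h0 : 0 ∈ S) : r ≠ 0 := by
  rintro rfl
  have := h.2 _ (mem_sp_self h0)
  rw [inner_zero_left, evalAt_basis] at this
  simp at this

theorem continuous_evalAt (z : ℂ) (f : H) : Continuous fun w => evalAt e z w f := by
  induction f using induction_basis (e := e) with
  | h0 => simpa using continuous_const
  | hadd f g hf hg => simp only [map_add]; exact hf.add hg
  | hs c a =>
    simp only [map_smul, evalAt_basis]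
    fun_prop

/-- Comparing coefficients from the left edge of the box, each column vanishes because the preceding
one does. -/
theorem eq_zero_of_sh_eq_smul {z : ℂ} (hz : z ≠ 0) {i j : ℤ} {r : H} (hr : r ∈ sp e (box i j))
    (h : sh e (1, 0) r = z • r) : r = 0 := by
  have h1 : ∀ a b, e.repr r (a - 1, b) = z * e.repr r (a, b) := fun a b => by
    have := congrArg (fun f => e.repr f (a, b)) h
    simpa [repr_sh] using this
  have h2 : ∀ (k : ℕ) b, e.repr r ((k : ℤ) - 1, b) = 0 := by
    intro k
    induction k with
    | zero => intro b; exact mem_sp.1 hr _ (by simp [mem_box])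
    | succ k ih =>
      intro b
      have := h1 k b
      rw [ih b] at this
      push_cast
      rw [add_sub_cancel_right]
      exact (mul_eq_zero.1 this.symm).resolve_left hz
  apply e.ext_elem
  rintro ⟨a, b⟩
  by_cases ha : 0 ≤ a
  · obtain ⟨k, hk⟩ := Int.eq_ofNat_of_zero_le (a := a + 1) (by omega)
    have := h2 k b
    rw [← hk, add_sub_cancel_right] at this
    simpa using this
  · simpa using mem_sp.1 hr (a, b) (by simp only [mem_box]; omega)

/-- If r₂ = r₀ = r, then z r is still in P_{n,m-1} and ⟨r, z r⟩ = z ‖r‖². As ‖z r‖ = ‖r‖ and |z| =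
1, this is equality in Cauchy–Schwarz: multiplication by z acts on r as the scalar z, which no
nonzero polynomial allows. -/
theorem IsRepresenter.ne_of_norm_eq_one (he : IsStationary e) {n m : ℤ} (hn : 0 ≤ n) (hm : 1 ≤ m)
    {z w : ℂ} (hz : ‖z‖ = 1) {r₀ r₂ : H}
    (h₀ : IsRepresenter e z w (box (n - 1) (m - 1)) r₀)
    (h₂ : IsRepresenter e z w (box n (m - 1)) r₂) : r₂ ≠ r₀ := by
  rintro rfl
  have hz0 : z ≠ 0 := by rintro rfl; simp at hz
  refine h₂.ne_zero (by simp [mem_box]; omega) (eq_zero_of_sh_eq_smul hz0 h₂.1 ?_)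
  have hU : sh e (1, 0) r₂ ∈ sp e (box n (m - 1)) := sh_mem_sp h₀.1 fun s hs => by
    simp only [mem_box, Prod.fst_add, Prod.snd_add] at *; omega
  have h1 := h₂.2 _ hU
  rw [evalAt_sh_fst z w h₂.1 fun s hs => hs.1, h₂.evalAt_self] at h1
  have h1' : inner ℂ (sh e (1, 0) r₂) r₂ = conj z * (‖r₂‖ ^ 2 : ℝ) := by
    rw [← inner_conj_symm, h1, map_mul, Complex.conj_ofReal]
  have hzz : z * conj z = 1 := by rw [Complex.mul_conj']; simp [hz]
  rw [← sub_eq_zero, ← inner_self_eq_zero (𝕜 := ℂ), inner_sub_left, inner_sub_right,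
    inner_sub_right, inner_smul_left, inner_smul_left, inner_smul_right, inner_smul_right,
    inner_sh he, h1, h1', inner_self_eq_norm_sq_to_K]
  push_cast
  linear_combination (-(‖r₂‖ : ℂ) ^ 2) * hzz

/-- For |z| = 1 and both first coordinates equal to z, Christoffel–Darboux keeps only r₂ - r₀. At a
zero of the reverse, the diagonal gives -|p|² = (1 - |w|²)‖r₂ - r₀‖², impossible for |w| < 1 since
r₂ ≠ r₀; the case |w| = 1 needs the formula off the diagonal. -/
theorem Decoupled.evalAt_rev_ne_zero_face (he : IsStationary e) {n m : ℤ} (hn : 0 ≤ n)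
    (hm : 1 ≤ m) (hK : Decoupled e n m) {p : H} (hp : p ∈ leadSpace e n m) (hp1 : ‖p‖ = 1)
    {z w : ℂ} (hz : ‖z‖ = 1) (hw : ‖w‖ ≤ 1) : evalAt e z w (rev e (n, m) p) ≠ 0 := by
  intro hq
  obtain ⟨r₀, h₀⟩ := exists_isRepresenter (e := e) z w (finite_box (n - 1) (m - 1))
  obtain ⟨r₁, h₁⟩ := exists_isRepresenter (e := e) z w (finite_box (n - 1) m)
  obtain ⟨r₂, h₂⟩ := exists_isRepresenter (e := e) z w (finite_box n (m - 1))
  have hzz : z * conj z = 1 := by rw [Complex.mul_conj']; simp [hz]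
  have cd : ∀ w', - (evalAt e z w' p * conj (evalAt e z w p)) =
      (1 - w' * conj w) * evalAt e z w' (r₂ - r₀) := fun w' => by
    have := hK.christoffel_darboux he hp hp1 h₀ h₁ h₂ z w'
    rw [hq, map_zero, mul_zero, zero_sub, hzz] at this
    rw [this, map_sub]; ring
  have ha := h₂.evalAt_sub h₀ (box_mono (by omega) le_rfl)
  rw [← map_sub] at ha
  have hpos : 0 < ‖r₂ - r₀‖ ^ 2 :=
    pow_pos (norm_pos_iff.2 (sub_ne_zero.2 (h₀.ne_of_norm_eq_one he hn hm hz h₂))) 2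
  have hdiag := cd w
  rw [ha, Complex.mul_conj', Complex.mul_conj'] at hdiag
  have hdiag' : -(‖evalAt e z w p‖ ^ 2) = (1 - ‖w‖ ^ 2) * ‖r₂ - r₀‖ ^ 2 := by
    exact_mod_cast hdiag
  have hw1 : ‖w‖ = 1 := by
    by_contra hne
    have hlt : ‖w‖ < 1 := lt_of_le_of_ne hw hne
    have : 0 < 1 - ‖w‖ ^ 2 := by nlinarith [norm_nonneg w]
    nlinarith [mul_pos this hpos, sq_nonneg ‖evalAt e z w p‖]
  have hp0 : evalAt e z w p = 0 := by
    rw [hw1] at hdiag'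
    have : ‖evalAt e z w p‖ ^ 2 = 0 := by linarith
    simpa using this
  have hww : w * conj w = 1 := by rw [Complex.mul_conj']; simp [hw1]
  -- With |w| = 1 also p(z, w) = 0, so (1 - w' conj w)(r₂ - r₀)(z, w') = 0 for all w'. The first
  -- factor vanishes only at w' = w, and continuity recovers that point.
  have hoff : Set.EqOn (fun w' => evalAt e z w' (r₂ - r₀)) (fun _ => 0) {w}ᶜ := by
    intro w' hw'
    have := cd w'
    rw [hp0, map_zero, mul_zero, neg_zero] at this
    refine (mul_eq_zero.1 this.symm).resolve_left fun h => hw' ?_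
    have h' : w' - w = 0 := by linear_combination (-w) * h - w' * hww
    exact sub_eq_zero.1 h'
  have hall := Continuous.ext_on (dense_compl_singleton w) (continuous_evalAt z _)
    continuous_const hoff
  have hz' : evalAt e z w (r₂ - r₀) = 0 := congrFun hall w
  rw [ha] at hz'
  exact hpos.ne' (by exact_mod_cast hz')

/-- At an interior zero of the reverse, the diagonal Christoffel–Darboux formula becomes a vanishing
sum of nonnegative terms in |p|², ‖r₁ - r₀‖², ‖r₂ - r₀‖², ‖r₀‖². Hence r₂ = r₀ = 0, although r₂
evaluates the constant 1; m ≥ 1 puts this constant in its box. -/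
theorem Decoupled.evalAt_rev_ne_zero_interior (he : IsStationary e) {n m : ℤ} (hn : 0 ≤ n)
    (hm : 1 ≤ m) (hK : Decoupled e n m) {p : H} (hp : p ∈ leadSpace e n m) (hp1 : ‖p‖ = 1)
    {z w : ℂ} (hz : ‖z‖ < 1) (hw : ‖w‖ < 1) : evalAt e z w (rev e (n, m) p) ≠ 0 := by
  intro hq
  obtain ⟨r₀, h₀⟩ := exists_isRepresenter (e := e) z w (finite_box (n - 1) (m - 1))
  obtain ⟨r₁, h₁⟩ := exists_isRepresenter (e := e) z w (finite_box (n - 1) m)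
  obtain ⟨r₂, h₂⟩ := exists_isRepresenter (e := e) z w (finite_box n (m - 1))
  have cd := hK.christoffel_darboux he hp hp1 h₀ h₁ h₂ z w
  have h2 := h₂.evalAt_sub h₀ (box_mono (by omega) le_rfl)
  have h1 := h₁.evalAt_sub h₀ (box_mono le_rfl (by omega))
  rw [sub_eq_iff_eq_add, h₀.evalAt_self] at h1 h2
  rw [hq, map_zero, mul_zero, zero_sub, h1, h2, h₀.evalAt_self, Complex.mul_conj',
    Complex.mul_conj', Complex.mul_conj'] at cd
  have cd' : -(‖evalAt e z w p‖ ^ 2) = (1 - ‖z‖ ^ 2) * (‖r₁ - r₀‖ ^ 2 + ‖r₀‖ ^ 2) +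
      (1 - ‖w‖ ^ 2) * (‖r₂ - r₀‖ ^ 2 + ‖r₀‖ ^ 2) - (1 - ‖z‖ ^ 2 * ‖w‖ ^ 2) * ‖r₀‖ ^ 2 := by
    exact_mod_cast cd
  have hz' : 0 < 1 - ‖z‖ ^ 2 := by nlinarith [norm_nonneg z]
  have hw' : 0 < 1 - ‖w‖ ^ 2 := by nlinarith [norm_nonneg w]
  have hsum : ‖evalAt e z w p‖ ^ 2 + (1 - ‖z‖ ^ 2) * ‖r₁ - r₀‖ ^ 2 +
      (1 - ‖w‖ ^ 2) * ‖r₂ - r₀‖ ^ 2 + (1 - ‖z‖ ^ 2) * (1 - ‖w‖ ^ 2) * ‖r₀‖ ^ 2 = 0 := by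
    linear_combination -cd'
  have t1 := mul_nonneg hz'.le (sq_nonneg ‖r₁ - r₀‖)
  have t2 := mul_nonneg hw'.le (sq_nonneg ‖r₂ - r₀‖)
  have t3 := mul_nonneg (mul_pos hz' hw').le (sq_nonneg ‖r₀‖)
  have t4 := sq_nonneg ‖evalAt e z w p‖
  have z2 : (1 - ‖w‖ ^ 2) * ‖r₂ - r₀‖ ^ 2 = 0 := by linarith
  have z0 : (1 - ‖z‖ ^ 2) * (1 - ‖w‖ ^ 2) * ‖r₀‖ ^ 2 = 0 := by linarith
  have z2' : r₂ - r₀ = 0 := by simpa using (mul_eq_zero.1 z2).resolve_left hw'.ne'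
  have z0' : r₀ = 0 := by simpa using (mul_eq_zero.1 z0).resolve_left (mul_pos hz' hw').ne'
  rw [z0', sub_zero] at z2'
  exact h₂.ne_zero (by simp [mem_box]; omega) z2'

theorem Decoupled.evalAt_rev_ne_zero_of_one_le (he : IsStationary e) {n m : ℤ} (hn : 0 ≤ n)
    (hm : 1 ≤ m) (hK : Decoupled e n m) {p : H} (hp : p ∈ leadSpace e n m) (hp1 : ‖p‖ = 1)
    {z w : ℂ} (hz : ‖z‖ ≤ 1) (hw : ‖w‖ ≤ 1) : evalAt e z w (rev e (n, m) p) ≠ 0 := by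
  rcases hz.eq_or_lt with hz1 | hz1
  · exact hK.evalAt_rev_ne_zero_face he hn hm hp hp1 hz1 hw
  rcases hw.eq_or_lt with hw1 | hw1
  -- For n = 0 the exchange of coordinates is unavailable, but the polynomial does not depend on z,
  -- which may be replaced by 1.
  · rcases hn.eq_or_lt with rfl | hn1
    · have hq : rev e (0, m) p ∈ sp e (box 0 m) := rev_mem_sp hp.1 fun s hs => by
        simp only [mem_box, Prod.fst_sub, Prod.snd_sub] at *; omega
      have : evalAt e z w (rev e (0, m) p) = evalAt e 1 w (rev e (0, m) p) := by
        refine eqOn_sp (fun s hs => ?_) hq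
        have : s.1 = 0 := le_antisymm hs.2.1 hs.1
        rw [evalAt_basis, evalAt_basis, this]; simp
      rw [this]
      exact hK.evalAt_rev_ne_zero_face he hn hm hp hp1 (by simp) hw
    · have := (decoupled_swapped.2 hK).evalAt_rev_ne_zero_face he.swapped (by omega) (by omega)
        (p := p) (by rwa [leadSpace_swapped]) hp1 hw1 hz
      rwa [evalAt_swapped, rev_swapped] at this
  · exact hK.evalAt_rev_ne_zero_interior he hn hm hp hp1 hz1 hw1

theorem Decoupled.evalAt_rev_ne_zero (he : IsStationary e) {n m : ℤ} (hn : 0 ≤ n)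
    (hm : 0 ≤ m) (hK : Decoupled e n m) {p : H} (hp : p ∈ leadSpace e n m) (hp1 : ‖p‖ = 1)
    {z w : ℂ} (hz : ‖z‖ ≤ 1) (hw : ‖w‖ ≤ 1) : evalAt e z w (rev e (n, m) p) ≠ 0 := by
  rcases hm.eq_or_lt with rfl | hm1
  · rcases hn.eq_or_lt with rfl | hn1
    · have hq : rev e (0, 0) p = e.repr (rev e (0, 0) p) 0 • e 0 := by
        apply e.ext_elem; intro s
        by_cases hs : s = 0
        · simp [hs]
        · have : e.repr p (-s) = 0 := mem_sp.1 hp.1 _ fun h => hs (by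
            ext
            · have h1 := h.1; have h2 := h.2.1
              simp only [Prod.fst_neg, Prod.fst_zero] at *; omega
            · have h1 := h.2.2.1; have h2 := h.2.2.2
              simp only [Prod.snd_neg, Prod.snd_zero] at *; omega)
          simp [repr_rev, this, ← Prod.zero_eq_mk, Ne.symm hs]
      rw [hq, map_smul, evalAt_basis]
      simp only [Prod.fst_zero, Int.toNat_zero, pow_zero, Prod.snd_zero, mul_one, smul_eq_mul]
      intro h0
      rw [h0, zero_smul] at hq
      have := congrArg (rev e (0, 0)) hq
      rw [rev_rev, rev_zero] at this
      rw [this] at hp1; simp at hp1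
    · have := (decoupled_swapped.2 hK).evalAt_rev_ne_zero_of_one_le he.swapped (by omega) hn1
        (p := p) (by rwa [leadSpace_swapped]) hp1 hw hz
      rwa [evalAt_swapped, rev_swapped] at this
  · exact hK.evalAt_rev_ne_zero_of_one_le he hn hm1 hp hp1 hz hw

end Stationary

/-! ### Bounded solutions of linear recurrences -/

/-- The left shift on sequences. -/
def leftShift : Module.End ℂ (ℕ → ℂ) where
  toFun c b := c (b + 1)
  map_add' _ _ := rfl
  map_smul' _ _ := rfl

theorem leftShift_pow_apply (t : ℕ) (c : ℕ → ℂ) (b : ℕ) : (leftShift ^ t) c b = c (b + t) := by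
  induction t generalizing b with
  | zero => simp
  | succ t ih =>
    rw [pow_succ', Module.End.mul_apply]
    change (leftShift ^ t) c (b + 1) = _
    rw [ih]; congr 1; omega

/-- A bounded sequence annihilated by a polynomial in the shift without zeros in the closed unit
disk vanishes. -/
theorem eq_zero_of_aeval_leftShift (d : ℕ) : ∀ Q : Polynomial ℂ, Q.natDegree = d →
    (∀ w : ℂ, ‖w‖ ≤ 1 → Q.eval w ≠ 0) → ∀ c : ℕ → ℂ, (∃ M, ∀ b, ‖c b‖ ≤ M) →
    Polynomial.aeval leftShift Q c = 0 → c = 0 := by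
  induction d with
  | zero =>
    intro Q hd hQ c _ h
    rw [Polynomial.eq_C_of_natDegree_eq_zero hd, Polynomial.aeval_C,
      Module.algebraMap_end_apply] at h
    refine (smul_eq_zero.1 h).resolve_left fun h0 => hQ 0 (by simp) ?_
    rw [Polynomial.eq_C_of_natDegree_eq_zero hd, h0]; simp
  | succ d ih =>
    intro Q hd hQ c ⟨M, hM⟩ h
    have hdeg : Q.degree ≠ 0 := by
      intro h0
      have := Polynomial.natDegree_eq_zero_iff_degree_le_zero.2 h0.le
      omega
    obtain ⟨r, hr⟩ := IsAlgClosed.exists_root Q hdeg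
    obtain ⟨R, rfl⟩ := Polynomial.dvd_iff_isRoot.2 hr
    have hR0 : R ≠ 0 := by rintro rfl; simp at hd
    have hRd : R.natDegree = d := by
      rw [Polynomial.natDegree_mul (Polynomial.X_sub_C_ne_zero r) hR0,
        Polynomial.natDegree_X_sub_C] at hd
      omega
    have hr1 : 1 < ‖r‖ := by
      by_contra hle
      exact hQ r (not_lt.1 hle) hr
    -- For a root r, the sequence (S - r)c is bounded and annihilated by the cofactor `R`, so it
    -- vanishes by induction. Then c is geometric with ratio |r| > 1 and bounded, hence zero.
    have hc : leftShift c - r • c = 0 := by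
      refine ih R hRd (fun w hw h0 => hQ w hw (by rw [Polynomial.eval_mul, h0, mul_zero])) _
        ⟨M + ‖r‖ * M, fun b => ?_⟩ ?_
      · refine (norm_sub_le _ _).trans (add_le_add (hM _) ?_)
        rw [Pi.smul_apply, norm_smul]
        exact mul_le_mul_of_nonneg_left (hM b) (norm_nonneg r)
      · rw [mul_comm, map_mul, Module.End.mul_apply] at h
        simpa using h
    have hstep : ∀ b, c (b + 1) = r * c b := fun b => by
      have := congrFun hc b
      exact sub_eq_zero.1 this
    have hpow : ∀ b, c b = r ^ b * c 0 := by
      intro b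
      induction b with
      | zero => simp
      | succ b ihb => rw [hstep, ihb, pow_succ]; ring
    have h0 : c 0 = 0 := by
      by_contra hne
      have hpos : 0 < ‖c 0‖ := norm_pos_iff.2 hne
      obtain ⟨b, hb⟩ := pow_unbounded_of_one_lt (M / ‖c 0‖) hr1
      have := hM b
      rw [hpow, norm_mul, norm_pow] at this
      rw [div_lt_iff₀ hpos] at hb
      linarith
    funext b
    rw [hpow, h0, mul_zero]; rfl

theorem eq_zero_of_recurrence {d : ℕ} {a : ℕ → ℂ}
    (ha : ∀ w : ℂ, ‖w‖ ≤ 1 → ∑ t ∈ Finset.range d, a t * w ^ t ≠ 0) {c : ℕ → ℂ} {M : ℝ}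
    (hM : ∀ b, ‖c b‖ ≤ M) (h : ∀ b, ∑ t ∈ Finset.range d, a t * c (b + t) = 0) (b : ℕ) :
    c b = 0 := by
  set Q : Polynomial ℂ := ∑ t ∈ Finset.range d, Polynomial.C (a t) * Polynomial.X ^ t with hQ
  have := eq_zero_of_aeval_leftShift _ Q rfl (fun w hw => by
    simpa [hQ, Polynomial.eval_finsetSum] using ha w hw) c ⟨M, hM⟩ (by
    funext b
    simp only [hQ, map_sum, map_mul, Polynomial.aeval_C, map_pow, Polynomial.aeval_X,
      LinearMap.sum_apply, Finset.sum_apply, Module.End.mul_apply, Module.algebraMap_end_apply,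
      Pi.smul_apply, leftShift_pow_apply, smul_eq_mul]
    exact h b)
  exact congrFun this b

section Stationary

variable {H : Type*} [NormedAddCommGroup H] [InnerProductSpace ℂ H]
  {e : Module.Basis (ℤ × ℤ) ℂ H}

/-! ### Bernstein–Szegő families -/

theorem eq_sum_of_mem_sp {F : Finset (ℤ × ℤ)} {S : Set (ℤ × ℤ)} (hS : S ⊆ F) {f : H}
    (hf : f ∈ sp e S) : f = ∑ s ∈ F, e.repr f s • e s := by
  conv_lhs => rw [← e.linearCombination_repr f]
  rw [Finsupp.linearCombination_apply, Finsupp.sum]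
  refine Finset.sum_subset (fun s hs => hS ?_) fun s _ hs => ?_
  · by_contra h
    exact (Finsupp.mem_support_iff.1 hs) (mem_sp.1 hf s h)
  · rw [Finsupp.notMem_support_iff.1 hs, zero_smul]

variable (e) in
/-- The orthogonality relations satisfied by a stable polynomial `q` of degree at most `(n, m)`
with respect to the weight `1 / |q|²`. -/
structure IsBernsteinSzego (n m : ℕ) (q : H) : Prop where
  mem : q ∈ sp e (box n m)
  inner_sh_self : ∀ s, inner ℂ q (sh e s q) = if s = 0 then 1 else 0
  mem_perp : q ∈ perp e {s | 0 < s.1 ∨ 0 < s.2}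
  evalAt_left_ne : ∀ w : ℂ, ‖w‖ ≤ 1 → evalAt e 0 w q ≠ 0
  evalAt_right_ne : ∀ z : ℂ, ‖z‖ ≤ 1 → evalAt e z 0 q ≠ 0

namespace IsBernsteinSzego

variable {n m : ℕ} {q : H}

theorem swapped (h : IsBernsteinSzego e n m q) :
    IsBernsteinSzego (Bicircle.swapped e) m n q where
  mem := by rw [sp_swapped, swap_box]; exact h.mem
  inner_sh_self s := by
    rw [sh_swapped, h.inner_sh_self]
    simp [Prod.ext_iff, and_comm]
  mem_perp := by
    rw [perp_swapped]
    exact perp_anti (fun s hs => Or.symm hs) h.mem_perp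
  evalAt_left_ne w hw := by rw [evalAt_swapped]; exact h.evalAt_right_ne w hw
  evalAt_right_ne w hw := by rw [evalAt_swapped]; exact h.evalAt_left_ne w hw

/-- Only the support condition involves (n, m), so whatever is proved at (n, m) holds for all larger
degree bounds. -/
theorem mono (h : IsBernsteinSzego e n m q) {n' m' : ℕ} (hn : n ≤ n') (hm : m ≤ m') :
    IsBernsteinSzego e n' m' q :=
  { h with mem := sp_mono (box_mono (by omega) (by omega)) h.mem }

theorem rev_mem (h : IsBernsteinSzego e n m q) : rev e (n, m) q ∈ sp e (box n m) :=
  rev_mem_sp h.mem fun s hs => by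
    simp only [mem_box, Prod.fst_sub, Prod.snd_sub] at *; omega

theorem rev_mem_perp (he : IsStationary e) (h : IsBernsteinSzego e n m q) :
    rev e (n, m) q ∈ perp e {s | s.1 < n ∨ s.2 < m} :=
  Bicircle.rev_mem_perp he h.mem_perp fun s hs => by
    simp only [Set.mem_ofPred_eq, Prod.fst_sub, Prod.snd_sub] at *; omega

variable (e) in
/-- The vectors biorthogonal to the monomials in the strip `0 ≤ a < n`. -/
noncomputable def dual (n m : ℕ) (q : H) (k : ℤ) : H :=
  ∑ s ∈ (finite_box n m).toFinset with s.1 ≤ k,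
    (conj (e.repr q s) • sh e ((k, 0) - s) q -
      conj (e.repr (rev e (n, m) q) s) • sh e ((k, 0) - s) (rev e (n, m) q))

/-- Expanding ⟨q, z^v q⟩ = δ in the coefficients of the second q gives the claim with v = a - (k,
0): terms with s.1 > k vanish since q is orthogonal to positive exponents. The terms with the
reverse contribute nothing here, because only columns below n are met; they serve to cut the support
in `dual_mem`. -/
theorem inner_dual (he : IsStationary e) (h : IsBernsteinSzego e n m q) {k : ℤ} {a : ℤ × ℤ}
    (ha : 0 ≤ a.1) (ha' : a.1 < n) :
    inner ℂ (dual e n m q k) (e a) = if a = (k, 0) then 1 else 0 := by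
  have hsh : ∀ (s : ℤ × ℤ) (f : H),
      inner ℂ (sh e ((k, 0) - s) f) (e a) = inner ℂ f (e (s + (a - (k, 0)))) := fun s f => by
    rw [inner_sh_left he, sh_basis]; congr 2; abel
  have h1 : inner ℂ (dual e n m q k) (e a) =
      ∑ s ∈ (finite_box n m).toFinset with s.1 ≤ k,
        e.repr q s * inner ℂ q (e (s + (a - (k, 0)))) := by
    rw [dual, sum_inner]
    refine Finset.sum_congr rfl fun s hs => ?_
    rw [inner_sub_left, inner_smul_left, inner_smul_left, hsh, hsh, Complex.conj_conj,
      ← inner_conj_symm (rev e (n, m) q), Bicircle.mem_perp.1 (h.rev_mem_perp he), map_zero,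
      mul_zero, sub_zero]
    simp only [Finset.mem_filter] at hs
    left
    simp only [Prod.fst_add, Prod.fst_sub]
    omega
  rw [h1, Finset.sum_filter_of_ne fun s _ hs => ?_]
  · have h2 := h.inner_sh_self (a - (k, 0))
    conv_lhs at h2 =>
      arg 3
      rw [eq_sum_of_mem_sp (F := (finite_box n m).toFinset) (by simp) h.mem]
    simp only [map_sum, map_smul, sh_basis, inner_sum, inner_smul_right, sub_eq_zero] at h2
    exact h2
  · by_contra hk
    refine hs ?_
    rw [← inner_conj_symm, Bicircle.mem_perp.1 h.mem_perp, map_zero, mul_zero]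
    left
    simp only [Prod.fst_add, Prod.fst_sub]
    omega

/-- A polynomial and its reverse have the same autocorrelation, the coefficients of |q|²; the
substitution is s ↦ N - v - s. -/
theorem sum_conj_repr_mul (N v : ℤ × ℤ) {F : Finset (ℤ × ℤ)}
    (h : ∀ s ∉ F, e.repr q s = 0) (h' : ∀ s ∉ F, e.repr (rev e N q) s = 0) :
    ∑ s ∈ F, conj (e.repr (rev e N q) s) * e.repr (rev e N q) (s + v) =
      ∑ s ∈ F, conj (e.repr q s) * e.repr q (s + v) := by
  rw [← tsum_eq_sum (L := SummationFilter.unconditional _)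
      (f := fun s => conj (e.repr q s) * e.repr q (s + v)) fun s hs => by simp [h s hs],
    ← tsum_eq_sum (L := SummationFilter.unconditional _)
      (f := fun s => conj (e.repr (rev e N q) s) * e.repr (rev e N q) (s + v))
      fun s hs => by simp only [h' s hs, map_zero, zero_mul],
    ← (Equiv.subLeft (N - v)).tsum_eq]
  refine tsum_congr fun s => ?_
  simp only [Equiv.subLeft_apply, repr_rev, Complex.conj_conj]
  have h1 : N - (N - v - s) = s + v := by abel
  have h2 : N - (N - v - s + v) = s := by abel
  rw [h1, h2, mul_comm]

/-- For columns ≥ n the restriction s.1 ≤ k holds wherever the summand is nonzero, so the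
coefficient is a difference of full autocorrelations of q and its reverse, which cancel. Negative
columns and rows beyond ±m lie outside the support of every term. -/
theorem dual_mem (h : IsBernsteinSzego e n m q) {k : ℤ} :
    dual e n m q k ∈ sp e {s | 0 ≤ s.1 ∧ s.1 < n ∧ -m ≤ s.2 ∧ s.2 ≤ m} := by
  rw [mem_sp]
  intro x hx
  have hq : ∀ s, s ∉ box n m → e.repr q s = 0 := mem_sp.1 h.mem
  have hp : ∀ s, s ∉ box n m → e.repr (rev e (n, m) q) s = 0 := mem_sp.1 h.rev_mem
  have hterm : ∀ s, x - ((k, 0) - s) = s + (x - (k, 0)) := fun s => by abel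
  simp only [dual, map_sum, map_sub, map_smul, Finsupp.finsetSum_apply, Finsupp.sub_apply,
    Finsupp.smul_apply, repr_sh, smul_eq_mul, hterm]
  by_cases hxn : (n : ℤ) ≤ x.1
  · rw [Finset.sum_filter_of_ne fun s hs hne => ?_]
    · rw [Finset.sum_sub_distrib, sum_conj_repr_mul, sub_self]
      · intro s hs; exact hq s (by simpa using hs)
      · intro s hs; exact hp s (by simpa using hs)
    · by_contra hk
      refine hne ?_
      have : s + (x - (k, 0)) ∉ box n m := by
        simp only [mem_box, Prod.fst_add, Prod.fst_sub]; omega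
      rw [hq _ this, hp _ this, mul_zero, mul_zero, sub_zero]
  · refine Finset.sum_eq_zero fun s hs => ?_
    have : s + (x - (k, 0)) ∉ box n m := by
      simp only [Finset.mem_filter, Set.Finite.mem_toFinset, mem_box, Set.mem_ofPred_eq,
        Prod.fst_add, Prod.fst_sub, Prod.snd_add, Prod.snd_sub] at *
      omega
    rw [hq _ this, hp _ this, mul_zero, mul_zero, sub_zero]

end IsBernsteinSzego

end Stationary

/-! ### The Markov property of the strip -/

section Stationary

variable {H : Type*} [NormedAddCommGroup H] [InnerProductSpace ℂ H]
  {e : Module.Basis (ℤ × ℤ) ℂ H}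

theorem norm_basis (he : IsStationary e) (s : ℤ × ℤ) : ‖e s‖ = ‖e 0‖ := by
  rw [← norm_sh he s (e 0), sh_basis, zero_add]

theorem norm_sq_add_of_inner_eq_zero {f g : H} (h : inner ℂ f g = 0) :
    ‖f + g‖ ^ 2 = ‖f‖ ^ 2 + ‖g‖ ^ 2 := by
  rw [sq, sq, sq]; exact norm_add_sq_eq_norm_sq_add_norm_sq_of_inner_eq_zero f g h

namespace IsBernsteinSzego

variable {n m : ℕ} {q : H}

theorem inner_sh_dual (he : IsStationary e) (h : IsBernsteinSzego e n m q) {k t : ℤ} {g : H}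
    (hg : g ∈ sp e {s | 0 ≤ s.1 ∧ s.1 < n}) :
    inner ℂ (sh e (0, t) (dual e n m q k)) g = e.repr g (k, t) := by
  refine eqOn_sp (L := (innerSL ℂ (sh e (0, t) (dual e n m q k))).toLinearMap)
    (L' := e.coord (k, t)) (fun s hs => ?_) hg
  change inner ℂ (sh e (0, t) (dual e n m q k)) (e s) = e.repr (e s) (k, t)
  rw [inner_sh_left he, sh_basis, h.inner_dual he (by simpa using hs.1) (by simpa using hs.2),
    Module.Basis.repr_self, Finsupp.single_apply]
  simp [Prod.ext_iff, add_neg_eq_zero]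

/-- Although the strip is infinite, its coefficient functionals are vertical translates of finitely
many dual vectors, so they are uniformly bounded. -/
theorem norm_repr_le (he : IsStationary e) (h : IsBernsteinSzego e n m q) :
    ∃ K, 0 ≤ K ∧ ∀ g ∈ sp e {s | 0 ≤ s.1 ∧ s.1 < n}, ∀ k t : ℤ, 0 ≤ k → k < n →
      ‖e.repr g (k, t)‖ ≤ K * ‖g‖ := by
  refine ⟨∑ k ∈ Finset.Ico (0 : ℤ) n, ‖dual e n m q k‖,
    Finset.sum_nonneg fun _ _ => norm_nonneg _, fun g hg k t hk hk' => ?_⟩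
  rw [← h.inner_sh_dual he hg]
  refine (norm_inner_le_norm _ _).trans (mul_le_mul_of_nonneg_right ?_ (norm_nonneg _))
  rw [norm_sh he]
  exact Finset.single_le_sum (f := fun k => ‖dual e n m q k‖) (fun _ _ => norm_nonneg _)
    (Finset.mem_Ico.2 ⟨hk, hk'⟩)

/-- The part of the strip with `-N ≤ b < m`. -/
def window (n m N : ℕ) : Set (ℤ × ℤ) := {s | 0 ≤ s.1 ∧ s.1 < n ∧ -N ≤ s.2 ∧ s.2 < m}

theorem finite_window (n m N : ℕ) : (window n m N).Finite :=
  (Set.finite_Icc ((0, -N) : ℤ × ℤ) (n, m)).subset fun _ hs =>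
    ⟨⟨hs.1, hs.2.2.1⟩, ⟨hs.2.1.le, hs.2.2.2.le⟩⟩

theorem window_mono {n m N M : ℕ} (h : N ≤ M) : window n m N ⊆ window n m M :=
  fun s hs => ⟨hs.1, hs.2.1, by have := hs.2.2.1; omega, hs.2.2.2⟩

/-- The residual of a vector with respect to a window has no coefficients away from the two ends
of the window. -/
theorem repr_residual_eq_zero (he : IsStationary e) (h : IsBernsteinSzego e n m q) {N : ℕ} {g : H}
    (hg : g ∈ sp e {s | 0 ≤ s.1 ∧ s.1 < n}) (hg' : g ∈ perp e (window n m N)) {k t : ℤ}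
    (ht : m ≤ t + N) (ht' : t < 0) : e.repr g (k, t) = 0 := by
  rw [← h.inner_sh_dual he hg]
  refine inner_eq_zero_of_perp hg' (sh_mem_sp h.dual_mem fun s hs => ?_)
  simp only [Set.mem_ofPred_eq, window, Prod.fst_add, Prod.snd_add] at *
  omega

/-- Let G be the part of f - u in the lowest m rows of the window. The middle rows of f - u vanish,
so f - u - G is f plus an element of P_{n-1,m-1}; as f is orthogonal to the latter, ‖f‖ ≤ ‖f - u‖ +
‖G‖. The vector f - u' has no coefficients in those m rows, so G is controlled by the difference of
the two residuals. -/
theorem norm_le_residual (he : IsStationary e) (h : IsBernsteinSzego e n m q) : ∃ K, ∀ f u u' : H,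
    ∀ N : ℕ, m ≤ N → f ∈ revlexSpace e ((n : ℤ) - 1) m → u ∈ sp e (window n m N) →
      f - u ∈ perp e (window n m N) → u' ∈ sp e (window n m (N + m)) →
      f - u' ∈ perp e (window n m (N + m)) →
      ‖f‖ ≤ ‖f - u‖ + K * ‖(f - u) - (f - u')‖ := by
  obtain ⟨K, hK0, hK⟩ := h.norm_repr_le he
  set T : Finset (ℤ × ℤ) := Finset.Ico (0 : ℤ) n ×ˢ Finset.Ico (0 : ℤ) m with hT
  refine ⟨∑ _s ∈ T, K * ‖e 0‖, fun f u u' N hN hf hu hfu hu' hfu' => ?_⟩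
  have hfs : f ∈ sp e {s | 0 ≤ s.1 ∧ s.1 < n} := sp_mono (fun s hs => by
    simp only [mem_box, Set.mem_ofPred_eq] at *; omega) hf.1
  have hws : ∀ N, sp e (window n m N) ≤ sp e {s | 0 ≤ s.1 ∧ s.1 < n} := fun N =>
    sp_mono fun s hs => ⟨hs.1, hs.2.1⟩
  have hF : f - u ∈ sp e {s | 0 ≤ s.1 ∧ s.1 < n} := sub_mem hfs (hws _ hu)
  have hF' : f - u' ∈ sp e {s | 0 ≤ s.1 ∧ s.1 < n} := sub_mem hfs (hws _ hu')
  -- Translation by `v` carries rows 0, …, m-1 to the lowest m rows of the window.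
  set v : ℤ × ℤ := (0, -(N : ℤ)) with hv
  set G : H := ∑ s ∈ T, e.repr (f - u) (s + v) • e (s + v) with hG
  have hGnorm : ‖G‖ ≤ (∑ _s ∈ T, K * ‖e 0‖) * ‖(f - u) - (f - u')‖ := by
    refine (norm_sum_le _ _).trans ?_
    rw [Finset.sum_mul]
    refine Finset.sum_le_sum fun s hs => ?_
    simp only [hT, Finset.mem_product, Finset.mem_Ico] at hs
    rw [norm_smul, norm_basis he, mul_right_comm]
    refine mul_le_mul_of_nonneg_right ?_ (norm_nonneg _)
    have h0 : e.repr (f - u') (s + v) = 0 :=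
      h.repr_residual_eq_zero he hF' hfu' (k := (s + v).1) (t := (s + v).2)
        (by simp only [hv, Prod.snd_add]; push_cast; omega)
        (by simp only [hv, Prod.snd_add]; omega)
    have h1 : e.repr (f - u) (s + v) = e.repr ((f - u) - (f - u')) (s + v) := by
      rw [map_sub e.repr (f - u), Finsupp.sub_apply, h0, sub_zero]
    rw [h1]
    exact hK _ (sub_mem hF hF') _ _ (by simp only [hv]; omega)
      (by simp only [hv]; omega)
  have hGrepr : ∀ s, e.repr G s = if s - v ∈ T then e.repr (f - u) s else 0 := by
    intro s
    simp only [hG, map_sum, map_smul, Finsupp.finsetSum_apply, Finsupp.smul_apply,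
      Module.Basis.repr_self, Finsupp.single_apply, smul_eq_mul]
    split_ifs with hs
    · rw [Finset.sum_eq_single (s - v)]
      · simp
      · intro t _ hts
        rw [if_neg fun h' => hts (eq_sub_of_add_eq h'), mul_zero]
      · exact fun h' => absurd hs h'
    · refine Finset.sum_eq_zero fun t ht => ?_
      rw [if_neg fun h' => hs (by rwa [← h', add_sub_cancel_right]), mul_zero]
  have hdiff : -(u + G) ∈ sp e (box ((n : ℤ) - 1) ((m : ℤ) - 1)) := by
    rw [mem_sp]
    rintro ⟨a, b⟩ hab
    simp only [mem_box] at hab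
    rw [map_neg, map_add, Finsupp.neg_apply, Finsupp.add_apply, hGrepr]
    have hmemT : ((a, b) - v ∈ T) ↔ 0 ≤ a ∧ a < n ∧ -(N : ℤ) ≤ b ∧ b < m - N := by
      simp only [hT, hv, Prod.mk_sub_mk, Finset.mem_product, Finset.mem_Ico]; omega
    simp only [hmemT]
    have hfz : e.repr f (a, b) = 0 ∨ b = m := by
      by_cases hbm : b = m
      · exact Or.inr hbm
      · exact Or.inl (mem_sp.1 hf.1 _ (by simp only [mem_box]; omega))
    split_ifs with hc
    · have : e.repr f (a, b) = 0 := hfz.resolve_right (by omega)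
      simp [this]
    · by_cases hw : (a, b) ∈ window n m N
      · simp only [window, Set.mem_ofPred_eq] at hw
        have h1 := h.repr_residual_eq_zero he hF hfu (k := a) (t := b) (by omega) (by omega)
        have h2 : e.repr f (a, b) = 0 := hfz.resolve_right (by omega)
        rw [map_sub, Finsupp.sub_apply, h2, zero_sub, neg_eq_zero] at h1
        simp [h1]
      · simp [mem_sp.1 hu _ hw]
  have horth : inner ℂ f (-(u + G)) = 0 := inner_eq_zero_of_perp' hf.2 hdiff
  have hle : ‖f‖ ≤ ‖f + -(u + G)‖ := by
    have := norm_sq_add_of_inner_eq_zero horth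
    refine le_of_sq_le_sq ?_ (norm_nonneg _)
    rw [this]; linarith [sq_nonneg ‖-(u + G)‖]
  calc ‖f‖ ≤ ‖(f - u) - G‖ := by convert hle using 2; abel
    _ ≤ ‖f - u‖ + ‖G‖ := norm_sub_le _ _
    _ ≤ _ := by gcongr

/-- The Markov property: `P_{n-1,m} ⊖ P_{n-1,m-1}` is orthogonal to all of the strip below. -/
theorem revlexSpace_le_perp_strip (he : IsStationary e) (h : IsBernsteinSzego e n m q) {f : H}
    (hf : f ∈ revlexSpace e ((n : ℤ) - 1) m) :
    f ∈ perp e {s | 0 ≤ s.1 ∧ s.1 < n ∧ s.2 < m} := by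
  choose u hu hfu using fun N : ℕ => exists_residual (e := e) (finite_window n m N) f
  obtain ⟨K, hK⟩ := h.norm_le_residual he
  have hpyth : ∀ M N, M ≤ N → ‖f - u M‖ ^ 2 = ‖f - u N‖ ^ 2 + ‖(f - u M) - (f - u N)‖ ^ 2 := by
    intro M N hMN
    rw [← norm_sq_add_of_inner_eq_zero (inner_eq_zero_of_perp' (hfu N) ?_), add_sub_cancel]
    rw [sub_sub_sub_cancel_left]
    exact sub_mem (hu N) (sp_mono (window_mono hMN) (hu M))
  have hanti : Antitone fun N => ‖f - u N‖ ^ 2 := fun M N hMN => by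
    have := hpyth M N hMN
    simp only
    nlinarith [sq_nonneg ‖(f - u M) - (f - u N)‖]
  obtain ⟨x, hx⟩ : ∃ x, Tendsto (fun N => ‖f - u N‖ ^ 2) atTop (𝓝 x) :=
    ⟨_, tendsto_atTop_ciInf hanti ⟨0, by rintro _ ⟨N, rfl⟩; positivity⟩⟩
  -- The squared residual norms decrease and converge; by Pythagoras their increments are the
  -- squared distances of the residuals.
  have hdiff : Tendsto (fun N => ‖(f - u N) - (f - u (N + m))‖) atTop (𝓝 0) := by
    have h1 : Tendsto (fun N => ‖f - u N‖ ^ 2 - ‖f - u (N + m)‖ ^ 2) atTop (𝓝 0) := by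
      simpa using hx.sub (hx.comp (tendsto_add_atTop_nat m))
    have h2 := h1.sqrt
    rw [Real.sqrt_zero] at h2
    refine h2.congr fun N => ?_
    rw [hpyth N (N + m) (by omega), add_sub_cancel_left, Real.sqrt_sq (norm_nonneg _)]
  -- The contribution of the lower end dies out as the window grows, so subtracting `u M` does not
  -- shorten f. Pythagoras then gives u M = 0: f is its own residual.
  have hle : ∀ M, ‖f‖ ≤ ‖f - u M‖ := by
    intro M
    have hlim : Tendsto (fun N => ‖f - u M‖ + K * ‖(f - u N) - (f - u (N + m))‖) atTop
        (𝓝 (‖f - u M‖ + K * 0)) := tendsto_const_nhds.add (hdiff.const_mul K)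
    rw [mul_zero, add_zero] at hlim
    refine ge_of_tendsto hlim ?_
    filter_upwards [eventually_ge_atTop (max M m)] with N hN
    have h1 := hK f (u N) (u (N + m)) N ((le_max_right _ _).trans hN) hf (hu _) (hfu _) (hu _)
      (hfu _)
    have h2 : ‖f - u N‖ ≤ ‖f - u M‖ :=
      le_of_sq_le_sq (hanti ((le_max_left _ _).trans hN)) (norm_nonneg _)
    linarith
  have hu0 : ∀ N, u N = 0 := by
    intro N
    have h1 := norm_sq_add_of_inner_eq_zero (inner_eq_zero_of_perp' (hfu N) (hu N))
    rw [sub_add_cancel] at h1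
    have h2 := pow_le_pow_left₀ (norm_nonneg f) (hle N) 2
    have h3 : ‖u N‖ ^ 2 = 0 := le_antisymm (by linarith) (sq_nonneg _)
    simpa using h3
  rw [Bicircle.mem_perp]
  intro s hs
  obtain ⟨N, hN⟩ := Int.eq_ofNat_of_zero_le (a := max 0 (-s.2)) (by omega)
  have := hfu N
  rw [hu0, sub_zero] at this
  exact Bicircle.mem_perp.1 this s ⟨hs.1, hs.2.1, by omega, hs.2.2⟩

/-- Only column n is new. Vertical translates of the reverse of q are orthogonal to f, and in the
strip below row m their terms pair to zero with f. What remains is a recurrence for the inner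
products in column n, with coefficients those of q(0, w), and stability leaves no nonzero bounded
solution. -/
theorem revlexSpace_le_perp (he : IsStationary e) (h : IsBernsteinSzego e n m q) {f : H}
    (hf : f ∈ revlexSpace e ((n : ℤ) - 1) m) :
    f ∈ perp e {s | 0 ≤ s.1 ∧ s.1 ≤ n ∧ s.2 < m} := by
  have hs := h.revlexSpace_le_perp_strip he hf
  have hzero : ∀ b : ℕ, inner ℂ (e ((n : ℤ), (m : ℤ) - 1 - b)) f = 0 := by
    refine eq_zero_of_recurrence (d := m + 1) (a := fun t => e.repr q (0, (t : ℤ)))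
      (c := fun b : ℕ => inner ℂ (e ((n : ℤ), (m : ℤ) - 1 - b)) f)
      (M := ‖e 0‖ * ‖f‖) (fun w hw h0 => h.evalAt_left_ne w hw ?_) (fun b => ?_) (fun b => ?_)
    · rw [eq_sum_of_mem_sp (F := (finite_box n m).toFinset) (by simp) h.mem]
      simp only [map_sum, map_smul, evalAt_basis, smul_eq_mul]
      refine Eq.trans (Eq.symm ?_) h0
      refine Finset.sum_of_injOn (fun t : ℕ => ((0 : ℤ), (t : ℤ))) (fun a _ b _ hab => by simpa using hab)
        (fun t ht => ?_) (fun s hs hs' => ?_) (fun t _ => by simp)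
      · simp only [Finset.coe_range, Set.mem_Iio] at ht
        simp only [Set.Finite.coe_toFinset, mem_box]; omega
      · simp only [Set.Finite.mem_toFinset, mem_box] at hs
        have hs1 : s.1.toNat ≠ 0 := fun hs0 => hs' ⟨s.2.toNat, by simp; omega, by
          ext <;> simp <;> omega⟩
        rw [zero_pow hs1]; ring
    · refine (norm_inner_le_norm _ _).trans ?_
      rw [norm_basis he]
    -- The shift by -1 - b puts the top row of the reverse at m - 1 - b, strictly below row m, so
    -- that the strip lemma applies to all terms outside column n.
    · have h1 : inner ℂ (sh e (0, -1 - (b : ℤ)) (rev e (n, m) q)) f = 0 := by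
        refine inner_eq_zero_of_perp' (S := {s | s.1 < n}) (sh_mem_perp he (h.rev_mem_perp he) fun s hs => ?_)
          (sp_mono (fun s hs => ?_) hf.1)
        · left; simpa using hs
        · simp only [mem_box, Set.mem_ofPred_eq] at *; omega
      rw [eq_sum_of_mem_sp (F := (finite_box n m).toFinset) (by simp) h.rev_mem] at h1
      simp only [map_sum, map_smul, sum_inner, inner_smul_left, sh_basis, repr_rev,
        Complex.conj_conj] at h1
      rw [← h1]
      refine Finset.sum_of_injOn (fun t : ℕ => ((n : ℤ), (m : ℤ) - t))
        (fun a _ b _ hab => by simpa using hab)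
        (fun t ht => ?_) (fun s hs0 hs' => ?_) (fun t _ => ?_)
      · simp only [Finset.coe_range, Set.mem_Iio] at ht
        simp only [Set.Finite.coe_toFinset, mem_box]; omega
      · simp only [Set.Finite.mem_toFinset, mem_box] at hs0
        have hs1 : s.1 ≠ n := fun h0 => hs' ⟨(m - s.2).toNat, by simp; omega, by
          ext <;> simp <;> omega⟩
        rw [Bicircle.mem_perp.1 hs, mul_zero]
        simp only [Set.mem_ofPred_eq, Prod.fst_add, Prod.snd_add]; omega
      · simp only [Prod.mk_sub_mk, sub_self, sub_sub_cancel, Prod.mk_add_mk, add_zero]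
        congr 4; push_cast; ring
  rw [Bicircle.mem_perp]
  rintro ⟨a, b⟩ ⟨h1, h2, h3⟩
  simp only at h1 h2 h3
  rcases h2.eq_or_lt with rfl | h2
  · obtain ⟨c, hc⟩ := Int.eq_ofNat_of_zero_le (a := m - 1 - b) (by omega)
    have := hzero c
    rwa [← hc, sub_sub_cancel] at this
  · exact Bicircle.mem_perp.1 hs _ ⟨h1, h2, h3⟩

/-- Multiplication by w^{j-m} identifies the complement at level m with that at level j, since the
former stays orthogonal to everything below after translation. -/
theorem revlexSpace_le_perp_of_le (he : IsStationary e) (h : IsBernsteinSzego e n m q) {j : ℤ}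
    (hj : m ≤ j) {f : H} (hf : f ∈ revlexSpace e ((n : ℤ) - 1) j) :
    f ∈ perp e {s | 0 ≤ s.1 ∧ s.1 ≤ n ∧ s.2 < j} := by
  obtain ⟨g, hg, rfl⟩ := exists_sh_eq (e := e) (T := box ((n : ℤ) - 1) m)
    (T₀ := box ((n : ℤ) - 1) (m - 1)) (s := (0, j - m)) (finite_box _ _)
    (box_mono le_rfl (by omega)) (by
      intro a ha
      simp only [mem_box, Prod.fst_sub, Prod.snd_sub] at *; omega) (by
      intro a ha
      simp only [mem_box, Prod.fst_add, Prod.snd_add] at *; omega) (fun g hg => by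
      refine sh_mem_perp he (h.revlexSpace_le_perp he hg) fun s hs => ?_
      simp only [mem_box, Set.mem_ofPred_eq, Prod.fst_sub, Prod.snd_sub] at *; omega) hf
  refine sh_mem_perp he (h.revlexSpace_le_perp he hg) fun s hs => ?_
  simp only [Set.mem_ofPred_eq, Prod.fst_sub, Prod.snd_sub] at *; omega

theorem decoupled (he : IsStationary e) (h : IsBernsteinSzego e n m q) {j : ℤ} (hj : m ≤ j) :
    Decoupled e n j :=
  decoupled_of_symm fun _ hg => perp_anti (fun s hs => by
    simp only [mem_box, Set.mem_ofPred_eq] at *; omega) (h.revlexSpace_le_perp_of_le he hj hg)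

theorem shiftsRevlex (he : IsStationary e) (h : IsBernsteinSzego e n m q) {j : ℤ} (hj : m ≤ j) :
    ShiftsRevlex e ((n : ℤ) - 1) j := fun _ hf =>
  sh_mem_perp he (h.revlexSpace_le_perp_of_le he hj hf) fun s hs => by
    simp only [mem_box, Set.mem_ofPred_eq, Prod.fst_sub, Prod.snd_sub] at *; omega

end IsBernsteinSzego

end Stationary

section Stationary

variable {H : Type*} [NormedAddCommGroup H] [InnerProductSpace ℂ H]
  {e : Module.Basis (ℤ × ℤ) ℂ H}

/-! ### Orthonormal bases adapted to the lexicographical ordering -/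

variable (e) in
/-- `φ l`, for `l ≤ j`, has leading monomial `z^i w^l` and is orthogonal to the lower monomials in
the lexicographical ordering of `box i j`. -/
structure IsLexFamily (i j : ℕ) (φ : ℕ → H) : Prop where
  mem : ∀ l ≤ j, φ l ∈ sp e {s | s ∈ box i j ∧ (s.1 < i ∨ s.2 ≤ l)}
  mem_perp : ∀ l ≤ j, φ l ∈ perp e {s | s ∈ box i j ∧ (s.1 < i ∨ s.2 < l)}
  repr_ne : ∀ l ≤ j, e.repr (φ l) (i, l) ≠ 0

namespace IsLexFamily

variable {i j : ℕ} {φ : ℕ → H}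

theorem mem_lexSpace (h : IsLexFamily e i j φ) {l : ℕ} (hl : l ≤ j) : φ l ∈ lexSpace e i j :=
  ⟨sp_mono (fun _ hs => hs.1) (h.mem l hl), perp_anti (fun s hs => by
    simp only [mem_box, Set.mem_ofPred_eq] at *; omega) (h.mem_perp l hl)⟩

theorem mem_leadSpace (h : IsLexFamily e i j φ) : φ j ∈ leadSpace e i j :=
  ⟨sp_mono (fun _ hs => hs.1) (h.mem j le_rfl), perp_anti (by
    rintro ⟨a, b⟩ hs
    simp only [mem_box, Set.mem_ofPred_eq, Set.mem_sdiff, Set.mem_singleton_iff,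
      Prod.mk.injEq] at *
    omega) (h.mem_perp j le_rfl)⟩

theorem ne_zero (h : IsLexFamily e i j φ) {l : ℕ} (hl : l ≤ j) : φ l ≠ 0 := fun h0 =>
  h.repr_ne l hl (by rw [h0]; simp)

/-- Triangular elimination: subtract multiples of φ j, φ (j-1), … until nothing is left in column i;
the remainder is then orthogonal to itself. -/
theorem mem_span (h : IsLexFamily e i j φ) {f : H} (hf : f ∈ lexSpace e i j) :
    f ∈ Submodule.span ℂ (φ '' Set.Iic j) := by
  suffices key : ∀ l ≤ j + 1, ∀ g ∈ sp e {s | s ∈ box i j ∧ (s.1 < i ∨ s.2 < (l : ℤ))},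
      g ∈ perp e (box (i - 1) j) → g ∈ Submodule.span ℂ (φ '' Set.Iic j) by
    refine key (j + 1) le_rfl f (sp_mono (fun s hs => ?_) hf.1) hf.2
    simp only [mem_box, Set.mem_ofPred_eq] at *; push_cast; omega
  intro l
  induction l with
  | zero =>
    intro _ g hg hg'
    have : g = 0 := by
      refine eq_zero_of_mem_of_perp (sp_mono (fun s hs => ?_) hg) hg'
      simp only [mem_box, Set.mem_ofPred_eq] at *; push_cast at hs; omega
    rw [this]; exact zero_mem _
  | succ l ih =>
    intro hl g hg hg'
    have hl' : l ≤ j := by omega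
    set c := e.repr g ((i : ℤ), (l : ℤ)) / e.repr (φ l) ((i : ℤ), (l : ℤ)) with hc
    have h1 : g - c • φ l ∈ sp e ({s | s ∈ box i j ∧ (s.1 < i ∨ s.2 ≤ (l : ℤ))} \
        {((i : ℤ), (l : ℤ))}) := by
      refine mem_sp_diff (sub_mem (sp_mono (fun s hs => ?_) hg)
        (Submodule.smul_mem _ _ (h.mem l hl'))) ?_
      · simp only [mem_box, Set.mem_ofPred_eq] at *; push_cast at hs; omega
      · rw [map_sub, map_smul, Finsupp.sub_apply, Finsupp.smul_apply, smul_eq_mul, hc,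
          div_mul_cancel₀ _ (h.repr_ne l hl'), sub_self]
    have h2 := ih (by omega) (g - c • φ l) (sp_mono (by
      rintro ⟨a, b⟩ hs
      simp only [mem_box, Set.mem_ofPred_eq, Set.mem_sdiff, Set.mem_singleton_iff,
        Prod.mk.injEq] at *
      omega) h1) (sub_mem hg' (Submodule.smul_mem _ _ (h.mem_lexSpace hl').2))
    have h3 := add_mem h2 (Submodule.smul_mem _ c
      (Submodule.subset_span (Set.mem_image_of_mem φ (Set.mem_Iic.2 hl'))))
    rwa [sub_add_cancel] at h3

/-- By stationarity z f is already orthogonal to columns 1, …, i. The residuals of monomials against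
those columns are the reverses of P_{i,j} ⊖ P_{i-1,j}, so testing against reversed family members
suffices. -/
theorem shiftsLex_iff (he : IsStationary e) (h : IsLexFamily e i j φ) :
    ShiftsLex e i j ↔ ∀ k ≤ j, ∀ l ≤ j,
      inner ℂ (rev e ((i : ℤ), (j : ℤ)) (φ k)) (sh e (1, 0) (φ l)) = 0 := by
  constructor
  · intro hs k hk l hl
    refine inner_eq_zero_of_perp (hs _ (h.mem_lexSpace hl))
      (rev_mem_sp (h.mem_lexSpace hk).1 fun s hs => ?_)
    simp only [mem_box, Prod.fst_sub, Prod.snd_sub] at *; omega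
  · intro hz f hf
    have h1 : ∀ k ≤ j, ∀ f ∈ Submodule.span ℂ (φ '' Set.Iic j),
        inner ℂ (rev e ((i : ℤ), (j : ℤ)) (φ k)) (sh e (1, 0) f) = 0 := by
      intro k hk f hf
      induction hf using Submodule.span_induction with
      | mem x hx => obtain ⟨l, hl, rfl⟩ := hx; exact hz k hk l hl
      | zero => simp
      | add x y _ _ hx hy => rw [map_add, inner_add_right, hx, hy, add_zero]
      | smul c x _ hx => rw [map_smul, inner_smul_right, hx, mul_zero]
    have h2 : ∀ g ∈ Submodule.span ℂ (φ '' Set.Iic j), ∀ f ∈ lexSpace e i j,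
        inner ℂ (rev e ((i : ℤ), (j : ℤ)) g) (sh e (1, 0) f) = 0 := by
      intro g hg f hf
      induction hg using Submodule.span_induction with
      | mem x hx => obtain ⟨l, hl, rfl⟩ := hx; exact h1 l hl f (h.mem_span hf)
      | zero => simp [rev_zero]
      | add x y _ _ hx hy => rw [rev_add, inner_add_left, hx, hy, add_zero]
      | smul c x _ hx => rw [rev_smul, inner_smul_left, hx, mul_zero]
    have hsub : {s : ℤ × ℤ | 1 ≤ s.1 ∧ s.1 ≤ i ∧ 0 ≤ s.2 ∧ s.2 ≤ j} ⊆ box i j := fun s hs => by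
      simp only [mem_box, Set.mem_ofPred_eq] at *; omega
    have h3 : sh e (1, 0) f ∈ perp e {s | 1 ≤ s.1 ∧ s.1 ≤ i ∧ 0 ≤ s.2 ∧ s.2 ≤ j} :=
      sh_mem_perp he hf.2 fun s hs => by
        simp only [mem_box, Set.mem_ofPred_eq, Prod.fst_sub, Prod.snd_sub] at *; omega
    rw [Bicircle.mem_perp]
    intro s hs
    obtain ⟨x, hx, hx'⟩ := exists_residual (e := e) ((finite_box i j).subset hsub) (e s)
    have h4 : rev e ((i : ℤ), (j : ℤ)) (e s - x) ∈ lexSpace e i j := by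
      refine ⟨rev_mem_sp (sub_mem (mem_sp_self hs) (sp_mono hsub hx)) fun s hs => ?_,
        rev_mem_perp he hx' fun s hs => ?_⟩ <;>
      · simp only [mem_box, Set.mem_ofPred_eq, Prod.fst_sub, Prod.snd_sub] at *; omega
    have h5 := h2 _ (h.mem_span h4) f hf
    rwa [rev_rev, inner_sub_left, inner_eq_zero_of_perp h3 hx, sub_zero] at h5

end IsLexFamily

variable {i j : ℕ} {φ ψ : ℕ → H}

theorem shiftsRevlex_iff (he : IsStationary e) (h : IsLexFamily (swapped e) j i φ) :
    ShiftsRevlex e i j ↔ ∀ k ≤ i, ∀ l ≤ i,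
      inner ℂ (rev e ((i : ℤ), (j : ℤ)) (φ k)) (sh e (0, 1) (φ l)) = 0 := by
  rw [← shiftsLex_swapped, h.shiftsLex_iff he.swapped]
  simp only [rev_swapped, sh_swapped, Prod.swap]

/-- The two families span the two complements of P_{i,j}, so decoupling is the vanishing of their
cross Gram matrix. -/
theorem decoupled_iff (hφ : IsLexFamily e (i + 1) j φ) (hψ : IsLexFamily (swapped e) (j + 1) i ψ) :
    Decoupled e (i + 1 : ℕ) (j + 1 : ℕ) ↔ ∀ k ≤ i, ∀ l ≤ j, inner ℂ (ψ k) (φ l) = 0 := by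
  have hψm : ∀ k ≤ i, ψ k ∈ revlexSpace e ((i + 1 : ℕ) - 1) (j + 1 : ℕ) := fun k hk => by
    have := hψ.mem_lexSpace hk
    rw [lexSpace_swapped] at this
    simpa using this
  have hφm : ∀ l ≤ j, φ l ∈ lexSpace e (i + 1 : ℕ) ((j + 1 : ℕ) - 1) := fun l hl => by
    simpa using hφ.mem_lexSpace hl
  constructor
  · intro h k hk l hl
    exact inner_eq_zero_of_perp (h _ (hφm l hl)) (hψm k hk).1
  · intro h f hf
    have h1 : ∀ k ≤ i, inner ℂ (ψ k) f = 0 := by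
      intro k hk
      have hf' : f ∈ Submodule.span ℂ (φ '' Set.Iic j) := hφ.mem_span (by simpa using hf)
      clear hf
      induction hf' using Submodule.span_induction with
      | mem x hx => obtain ⟨l, hl, rfl⟩ := hx; exact h k hk l hl
      | zero => simp
      | add x y _ _ hx hy => rw [inner_add_right, hx, hy, add_zero]
      | smul c x _ hx => rw [inner_smul_right, hx, mul_zero]
    have h2 : ∀ g ∈ revlexSpace e ((i + 1 : ℕ) - 1) (j + 1 : ℕ), inner ℂ g f = 0 := by
      intro g hg
      have hg' : g ∈ Submodule.span ℂ (ψ '' Set.Iic i) :=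
        hψ.mem_span (by rw [lexSpace_swapped]; simpa using hg)
      clear hg
      induction hg' using Submodule.span_induction with
      | mem x hx => obtain ⟨l, hl, rfl⟩ := hx; exact h1 l hl
      | zero => simp
      | add x y _ _ hx hy => rw [inner_add_left, hx, hy, add_zero]
      | smul c x _ hx => rw [inner_smul_left, hx, mul_zero]
    rw [mem_perp]
    intro s hs
    obtain ⟨x, hx, hx'⟩ := exists_residual (e := e)
      (finite_box (((i + 1 : ℕ) : ℤ) - 1) ((j + 1 : ℕ) - 1)) (e s)
    have h3 := h2 (e s - x) ⟨sub_mem (mem_sp_self hs)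
      (sp_mono (box_mono le_rfl (by omega)) hx), hx'⟩
    rwa [inner_sub_left, inner_eq_zero_of_perp hf.2 hx, sub_zero] at h3

theorem decoupled_of_nonpos {i j : ℤ} (h : i ≤ 0 ∨ j ≤ 0) : Decoupled e i j := by
  intro f hf
  rcases h with h | h
  · rw [mem_perp]
    intro s hs
    simp only [mem_box] at hs; omega
  · have : f = 0 := by
      apply e.ext_elem; intro s
      rw [mem_sp.1 hf.1 s (by simp only [mem_box]; omega)]; simp
    rw [this]; exact zero_mem _

theorem shiftsRevlex_of_neg {i j : ℤ} (h : i < 0) : ShiftsRevlex e i j := by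
  intro f hf
  rw [mem_perp]
  intro s hs
  simp only [mem_box] at hs; omega

theorem shiftsLex_of_neg {i j : ℤ} (h : j < 0) : ShiftsLex e i j := by
  intro f hf
  rw [mem_perp]
  intro s hs
  simp only [mem_box] at hs; omega

theorem leadOrthogonal_iff (hφ : IsLexFamily e (i + 1) j φ)
    (hψ : IsLexFamily (swapped e) (j + 1) i ψ) :
    LeadOrthogonal e (i + 1 : ℕ) (j + 1 : ℕ) ↔
      inner ℂ (rev e ((i : ℤ), (j + 1 : ℕ)) (ψ i)) (sh e (0, 1) (φ j)) = 0 := by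
  have h1 := hφ.mem_leadSpace
  have h2 := hψ.mem_leadSpace
  rw [leadSpace_swapped] at h2
  have e1 : (((i + 1 : ℕ) : ℤ) - 1) = i := by simp
  have e2 : (((j + 1 : ℕ) : ℤ) - 1) = j := by simp
  unfold LeadOrthogonal
  rw [e1, e2]
  constructor
  · exact fun h => h _ h1 _ h2
  · intro h p hp p' hp'
    obtain ⟨c, rfl⟩ := eq_smul_of_mem_leadSpace h1 (hφ.ne_zero le_rfl) hp
    obtain ⟨d, rfl⟩ := eq_smul_of_mem_leadSpace h2 (hψ.ne_zero le_rfl) hp'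
    rw [rev_smul, map_smul, inner_smul_left, inner_smul_right, h, mul_zero, mul_zero]

theorem Decoupled.mixedOrthogonal {i j : ℤ} (hi : 1 ≤ i) (hj : 1 ≤ j)
    (h : Decoupled e i j) : MixedOrthogonal e i j := by
  intro f hf g hg hf' hg'
  have h1 : f ∈ lexSpace e i (j - 1) := by
    refine ⟨?_, hf⟩
    rw [← sub_add_cancel f (e (i, 0))]
    exact add_mem (sp_mono (box_mono (by omega) le_rfl) hf')
      (mem_sp_self (by simp only [mem_box]; omega))
  have h2 : g ∈ sp e (box (i - 1) j) := by
    rw [← sub_add_cancel g (e (0, j))]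
    exact add_mem (sp_mono (box_mono le_rfl (by omega)) hg')
      (mem_sp_self (by simp only [mem_box]; omega))
  exact inner_eq_zero_of_perp (h f h1) h2

/-- The coefficient matrix of `z^i [w^j, …, 1]` in `[φ j, …, φ 0]`. -/
noncomputable def leadMatrix (e : Module.Basis (ℤ × ℤ) ℂ H) (i j : ℕ) (φ : ℕ → H) :
    Matrix (Fin (j + 1)) (Fin (j + 1)) ℂ :=
  Matrix.of fun a b => e.repr (φ (j - a)) ((i : ℤ), ((j - b : ℕ) : ℤ))

theorem IsLexFamily.isUnit_det_leadMatrix (h : IsLexFamily e i j φ) :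
    IsUnit (leadMatrix e i j φ).det := by
  have ht : (leadMatrix e i j φ).BlockTriangular id := by
    intro a b hab
    refine mem_sp.1 (h.mem (j - a) (by omega)) _ fun hs => ?_
    have hab' : (b : ℕ) < a := hab
    have := a.2
    have h2 := hs.2
    simp only at h2
    omega
  rw [Matrix.det_of_isUpperTriangular ht, isUnit_iff_ne_zero, Finset.prod_ne_zero_iff]
  intro a _
  exact h.repr_ne (j - a) (by omega)

/-- The residual of `z^i` with respect to `P_{i-1,j}` is the last row of the inverse of the
leading matrix applied to the family. -/
theorem IsLexFamily.eq_sum_of_residual (h : IsLexFamily e i j φ) {f : H}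
    (hf : f ∈ perp e (box (i - 1) j)) (hf' : f - e ((i : ℤ), 0) ∈ sp e (box (i - 1) j)) :
    f = ∑ a, (leadMatrix e i j φ)⁻¹ (Fin.last j) a • φ (j - a) := by
  set g := ∑ a, (leadMatrix e i j φ)⁻¹ (Fin.last j) a • φ (j - a) with hg
  have hgs : g ∈ lexSpace e i j :=
    Submodule.sum_mem _ fun a _ => Submodule.smul_mem _ _ (h.mem_lexSpace (by omega))
  refine sub_eq_zero.1 (eq_zero_of_mem_of_perp (e := e) (S := box (i - 1) j) ?_
    (sub_mem hf hgs.2))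
  have h1 : f - g = (f - e ((i : ℤ), 0)) - (g - e ((i : ℤ), 0)) := by abel
  rw [h1]
  refine sub_mem hf' (mem_sp.2 ?_)
  rintro ⟨a, b⟩ hab
  rw [map_sub, Finsupp.sub_apply, Module.Basis.repr_self, Finsupp.single_apply]
  by_cases hbox : (a, b) ∈ box i j
  · simp only [mem_box] at hbox hab
    have ha : a = i := by omega
    obtain ⟨c, hc⟩ := Int.eq_ofNat_of_zero_le hbox.2.2.1
    have hcj : c ≤ j := by omega
    subst ha hc
    have h2 : e.repr g ((i : ℤ), (c : ℤ)) =
        ((leadMatrix e i j φ)⁻¹ * leadMatrix e i j φ) (Fin.last j) ⟨j - c, by omega⟩ := by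
      rw [hg, Matrix.mul_apply]
      simp only [map_sum, map_smul, Finsupp.finsetSum_apply, Finsupp.smul_apply, smul_eq_mul,
        leadMatrix, Matrix.of_apply]
      have : j - (j - c) = c := by omega
      simp [this]
    rw [h2, Matrix.nonsing_inv_mul _ h.isUnit_det_leadMatrix, Matrix.one_apply]
    by_cases hc0 : c = 0
    · subst hc0
      rw [if_pos (by ext; simp), if_pos (by simp), sub_self]
    · rw [if_neg (fun h' => hc0 ?_), if_neg (fun h' => hc0 (by simpa using h'.symm)), sub_self]
      have := congrArg Fin.val h'
      simp only [Fin.val_last] at this; omega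
  · rw [mem_sp.1 hgs.1 _ hbox, if_neg (fun h' => hbox ?_), sub_zero]
    rw [← h']; simp [mem_box]

/-- By `IsLexFamily.eq_sum_of_residual`, the last rows of the inverse leading matrices express the
residuals of z^{i+1} and w^{j+1} in the two families, so the last entry of the triple product is
exactly the inner product of these residuals. -/
theorem mixedOrthogonal_of_entry (hφ : IsLexFamily e (i + 1) j φ)
    (hψ : IsLexFamily (swapped e) (j + 1) i ψ)
    (h : ((leadMatrix e (i + 1) j φ)⁻¹ *
      (Matrix.of fun a b => inner ℂ (ψ (i - b)) (φ (j - a)) :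
        Matrix (Fin (j + 1)) (Fin (i + 1)) ℂ) *
      ((leadMatrix (swapped e) (j + 1) i ψ).conjTranspose)⁻¹) (Fin.last j) (Fin.last i) = 0) :
    MixedOrthogonal e (i + 1 : ℕ) (j + 1 : ℕ) := by
  intro f hf g hg hf' hg'
  have e1 : (((i + 1 : ℕ) : ℤ) - 1) = i := by simp
  have e2 : (((j + 1 : ℕ) : ℤ) - 1) = j := by simp
  have hF := hφ.eq_sum_of_residual (f := f) (by rwa [e2] at hf) (by rwa [e2] at hf')
  have hG := hψ.eq_sum_of_residual (f := g)
    (by rw [perp_swapped, swap_box]; rwa [e1] at hg)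
    (by rw [sp_swapped, swap_box]; rw [e1] at hg'; simpa using hg')
  rw [hF, hG, ← h, ← Matrix.conjTranspose_nonsing_inv]
  simp only [sum_inner, inner_sum, inner_smul_left, inner_smul_right, Matrix.mul_apply,
    Matrix.conjTranspose_apply, Matrix.of_apply, Finset.sum_mul]
  simp only [Finset.mul_sum]
  rw [Finset.sum_comm]
  refine Finset.sum_congr rfl fun b _ => Finset.sum_congr rfl fun a _ => ?_
  rw [Complex.star_def]; ring

end Stationary

/-! ### Laurent polynomials on the bicircle -/

/-- The character `z^a w^b` of the bicircle. -/
noncomputable def character (s : ℤ × ℤ) : Circle × Circle → ℂ :=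
  fun x => (x.1 : ℂ) ^ s.1 * (x.2 : ℂ) ^ s.2

theorem character_add (s t : ℤ × ℤ) (x : Circle × Circle) :
    character (s + t) x = character s x * character t x := by
  simp only [character, Prod.fst_add, Prod.snd_add]
  rw [zpow_add₀ (Circle.coe_ne_zero _), zpow_add₀ (Circle.coe_ne_zero _)]
  ring

theorem norm_character (s : ℤ × ℤ) (x : Circle × Circle) : ‖character s x‖ = 1 := by
  simp [character, Circle.norm_coe]

theorem character_mul_conj (s : ℤ × ℤ) (x : Circle × Circle) :
    character s x * conj (character s x) = 1 := by
  rw [Complex.mul_conj', norm_character]; simp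

theorem conj_character (s : ℤ × ℤ) (x : Circle × Circle) :
    conj (character s x) = character (-s) x := by
  have h1 := character_mul_conj s x
  have h2 : character s x * character (-s) x = 1 := by
    rw [← character_add, add_neg_cancel]; simp [character]
  have h0 : character s x ≠ 0 := fun h => by rw [h, zero_mul] at h1; exact zero_ne_one h1
  exact mul_left_cancel₀ h0 (h1.trans h2.symm)

theorem continuous_character (s : ℤ × ℤ) : Continuous (character s) := by
  unfold character
  refine Continuous.mul ?_ ?_
  · exact (continuous_subtype_val.comp continuous_fst).zpow₀ _
      fun x => Or.inl (Circle.coe_ne_zero _)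
  · exact (continuous_subtype_val.comp continuous_snd).zpow₀ _
      fun x => Or.inl (Circle.coe_ne_zero _)

/-- The function on the bicircle with the given Fourier coefficients. -/
noncomputable def trigPoly : (ℤ × ℤ →₀ ℂ) →ₗ[ℂ] (Circle × Circle → ℂ) :=
  Finsupp.linearCombination ℂ character

theorem trigPoly_single (s : ℤ × ℤ) (c : ℂ) (x : Circle × Circle) :
    trigPoly (Finsupp.single s c) x = c * character s x := by
  simp [trigPoly]

theorem continuous_trigPoly (f : ℤ × ℤ →₀ ℂ) : Continuous (trigPoly f) := by
  induction f using Finsupp.induction_linear with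
  | zero => rw [map_zero]; exact continuous_const
  | add f g hf hg => rw [map_add]; exact hf.add hg
  | single s c =>
    have : trigPoly (Finsupp.single s c) = fun x => c * character s x :=
      funext (trigPoly_single s c)
    rw [this]; exact continuous_const.mul (continuous_character s)

theorem integrable_of_continuous {μ : Measure (Circle × Circle)} [IsFiniteMeasure μ]
    {f : Circle × Circle → ℂ} (hf : Continuous f) : Integrable f μ := by
  rw [← integrableOn_univ]
  exact hf.continuousOn.integrableOn_compact isCompact_univ

theorem continuous_mul_conj {f g : Circle × Circle → ℂ} (hf : Continuous f) (hg : Continuous g) :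
    Continuous fun x => f x * conj (g x) :=
  hf.mul (Complex.continuous_conj.comp hg)

theorem pairing_add_left {μ : Measure (Circle × Circle)} [IsFiniteMeasure μ]
    {f f' g : Circle × Circle → ℂ} (hf : Continuous f) (hf' : Continuous f') (hg : Continuous g) :
    pairing μ (f + f') g = pairing μ f g + pairing μ f' g := by
  simp only [pairing, functional, Pi.add_apply, add_mul]
  rw [integral_add (integrable_of_continuous (continuous_mul_conj hf hg))
    (integrable_of_continuous (continuous_mul_conj hf' hg)), mul_add]

theorem pairing_smul_left (μ : Measure (Circle × Circle)) (c : ℂ) (f g : Circle × Circle → ℂ) :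
    pairing μ (c • f) g = c * pairing μ f g := by
  simp only [pairing, functional, Pi.smul_apply, smul_eq_mul, mul_assoc]
  rw [integral_const_mul]; ring

theorem conj_pairing (μ : Measure (Circle × Circle)) (f g : Circle × Circle → ℂ) :
    conj (pairing μ f g) = pairing μ g f := by
  simp only [pairing, functional, map_mul, ← integral_conj]
  simp [mul_comm, Complex.conj_ofNat]

theorem pairing_self (μ : Measure (Circle × Circle)) (f : Circle × Circle → ℂ) :
    pairing μ f f = ((1 / (2 * Real.pi)) ^ 2 * ∫ x, ‖f x‖ ^ 2 ∂μ : ℝ) := by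
  simp only [pairing, functional, Complex.mul_conj']
  push_cast
  rw [← integral_complex_ofReal]
  push_cast
  rfl

/-- The Laurent polynomial with the coefficients of a polynomial. -/
noncomputable def laurent : MvPolynomial (Fin 2) ℂ →ₗ[ℂ] (ℤ × ℤ →₀ ℂ) :=
  (MvPolynomial.basisMonomials (Fin 2) ℂ).constr ℂ
    fun d => Finsupp.single ((d 0 : ℤ), (d 1 : ℤ)) 1

theorem laurent_monomial (d : Fin 2 →₀ ℕ) (c : ℂ) :
    laurent (MvPolynomial.monomial d c) = Finsupp.single ((d 0 : ℤ), (d 1 : ℤ)) c := by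
  have h : MvPolynomial.monomial d c = c • MvPolynomial.basisMonomials (Fin 2) ℂ d := by
    simp [MvPolynomial.smul_monomial]
  rw [h, map_smul, laurent, Module.Basis.constr_basis]
  simp

theorem eq_expo (d : Fin 2 →₀ ℕ) : d = expo (d 0) (d 1) := by
  ext a; fin_cases a <;> simp [expo]

theorem laurent_apply (p : MvPolynomial (Fin 2) ℂ) (i j : ℕ) :
    laurent p ((i : ℤ), (j : ℤ)) = cf p i j := by
  induction p using MvPolynomial.induction_on' with
  | monomial d c =>
    rw [laurent_monomial, cf, MvPolynomial.coeff_monomial, Finsupp.single_apply]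
    have : ((d 0 : ℤ), (d 1 : ℤ)) = ((i : ℤ), (j : ℤ)) ↔ d = expo i j := by
      constructor
      · intro h
        simp only [Prod.mk.injEq, Nat.cast_inj] at h
        rw [eq_expo d, h.1, h.2]
      · rintro rfl; simp [expo]
    simp only [this]
  | add p q hp hq => rw [map_add, Finsupp.add_apply, hp, hq]; simp [cf]

theorem laurent_apply_of_neg (p : MvPolynomial (Fin 2) ℂ) {s : ℤ × ℤ} (hs : s.1 < 0 ∨ s.2 < 0) :
    laurent p s = 0 := by
  induction p using MvPolynomial.induction_on' with
  | monomial d c =>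
    rw [laurent_monomial, Finsupp.single_apply, if_neg]
    rintro rfl; simp only at hs; omega
  | add p q hp hq => rw [map_add, Finsupp.add_apply, hp, hq, add_zero]

theorem trigPoly_laurent (p : MvPolynomial (Fin 2) ℂ) : trigPoly (laurent p) = onTorus p := by
  funext x
  induction p using MvPolynomial.induction_on' with
  | monomial d c =>
    have h : MvPolynomial.monomial d c = c • MvPolynomial.monomial (expo (d 0) (d 1)) (1 : ℂ) := by
      rw [← eq_expo, MvPolynomial.smul_monomial, smul_eq_mul, mul_one]
    have h2 := congrFun (onTorus_monomial (d 0) (d 1)) x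
    rw [laurent_monomial, trigPoly_single, h]
    simp only [onTorus, val, MvPolynomial.smul_eval] at h2 ⊢
    rw [h2]
    simp [mono, character]
  | add p q hp hq =>
    rw [map_add, map_add, Pi.add_apply, hp, hq]; simp [onTorus, val]

theorem exists_laurent_eq {f : ℤ × ℤ →₀ ℂ} (hf : ∀ s, s.1 < 0 ∨ s.2 < 0 → f s = 0) :
    ∃ p, laurent p = f := by
  refine ⟨∑ s ∈ f.support, MvPolynomial.monomial (expo s.1.toNat s.2.toNat) (f s), ?_⟩
  rw [map_sum]
  conv_rhs => rw [← Finsupp.sum_single f]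
  rw [Finsupp.sum]
  refine Finset.sum_congr rfl fun s hs => ?_
  have h0 : ¬(s.1 < 0 ∨ s.2 < 0) := fun h => Finsupp.mem_support_iff.1 hs (hf s h)
  rw [laurent_monomial]
  congr 1
  ext <;> simp [expo] <;> omega

theorem laurent_injective : Function.Injective laurent := fun p q h =>
  ext_cf fun i j => by rw [← laurent_apply, h, laurent_apply]

theorem trigPoly_mapDomain (f : ℤ × ℤ →₀ ℂ) (s : ℤ × ℤ) (x : Circle × Circle) :
    trigPoly (f.mapDomain (· + s)) x = character s x * trigPoly f x := by
  induction f using Finsupp.induction_linear with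
  | zero => simp
  | add f g hf hg => rw [Finsupp.mapDomain_add, map_add, Pi.add_apply, hf, hg, map_add]; simp [mul_add]
  | single t c => rw [Finsupp.mapDomain_single, trigPoly_single, trigPoly_single, character_add]; ring

/-- A Laurent polynomial is a monomial times a polynomial. -/
theorem exists_norm_trigPoly_eq {f : ℤ × ℤ →₀ ℂ} (hf : f ≠ 0) :
    ∃ p : MvPolynomial (Fin 2) ℂ, p ≠ 0 ∧ ∀ x, ‖trigPoly f x‖ = ‖onTorus p x‖ := by
  obtain ⟨N, hN⟩ : ∃ N : ℕ, ∀ s ∈ f.support, -(N : ℤ) ≤ s.1 ∧ -(N : ℤ) ≤ s.2 := by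
    refine ⟨∑ s ∈ f.support, (s.1.natAbs + s.2.natAbs), fun s hs => ?_⟩
    have := Finset.single_le_sum (f := fun s : ℤ × ℤ => s.1.natAbs + s.2.natAbs)
      (fun _ _ => Nat.zero_le _) hs
    omega
  obtain ⟨p, hp⟩ := exists_laurent_eq (f := f.mapDomain (· + ((N : ℤ), (N : ℤ)))) (fun s hs => by
    have h : s = (s - ((N : ℤ), (N : ℤ))) + ((N : ℤ), (N : ℤ)) := by abel
    rw [h, Finsupp.mapDomain_apply (add_left_injective _)]
    by_contra hne
    have := hN _ (Finsupp.mem_support_iff.2 hne)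
    simp only [Prod.fst_sub, Prod.snd_sub] at this
    omega)
  refine ⟨p, ?_, fun x => ?_⟩
  · rintro rfl
    rw [map_zero] at hp
    refine hf (Finsupp.mapDomain_injective (add_left_injective ((N : ℤ), (N : ℤ))) ?_)
    rw [Finsupp.mapDomain_zero]; exact hp.symm
  · rw [← trigPoly_laurent, hp, trigPoly_mapDomain, norm_mul, norm_character, one_mul]

/-! ### The inner product defined by a positive definite measure -/

section InnerProduct

set_option linter.unusedSectionVars false

variable (μ : Measure (Circle × Circle)) [IsFiniteMeasure μ] (hμ : IsPosDef μ)

/-- The Laurent polynomials with the inner product defined by `μ`. -/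
def LaurentSpace (_hμ : IsPosDef μ) : Type := ℤ × ℤ →₀ ℂ

noncomputable instance : AddCommGroup (LaurentSpace μ hμ) :=
  inferInstanceAs (AddCommGroup (ℤ × ℤ →₀ ℂ))

noncomputable instance : Module ℂ (LaurentSpace μ hμ) :=
  inferInstanceAs (Module ℂ (ℤ × ℤ →₀ ℂ))

/-- The function on the bicircle defined by an element of `LaurentSpace μ hμ`. -/
noncomputable def toFun : LaurentSpace μ hμ →ₗ[ℂ] (Circle × Circle → ℂ) := trigPoly

theorem continuous_toFun (f : LaurentSpace μ hμ) : Continuous (toFun μ hμ f) :=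
  continuous_trigPoly f

theorem pairing_self_pos {f : LaurentSpace μ hμ} (hf : f ≠ 0) :
    0 < (pairing μ (toFun μ hμ f) (toFun μ hμ f)).re := by
  obtain ⟨p, hp, h⟩ := exists_norm_trigPoly_eq (f := f) hf
  have h1 := hμ p hp
  rw [pairing_self] at h1 ⊢
  simp only [← h] at h1
  exact h1

/-- The inner product `⟨f, g⟩ = 𝓛(f̄ g)`. -/
@[reducible]
noncomputable def innerCore : InnerProductSpace.Core ℂ (LaurentSpace μ hμ) where
  inner f g := pairing μ (toFun μ hμ g) (toFun μ hμ f)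
  conj_inner_symm f g := conj_pairing μ _ _
  re_inner_nonneg f := by
    change 0 ≤ (pairing μ (toFun μ hμ f) (toFun μ hμ f)).re
    by_cases hf : f = 0
    · rw [hf, map_zero, pairing_self]; simp
    · exact (pairing_self_pos μ hμ hf).le
  add_left f g h := by
    rw [map_add, ← conj_pairing, pairing_add_left (continuous_toFun μ hμ f)
      (continuous_toFun μ hμ g) (continuous_toFun μ hμ h), map_add, conj_pairing, conj_pairing]
  smul_left f g c := by
    rw [map_smul, ← conj_pairing, pairing_smul_left, map_mul, conj_pairing]
  definite f h := by
    by_contra hf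
    have := pairing_self_pos μ hμ hf
    rw [h] at this
    exact lt_irrefl _ this

noncomputable instance : NormedAddCommGroup (LaurentSpace μ hμ) :=
  (innerCore μ hμ).toNormedAddCommGroup

noncomputable instance : InnerProductSpace ℂ (LaurentSpace μ hμ) :=
  InnerProductSpace.ofCore (innerCore μ hμ).toCore

theorem inner_def (f g : LaurentSpace μ hμ) :
    inner ℂ f g = pairing μ (toFun μ hμ g) (toFun μ hμ f) := rfl

/-- The monomials as a basis of `LaurentSpace μ hμ`. -/
noncomputable def monomialBasis : Module.Basis (ℤ × ℤ) ℂ (LaurentSpace μ hμ) :=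
  Module.Basis.ofRepr (LinearEquiv.refl ℂ (ℤ × ℤ →₀ ℂ))

theorem toFun_monomialBasis (s : ℤ × ℤ) : toFun μ hμ (monomialBasis μ hμ s) = character s := by
  funext x
  have := trigPoly_single s 1 x
  rw [one_mul] at this
  exact this

theorem isStationary_monomialBasis : IsStationary (monomialBasis μ hμ) := by
  intro s a b
  rw [inner_def, inner_def]
  simp only [toFun_monomialBasis, pairing, character_add, map_mul]
  congr 1; funext x
  linear_combination (character b x * conj (character a x)) * character_mul_conj s x

theorem toFun_sh (s : ℤ × ℤ) (f : LaurentSpace μ hμ) (x : Circle × Circle) :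
    toFun μ hμ (sh (monomialBasis μ hμ) s f) x = character s x * toFun μ hμ f x := by
  induction f using induction_basis (e := monomialBasis μ hμ) with
  | h0 => simp
  | hadd f g hf hg => rw [map_add, map_add, Pi.add_apply, hf, hg, map_add, Pi.add_apply, mul_add]
  | hs c a =>
    rw [map_smul, sh_basis, map_smul, map_smul, toFun_monomialBasis, toFun_monomialBasis]
    simp only [Pi.smul_apply, smul_eq_mul, character_add]; ring

/-- A polynomial as an element of `LaurentSpace μ hμ`. -/
noncomputable def emb : MvPolynomial (Fin 2) ℂ →ₗ[ℂ] LaurentSpace μ hμ := laurent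

theorem toFun_emb (p : MvPolynomial (Fin 2) ℂ) : toFun μ hμ (emb μ hμ p) = onTorus p :=
  trigPoly_laurent p

theorem repr_emb (p : MvPolynomial (Fin 2) ℂ) (i j : ℕ) :
    (monomialBasis μ hμ).repr (emb μ hμ p) ((i : ℤ), (j : ℤ)) = cf p i j :=
  laurent_apply p i j

theorem repr_emb_of_neg (p : MvPolynomial (Fin 2) ℂ) {s : ℤ × ℤ} (hs : s.1 < 0 ∨ s.2 < 0) :
    (monomialBasis μ hμ).repr (emb μ hμ p) s = 0 :=
  laurent_apply_of_neg p hs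

theorem inner_emb (p q : MvPolynomial (Fin 2) ℂ) :
    inner ℂ (emb μ hμ p) (emb μ hμ q) = pairing μ (onTorus q) (onTorus p) := by
  rw [inner_def, toFun_emb, toFun_emb]

theorem emb_monomial (i j : ℕ) (c : ℂ) : emb μ hμ (MvPolynomial.monomial (expo i j) c) =
    c • monomialBasis μ hμ ((i : ℤ), (j : ℤ)) := by
  have h1 := laurent_monomial (expo i j) c
  have h2 : (expo i j) 0 = i ∧ (expo i j) 1 = j := by simp [expo]
  rw [h2.1, h2.2] at h1
  refine h1.trans ?_
  have : monomialBasis μ hμ ((i : ℤ), (j : ℤ)) = Finsupp.single ((i : ℤ), (j : ℤ)) (1 : ℂ) := rfl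
  rw [this]
  exact (Finsupp.smul_single_one _ c).symm

theorem evalAt_emb (p : MvPolynomial (Fin 2) ℂ) (z w : ℂ) :
    evalAt (monomialBasis μ hμ) z w (emb μ hμ p) = val p z w := by
  induction p using MvPolynomial.induction_on' with
  | monomial d c =>
    rw [eq_expo d, emb_monomial, map_smul, evalAt_basis, val, MvPolynomial.eval_monomial, expo,
      Finsupp.prod_add_index' (by simp) (by intros; simp [pow_add])]
    simp
  | add p q hp hq => rw [map_add, map_add, hp, hq]; simp [val]

theorem emb_mem_sp {S : Set (ℤ × ℤ)} {p : MvPolynomial (Fin 2) ℂ}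
    (h : ∀ i j : ℕ, ((i : ℤ), (j : ℤ)) ∉ S → cf p i j = 0) :
    emb μ hμ p ∈ sp (monomialBasis μ hμ) S := by
  rw [mem_sp]
  rintro ⟨a, b⟩ hs
  by_cases hneg : a < 0 ∨ b < 0
  · exact repr_emb_of_neg μ hμ p hneg
  · obtain ⟨i, rfl⟩ := Int.eq_ofNat_of_zero_le (a := a) (by omega)
    obtain ⟨j, rfl⟩ := Int.eq_ofNat_of_zero_le (a := b) (by omega)
    rw [repr_emb]; exact h i j hs

theorem emb_reverse {n m : ℕ} {p : MvPolynomial (Fin 2) ℂ}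
    (h : emb μ hμ p ∈ sp (monomialBasis μ hμ) (box n m)) :
    emb μ hμ (reverse n m p) = rev (monomialBasis μ hμ) ((n : ℤ), (m : ℤ)) (emb μ hμ p) := by
  have hF : box (n : ℤ) m ⊆ (((Finset.range (n + 1) ×ˢ Finset.range (m + 1)).map
      (Nat.castEmbedding.prodMap Nat.castEmbedding) : Finset (ℤ × ℤ)) : Set (ℤ × ℤ)) := by
    rintro ⟨a, b⟩ hs
    simp only [mem_box] at hs
    simp only [Finset.coe_map, Finset.coe_product, Set.mem_image, Set.mem_prod, Finset.mem_coe,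
      Finset.mem_range]
    exact ⟨(a.toNat, b.toNat), by simp only; omega, by
      ext <;> simp [Function.Embedding.prodMap] <;> omega⟩
  conv_rhs => rw [eq_sum_of_mem_sp hF h]
  have hrs : ∀ (F : Finset (ℤ × ℤ)) (c : ℤ × ℤ → ℂ) (N : ℤ × ℤ),
      rev (monomialBasis μ hμ) N (∑ s ∈ F, c s • monomialBasis μ hμ s) =
        ∑ s ∈ F, conj (c s) • monomialBasis μ hμ (N - s) := by
    intro F c N
    induction F using Finset.induction_on with
    | empty => simp [rev_zero]
    | insert a F ha ih => rw [Finset.sum_insert ha, Finset.sum_insert ha, rev_add, rev_smul,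
        rev_basis, ih]
  rw [hrs, Finset.sum_map, Finset.sum_product, reverse, map_sum]
  refine Finset.sum_congr rfl fun i hi => ?_
  rw [map_sum]
  refine Finset.sum_congr rfl fun j hj => ?_
  simp only [Finset.mem_range] at hi hj
  rw [emb_monomial, Nat.cast_sub (by omega), Nat.cast_sub (by omega)]
  have hij : (Nat.castEmbedding.prodMap Nat.castEmbedding : ℕ × ℕ ↪ ℤ × ℤ) (i, j) =
    ((i : ℤ), (j : ℤ)) := rfl
  rw [hij, repr_emb]
  rfl

theorem mem_perp_of_pairing {S : Set (ℤ × ℤ)} {p : MvPolynomial (Fin 2) ℂ}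
    (h0 : ∀ s ∈ S, 0 ≤ s.1 ∧ 0 ≤ s.2)
    (h : ∀ i j : ℕ, ((i : ℤ), (j : ℤ)) ∈ S → pairing μ (onTorus p) (mono i j) = 0) :
    emb μ hμ p ∈ perp (monomialBasis μ hμ) S := by
  rw [mem_perp]
  rintro ⟨a, b⟩ hs
  obtain ⟨i, rfl⟩ := Int.eq_ofNat_of_zero_le (h0 _ hs).1
  obtain ⟨j, rfl⟩ := Int.eq_ofNat_of_zero_le (h0 _ hs).2
  have : character ((i : ℤ), (j : ℤ)) = mono i j := by
    funext x; simp [character, mono]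
  rw [inner_def, toFun_emb, toFun_monomialBasis, this]
  exact h i j hs

end InnerProduct

/-! ### The recurrence coefficients in terms of the inner product -/

theorem orthonormalStep_spec (μ : Measure (Circle × Circle)) [IsFiniteMeasure μ]
    (hμ : IsPosDef μ) {S : Finset (ℕ × ℕ)} {d : ℕ × ℕ} (hd : d ∉ S) :
    IsOrthonormalStep μ S d (orthonormalStep μ S d) := by
  have h := (existsUnique_isOrthonormalStep μ hμ S d hd).exists
  rw [orthonormalStep, dif_pos h]
  exact h.choose_spec

theorem u_negSucc (μ : Measure (Circle × Circle)) (i j : ℕ) : u μ (Int.negSucc i) (j + 1) =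
    if i = 0 ∧ j = 0 then K μ (i + 1) (j + 1) (Fin.last j) (Fin.last i)
      else ((leadCoeff μ (i + 1) j)⁻¹ * K μ (i + 1) (j + 1) *
        ((leadCoeffTilde μ i (j + 1)).conjTranspose)⁻¹) (Fin.last j) (Fin.last i) := rfl

/-- The conditions on the recurrence coefficients in the characterization of Bernstein–Szegő
measures. -/
def CoefficientConditions (μ : Measure (Circle × Circle)) (n m : ℕ) : Prop :=
  (∀ j, m ≤ j → K μ n j = 0 ∧ (0 < n → EhatTilde μ (n - 1) (j + 1) = 0) ∧
    u μ n (j + 1) = 0) ∧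
  (∀ i, n < i → K μ i m = 0 ∧ (0 < m → Ehat μ i (m - 1) = 0) ∧ u μ i m = 0) ∧
  (∀ (i : ℤ) (j : ℕ), (n : ℤ) < |i| → m < j → u μ i j = 0)

section Translation

theorem phi_spec (μ : Measure (Circle × Circle)) [IsFiniteMeasure μ] (hμ : IsPosDef μ)
    (i j l : ℕ) : IsOrthonormalStep μ (lexBelow i j l) (i, l) (phi μ i j l) :=
  orthonormalStep_spec μ hμ (by simp [lexBelow])

theorem phiTilde_spec (μ : Measure (Circle × Circle)) [IsFiniteMeasure μ] (hμ : IsPosDef μ)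
    (i j l : ℕ) : IsOrthonormalStep μ (revlexBelow i j l) (l, j) (phiTilde μ i j l) :=
  orthonormalStep_spec μ hμ (by simp [revlexBelow])

variable (μ : Measure (Circle × Circle)) [IsFiniteMeasure μ] (hμ : IsPosDef μ)

theorem isLexFamily_phi (i j : ℕ) :
    IsLexFamily (monomialBasis μ hμ) i j fun l => emb μ hμ (phi μ i j l) where
  mem l hl := emb_mem_sp μ hμ fun a b hab => by
    refine (phi_spec μ hμ i j l).1 a b (fun h => hab ?_) (fun h => hab ?_)
    · simp only [lexBelow, Finset.mem_filter, Finset.mem_product, Finset.mem_range, mem_box,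
        Set.mem_ofPred_eq] at *
      omega
    · simp only [Prod.mk.injEq, mem_box, Set.mem_ofPred_eq] at *
      omega
  mem_perp l hl := mem_perp_of_pairing μ hμ (fun s hs => ⟨hs.1.1, hs.1.2.2.1⟩) fun a b hab => by
    refine (phi_spec μ hμ i j l).2.2.1 (a, b) ?_
    simp only [lexBelow, Finset.mem_filter, Finset.mem_product, Finset.mem_range, mem_box,
      Set.mem_ofPred_eq] at *
    omega
  repr_ne l hl := by
    obtain ⟨k, hk, hk'⟩ := (phi_spec μ hμ i j l).2.1
    rw [repr_emb, hk']
    exact_mod_cast hk.ne'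

theorem isLexFamily_phiTilde (i j : ℕ) :
    IsLexFamily (swapped (monomialBasis μ hμ)) j i fun l => emb μ hμ (phiTilde μ i j l) where
  mem l hl := by
    rw [sp_swapped]
    refine emb_mem_sp μ hμ fun a b hab => ?_
    refine (phiTilde_spec μ hμ i j l).1 a b (fun h => hab ?_) (fun h => hab ?_)
    · simp only [revlexBelow, Finset.mem_filter, Finset.mem_product, Finset.mem_range, mem_box,
        Set.mem_preimage, Prod.swap_prod_mk, Set.mem_ofPred_eq] at *
      omega
    · simp only [Prod.mk.injEq, mem_box, Set.mem_preimage, Prod.swap_prod_mk,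
        Set.mem_ofPred_eq] at *
      omega
  mem_perp l hl := by
    rw [perp_swapped]
    refine mem_perp_of_pairing μ hμ (fun s hs => ⟨hs.1.2.2.1, hs.1.1⟩) fun a b hab => ?_
    refine (phiTilde_spec μ hμ i j l).2.2.1 (a, b) ?_
    simp only [revlexBelow, Finset.mem_filter, Finset.mem_product, Finset.mem_range, mem_box,
      Set.mem_preimage, Prod.swap_prod_mk, Set.mem_ofPred_eq] at *
    omega
  repr_ne l hl := by
    obtain ⟨k, hk, hk'⟩ := (phiTilde_spec μ hμ i j l).2.1
    rw [repr_swapped]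
    change (monomialBasis μ hμ).repr _ ((l : ℤ), (j : ℤ)) ≠ 0
    rw [repr_emb, hk']
    exact_mod_cast hk.ne'

theorem K_eq (i j : ℕ) : K μ (i + 1) (j + 1) = Matrix.of fun a b : Fin _ =>
    inner ℂ (emb μ hμ (phiTilde μ i (j + 1) (i - b))) (emb μ hμ (phi μ (i + 1) j (j - a))) := by
  ext a b
  simp only [Matrix.of_apply, inner_emb, K, Nat.add_sub_cancel]

theorem K_eq_zero_iff (i j : ℕ) : K μ i j = 0 ↔ Decoupled (monomialBasis μ hμ) i j := by
  rcases i with _ | i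
  · exact ⟨fun _ => decoupled_of_nonpos (Or.inl le_rfl), fun _ => by ext a b; exact b.elim0⟩
  rcases j with _ | j
  · exact ⟨fun _ => decoupled_of_nonpos (Or.inr le_rfl), fun _ => by ext a b; exact a.elim0⟩
  rw [decoupled_iff (isLexFamily_phi μ hμ (i + 1) j) (isLexFamily_phiTilde μ hμ i (j + 1)),
    K_eq μ hμ]
  constructor
  · intro h k hk l hl
    have := congrFun (congrFun h ⟨j - l, by omega⟩) ⟨i - k, by omega⟩
    simp only [Matrix.of_apply, Matrix.zero_apply] at this
    rwa [show j - (j - l) = l by omega, show i - (i - k) = k by omega] at this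
  · intro h
    ext a b
    exact h _ (by omega) _ (by omega)

theorem pairing_shift_reverse {n m : ℕ} {p q : MvPolynomial (Fin 2) ℂ} (s : ℤ × ℤ)
    (hq : emb μ hμ q ∈ sp (monomialBasis μ hμ) (box n m)) :
    pairing μ (fun x => character s x * onTorus p x) (onTorus (reverse n m q)) =
      inner ℂ (rev (monomialBasis μ hμ) ((n : ℤ), (m : ℤ)) (emb μ hμ q))
        (sh (monomialBasis μ hμ) s (emb μ hμ p)) := by
  rw [← emb_reverse μ hμ hq, inner_def, toFun_emb]
  congr 1
  funext x
  rw [toFun_sh, toFun_emb]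

theorem character_fst (x : Circle × Circle) : character (1, 0) x = x.1 := by simp [character]

theorem character_snd (x : Circle × Circle) : character (0, 1) x = x.2 := by simp [character]

theorem emb_phi_mem (i j l : ℕ) (hl : l ≤ j) :
    emb μ hμ (phi μ i j l) ∈ sp (monomialBasis μ hμ) (box i j) :=
  ((isLexFamily_phi μ hμ i j).mem_lexSpace hl).1

theorem emb_phiTilde_mem (i j l : ℕ) (hl : l ≤ i) :
    emb μ hμ (phiTilde μ i j l) ∈ sp (monomialBasis μ hμ) (box i j) := by
  have := ((isLexFamily_phiTilde μ hμ i j).mem_lexSpace hl).1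
  rwa [sp_swapped, swap_box] at this

theorem Ehat_eq (i j : ℕ) : Ehat μ (i + 1) j = Matrix.of fun a b : Fin _ =>
    inner ℂ (rev (monomialBasis μ hμ) ((i : ℤ), (j : ℤ)) (emb μ hμ (phi μ i j (j - b))))
      (sh (monomialBasis μ hμ) (1, 0) (emb μ hμ (phi μ i j (j - a)))) := by
  ext a b
  rw [Matrix.of_apply, ← pairing_shift_reverse μ hμ _ (emb_phi_mem μ hμ _ _ _ (Nat.sub_le _ _))]
  simp only [Ehat, Matrix.of_apply, character_fst, Nat.add_sub_cancel]

theorem EhatTilde_eq (i j : ℕ) : EhatTilde μ i (j + 1) = Matrix.of fun a b : Fin _ =>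
    inner ℂ (rev (monomialBasis μ hμ) ((i : ℤ), (j : ℤ)) (emb μ hμ (phiTilde μ i j (i - b))))
      (sh (monomialBasis μ hμ) (0, 1) (emb μ hμ (phiTilde μ i j (i - a)))) := by
  ext a b
  rw [Matrix.of_apply,
    ← pairing_shift_reverse μ hμ _ (emb_phiTilde_mem μ hμ _ _ _ (Nat.sub_le _ _))]
  simp only [EhatTilde, Matrix.of_apply, character_snd, Nat.add_sub_cancel]

theorem Ehat_eq_zero_iff (i j : ℕ) :
    Ehat μ (i + 1) j = 0 ↔ ShiftsLex (monomialBasis μ hμ) i j := by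
  rw [(isLexFamily_phi μ hμ i j).shiftsLex_iff (isStationary_monomialBasis μ hμ), Ehat_eq μ hμ]
  constructor
  · intro h k hk l hl
    have := congrFun (congrFun h ⟨j - l, by omega⟩) ⟨j - k, by omega⟩
    simp only [Matrix.of_apply, Matrix.zero_apply] at this
    rwa [show j - (j - l) = l by omega, show j - (j - k) = k by omega] at this
  · intro h
    ext a b
    exact h _ (by omega) _ (by omega)

theorem EhatTilde_eq_zero_iff (i j : ℕ) :
    EhatTilde μ i (j + 1) = 0 ↔ ShiftsRevlex (monomialBasis μ hμ) i j := by
  rw [shiftsRevlex_iff (isStationary_monomialBasis μ hμ) (isLexFamily_phiTilde μ hμ i j),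
    EhatTilde_eq μ hμ]
  constructor
  · intro h k hk l hl
    have := congrFun (congrFun h ⟨i - l, by omega⟩) ⟨i - k, by omega⟩
    simp only [Matrix.of_apply, Matrix.zero_apply] at this
    rwa [show i - (i - l) = l by omega, show i - (i - k) = k by omega] at this
  · intro h
    ext a b
    exact h _ (by omega) _ (by omega)

/-- The (1, 1) entry of 𝒦¹ pairs the top members of the two families. They generate the leading
lines, so this one number carries the whole condition. -/
theorem u_pos_eq_zero_iff (i j : ℕ) : u μ ((i + 1 : ℕ) : ℤ) (j + 1) = 0 ↔
    LeadOrthogonal (monomialBasis μ hμ) (i + 1 : ℕ) (j + 1 : ℕ) := by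
  rw [leadOrthogonal_iff (isLexFamily_phi μ hμ (i + 1) j) (isLexFamily_phiTilde μ hμ i (j + 1)),
    ← pairing_shift_reverse μ hμ _ (emb_phiTilde_mem μ hμ _ _ _ le_rfl)]
  change conj (K1 μ (i + 1) (j + 1) 0 0) = 0 ↔ _
  rw [map_eq_zero]
  simp only [K1, Matrix.of_apply, character_snd, Nat.add_sub_cancel, Fin.val_zero, Nat.sub_zero]

theorem u_row_zero_eq_zero_iff (i : ℕ) : u μ ((i + 1 : ℕ) : ℤ) 0 = 0 ↔
    ShiftsLex (monomialBasis μ hμ) i 0 := by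
  have h := Ehat_eq_zero_iff μ hμ i 0
  rw [Nat.cast_zero] at h
  rw [← h]
  change Ehat μ (i + 1) 0 0 0 = 0 ↔ _
  constructor
  · intro h'
    ext a b
    rw [Fin.fin_one_eq_zero a, Fin.fin_one_eq_zero b]; exact h'
  · intro h'; rw [h']; rfl

theorem u_col_zero_eq_zero_iff (j : ℕ) : u μ ((0 : ℕ) : ℤ) (j + 1) = 0 ↔
    ShiftsRevlex (monomialBasis μ hμ) 0 j := by
  have h := EhatTilde_eq_zero_iff μ hμ 0 j
  rw [Nat.cast_zero] at h
  rw [← h]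
  change EhatTilde μ 0 (j + 1) 0 0 = 0 ↔ _
  constructor
  · intro h'
    ext a b
    rw [Fin.fin_one_eq_zero a, Fin.fin_one_eq_zero b]; exact h'
  · intro h'; rw [h']; rfl

theorem leadCoeff_eq (i j : ℕ) : leadCoeff μ i j =
    leadMatrix (monomialBasis μ hμ) i j fun l => emb μ hμ (phi μ i j l) := by
  ext a b
  simp only [leadCoeff, leadMatrix, Matrix.of_apply, repr_emb]

theorem leadCoeffTilde_eq (i j : ℕ) : leadCoeffTilde μ i j =
    leadMatrix (swapped (monomialBasis μ hμ)) j i fun l => emb μ hμ (phiTilde μ i j l) := by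
  ext a b
  simp only [leadCoeffTilde, leadMatrix, Matrix.of_apply, repr_swapped, Prod.swap, repr_emb]

theorem u_negSucc_eq_zero_of_decoupled {i j : ℕ}
    (h : Decoupled (monomialBasis μ hμ) (i + 1 : ℕ) (j + 1 : ℕ)) :
    u μ (Int.negSucc i) (j + 1) = 0 := by
  rw [u_negSucc, (K_eq_zero_iff μ hμ _ _).2 h]
  simp

theorem mixedOrthogonal_of_u_negSucc {i j : ℕ} (h : u μ (Int.negSucc i) (j + 1) = 0) :
    MixedOrthogonal (monomialBasis μ hμ) (i + 1 : ℕ) (j + 1 : ℕ) := by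
  rw [u_negSucc] at h
  split_ifs at h with hij
  -- The exceptional parameter u_{-1,1} is the only entry of 𝒦_{1,1}, so its vanishing is full
  -- decoupling.
  · obtain ⟨rfl, rfl⟩ := hij
    refine Decoupled.mixedOrthogonal (by simp) (by simp) ((K_eq_zero_iff μ hμ _ _).1 ?_)
    ext a b
    rw [Fin.fin_one_eq_zero a, Fin.fin_one_eq_zero b]; exact h
  · rw [K_eq μ hμ, leadCoeff_eq μ hμ, leadCoeffTilde_eq μ hμ] at h
    exact mixedOrthogonal_of_entry (isLexFamily_phi μ hμ (i + 1) j)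
      (isLexFamily_phiTilde μ hμ i (j + 1)) h

/-- The index of `Ehat` is one above the degree in z of the polynomials it shifts. Thus (b), stated
for indices above n, gives the shift conditions for all degrees ≥ n; likewise for u_{i,m}. For n = 0
or m = 0, u on the axis replaces the void conditions. -/
theorem CoefficientConditions.vanishingConditions {n m : ℕ} (h : CoefficientConditions μ n m) :
    VanishingConditions (monomialBasis μ hμ) n m := by
  obtain ⟨ha, hb, hc⟩ := h
  constructor
  · intro j hj
    obtain ⟨j, rfl⟩ := Int.eq_ofNat_of_zero_le (a := j) (by omega)
    exact (K_eq_zero_iff μ hμ n j).1 (ha j (by omega)).1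
  · intro i hi
    obtain ⟨i, rfl⟩ := Int.eq_ofNat_of_zero_le (a := i) (by omega)
    rcases (show n ≤ i by omega).eq_or_lt with rfl | hlt
    · exact (K_eq_zero_iff μ hμ _ _).1 (ha m le_rfl).1
    · exact (K_eq_zero_iff μ hμ _ _).1 (hb i hlt).1
  · intro j hj
    obtain ⟨j, rfl⟩ := Int.eq_ofNat_of_zero_le (a := j) (by omega)
    rcases n with _ | n
    · exact shiftsRevlex_of_neg (by simp)
    · have := (EhatTilde_eq_zero_iff μ hμ _ _).1 ((ha j (by omega)).2.1 (by omega))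
      simpa using this
  · intro i hi
    obtain ⟨i, rfl⟩ := Int.eq_ofNat_of_zero_le (a := i) (by omega)
    rcases m with _ | m
    · exact shiftsLex_of_neg (by simp)
    · have := (Ehat_eq_zero_iff μ hμ _ _).1 ((hb (i + 1) (by omega)).2.1 (by omega))
      simpa using this
  · intro hn j hj
    obtain ⟨j, rfl⟩ := Int.eq_ofNat_of_zero_le (a := j) (by omega)
    obtain ⟨n, rfl⟩ := Nat.exists_eq_add_of_le' (show 1 ≤ n by omega)
    exact (u_pos_eq_zero_iff μ hμ n j).1 (ha j (by omega)).2.2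
  · intro hm i hi
    obtain ⟨i, rfl⟩ := Int.eq_ofNat_of_zero_le (a := i) (by omega)
    obtain ⟨m, rfl⟩ := Nat.exists_eq_add_of_le' (show 1 ≤ m by omega)
    exact (u_pos_eq_zero_iff μ hμ i m).1 (hb (i + 1) (by omega)).2.2
  · intro hn j hj
    obtain ⟨j, rfl⟩ := Int.eq_ofNat_of_zero_le (a := j) (by omega)
    obtain rfl : n = 0 := by omega
    exact (u_col_zero_eq_zero_iff μ hμ j).1 (ha j (by omega)).2.2
  · intro hm i hi
    obtain ⟨i, rfl⟩ := Int.eq_ofNat_of_zero_le (a := i) (by omega)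
    obtain rfl : m = 0 := by omega
    exact (u_row_zero_eq_zero_iff μ hμ i).1 (hb (i + 1) (by omega)).2.2
  · intro i j hi hj
    obtain ⟨i, rfl⟩ := Int.eq_ofNat_of_zero_le (a := i) (by omega)
    obtain ⟨j, rfl⟩ := Int.eq_ofNat_of_zero_le (a := j) (by omega)
    obtain ⟨i, rfl⟩ := Nat.exists_eq_add_of_le' (show 1 ≤ i by omega)
    obtain ⟨j, rfl⟩ := Nat.exists_eq_add_of_le' (show 1 ≤ j by omega)
    exact (u_pos_eq_zero_iff μ hμ i j).1 (hc _ _ (by rw [abs_of_nonneg (by omega)]; omega)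
      (by omega))
  · intro i j hi hj
    obtain ⟨i, rfl⟩ := Int.eq_ofNat_of_zero_le (a := i) (by omega)
    obtain ⟨j, rfl⟩ := Int.eq_ofNat_of_zero_le (a := j) (by omega)
    obtain ⟨i, rfl⟩ := Nat.exists_eq_add_of_le' (show 1 ≤ i by omega)
    obtain ⟨j, rfl⟩ := Nat.exists_eq_add_of_le' (show 1 ≤ j by omega)
    refine mixedOrthogonal_of_u_negSucc μ hμ (hc _ _ ?_ (by omega))
    rw [Int.negSucc_eq, abs_neg, abs_of_nonneg (by omega)]
    push_cast at hi ⊢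
    omega

end Translation

/-! ### Recurrence coefficients of a Bernstein–Szegő family -/

namespace IsBernsteinSzego

variable {H : Type*} [NormedAddCommGroup H] [InnerProductSpace ℂ H]
  {e : Module.Basis (ℤ × ℤ) ℂ H} {n m : ℕ} {q : H}

theorem ne_zero (h : IsBernsteinSzego e n m q) : q ≠ 0 := by
  rintro rfl
  have := h.inner_sh_self 0
  simp at this

theorem rev_mem_leadSpace (he : IsStationary e) (h : IsBernsteinSzego e n m q) :
    rev e ((n : ℤ), (m : ℤ)) q ∈ leadSpace e n m := by
  refine ⟨h.rev_mem, perp_anti (fun s hs => ?_) (h.rev_mem_perp he)⟩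
  obtain ⟨⟨_, h1, _, h2⟩, h3⟩ := hs
  by_contra h'
  simp only [Set.mem_ofPred_eq, not_or, not_lt] at h'
  exact h3 (Prod.ext (le_antisymm h1 h'.1) (le_antisymm h2 h'.2))

theorem eq_smul_rev (he : IsStationary e) (h : IsBernsteinSzego e n m q) {p : H}
    (hp : p ∈ leadSpace e n m) : ∃ c : ℂ, p = c • rev e ((n : ℤ), (m : ℤ)) q := by
  refine eq_smul_of_mem_leadSpace (h.rev_mem_leadSpace he) (fun h0 => h.ne_zero ?_) hp
  rw [← rev_rev (e := e) ((n : ℤ), (m : ℤ)) q, h0, rev_zero]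

theorem mem_perp_of_mem_leadSpace (he : IsStationary e) (h : IsBernsteinSzego e n m q) {p : H}
    (hp : p ∈ leadSpace e n m) : p ∈ perp e {s | s.1 < n ∨ s.2 < m} := by
  obtain ⟨c, rfl⟩ := h.eq_smul_rev he hp
  exact Submodule.smul_mem _ _ (h.rev_mem_perp he)

/-- A leading polynomial is orthogonal to all columns below n, and multiplication by w preserves
this; the reversed polynomial of degree n - 1 in z lives in those columns. -/
theorem leadOrthogonal_right (he : IsStationary e) (h : IsBernsteinSzego e n m q) :
    LeadOrthogonal e n (m + 1 : ℕ) := by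
  intro p hp p' hp'
  rw [show ((m + 1 : ℕ) : ℤ) - 1 = m by push_cast; ring] at hp
  refine inner_eq_zero_of_perp (sh_mem_perp (T := {s | s.1 < (n : ℤ)}) he
    (h.mem_perp_of_mem_leadSpace he hp) fun s hs => Or.inl ?_)
    (rev_mem_sp hp'.1 fun s hs => ?_)
  · simpa using hs
  · rw [mem_box] at hs
    simp only [Set.mem_ofPred_eq, Prod.fst_sub]
    omega

/-- Here the reversed leading polynomial is a multiple of q, which is orthogonal to everything
divisible by w. -/
theorem leadOrthogonal_left (he : IsStationary e) (h : IsBernsteinSzego e n m q) :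
    LeadOrthogonal e (n + 1 : ℕ) m := by
  intro p hp p' hp'
  rw [show ((n + 1 : ℕ) : ℤ) - 1 = n by push_cast; ring] at *
  obtain ⟨c, rfl⟩ := h.eq_smul_rev he hp'
  rw [rev_smul, rev_rev, inner_smul_left]
  refine mul_eq_zero_of_right _ (inner_eq_zero_of_perp' h.mem_perp
    (sh_mem_sp hp.1 fun s hs => Or.inr ?_))
  rw [mem_box] at hs
  simp only [Prod.snd_add]
  omega

theorem shiftsRevlex_zero (he : IsStationary e) (h : IsBernsteinSzego e 0 m q) :
    ShiftsRevlex e 0 m := by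
  intro f hf
  have hf' : f ∈ leadSpace e (0 : ℕ) m := ⟨hf.1, perp_anti (fun s hs => by
    obtain ⟨a, b⟩ := s
    simp only [Set.mem_sdiff, Set.mem_singleton_iff, mem_box, Prod.mk.injEq] at *
    omega) hf.2⟩
  refine sh_mem_perp he (h.mem_perp_of_mem_leadSpace he hf') fun s hs => Or.inr ?_
  rw [mem_box] at hs
  simp only [Prod.snd_sub]
  omega

theorem shiftsLex_zero (he : IsStationary e) (h : IsBernsteinSzego e n 0 q) :
    ShiftsLex e n 0 := by
  intro f hf
  have hf' : f ∈ leadSpace e n (0 : ℕ) := ⟨hf.1, perp_anti (fun s hs => by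
    obtain ⟨a, b⟩ := s
    simp only [Set.mem_sdiff, Set.mem_singleton_iff, mem_box, Prod.mk.injEq] at *
    omega) hf.2⟩
  refine sh_mem_perp he (h.mem_perp_of_mem_leadSpace he hf') fun s hs => Or.inl ?_
  rw [mem_box] at hs
  simp only [Prod.fst_sub]
  omega

theorem shiftsLex (he : IsStationary e) (h : IsBernsteinSzego e n m q) :
    ShiftsLex e n ((m : ℤ) - 1) :=
  shiftsRevlex_swapped.1 (h.swapped.shiftsRevlex (he.swapped) le_rfl)

end IsBernsteinSzego

/-- Raising the degree bound with `mono` makes each coefficient a case of a statement at the bound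
or one step beyond it. -/
theorem IsBernsteinSzego.coefficientConditions (μ : Measure (Circle × Circle)) [IsFiniteMeasure μ]
    (hμ : IsPosDef μ) {n m : ℕ} {q : LaurentSpace μ hμ}
    (h : IsBernsteinSzego (monomialBasis μ hμ) n m q) : CoefficientConditions μ n m := by
  have he := isStationary_monomialBasis μ hμ
  have hd : ∀ i j, n ≤ i → m ≤ j → K μ i j = 0 := fun i j hi hj =>
    (K_eq_zero_iff μ hμ i j).2 ((h.mono hi hj).decoupled he le_rfl)
  refine ⟨fun j hj => ⟨hd _ _ le_rfl hj, fun hn => ?_, ?_⟩,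
    fun i hi => ⟨hd _ _ hi.le le_rfl, fun hm => ?_, ?_⟩, fun i j hi hj => ?_⟩
  · have := (h.mono le_rfl hj).shiftsRevlex he le_rfl
    rw [EhatTilde_eq_zero_iff μ hμ]
    rwa [show ((n - 1 : ℕ) : ℤ) = n - 1 by omega]
  · have h' := h.mono le_rfl hj
    rcases n with _ | n
    · exact (u_col_zero_eq_zero_iff μ hμ j).2 (h'.shiftsRevlex_zero he)
    · exact (u_pos_eq_zero_iff μ hμ n j).2 (h'.leadOrthogonal_right he)
  · obtain ⟨i, rfl⟩ := Nat.exists_eq_add_of_le' (show 1 ≤ i by omega)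
    have := (h.mono (show n ≤ i by omega) le_rfl).shiftsLex he
    rw [Ehat_eq_zero_iff μ hμ]
    rwa [show ((m - 1 : ℕ) : ℤ) = m - 1 by omega]
  · obtain ⟨i, rfl⟩ := Nat.exists_eq_add_of_le' (show 1 ≤ i by omega)
    have h' := h.mono (show n ≤ i by omega) le_rfl
    rcases m with _ | m
    · exact (u_row_zero_eq_zero_iff μ hμ i).2 (h'.shiftsLex_zero he)
    · exact (u_pos_eq_zero_iff μ hμ i m).2 (h'.leadOrthogonal_left he)
  · obtain ⟨j, rfl⟩ := Nat.exists_eq_add_of_le' (show 1 ≤ j by omega)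
    rcases i with i | i
    · obtain ⟨i, rfl⟩ := Nat.exists_eq_add_of_le' (show 1 ≤ i by simp at hi; omega)
      have hi' : n ≤ i := by
        rw [Int.ofNat_eq_natCast, abs_of_nonneg (by omega)] at hi
        omega
      exact (u_pos_eq_zero_iff μ hμ i j).2
        ((h.mono hi' (show m ≤ j + 1 by omega)).leadOrthogonal_left he)
    · have hi' : n ≤ i := by
        rw [Int.negSucc_eq, abs_neg, abs_of_nonneg (by omega)] at hi
        omega
      exact u_negSucc_eq_zero_of_decoupled μ hμ
        ((h.mono (show n ≤ i + 1 by omega) (show m ≤ j + 1 by omega)).decoupled he le_rfl)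

/-! ### Lebesgue measure on the bicircle -/

instance : IsFiniteMeasure arcLength := by
  rw [arcLength]
  infer_instance

instance : IsFiniteMeasure lebesgue := by
  rw [lebesgue]
  infer_instance

theorem integral_arcLength (f : ℂ → ℂ) (hf : Continuous fun z : Circle => f z) :
    ∫ z : Circle, f z ∂arcLength = ∫ θ in (0 : ℝ)..2 * Real.pi, f (circleMap 0 1 θ) := by
  rw [arcLength, integral_map Circle.exp.continuous.aemeasurable hf.aestronglyMeasurable]
  have hper : Function.Periodic (fun θ : ℝ => f (circleMap 0 1 θ)) (2 * Real.pi) :=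
    (periodic_circleMap 0 1).comp f
  have h := hper.intervalIntegral_add_eq (-Real.pi) 0
  rw [zero_add, show -Real.pi + 2 * Real.pi = Real.pi by ring] at h
  rw [← h, intervalIntegral.integral_of_le (by linarith [Real.pi_pos])]
  simp [circleMap, Circle.coe_exp]

/-- Cauchy's theorem on the unit circle. -/
theorem integral_arcLength_mul_eq_zero {g : ℂ → ℂ}
    (hg : ∀ z : ℂ, ‖z‖ ≤ 1 → DifferentiableAt ℂ g z) :
    ∫ z : Circle, (z : ℂ) * g z ∂arcLength = 0 := by
  have hc : Continuous fun z : Circle => (z : ℂ) * g z := by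
    refine continuous_subtype_val.mul (continuous_iff_continuousAt.2 fun z => ?_)
    exact (hg z (Circle.norm_coe z).le).continuousAt.comp
      (f := fun z : Circle => (z : ℂ)) continuous_subtype_val.continuousAt
  rw [integral_arcLength (fun z => z * g z) hc]
  have h : (∮ z in C(0, 1), g z) = 0 := by
    refine DiffContOnCl.circleIntegral_eq_zero zero_le_one
      (DifferentiableOn.diffContOnCl fun z hz => ?_)
    refine (hg z ?_).differentiableWithinAt
    have := Metric.closure_ball_subset_closedBall hz
    simpa using this
  rw [circleIntegral] at h
  simp only [deriv_circleMap, smul_eq_mul] at h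
  have h2 : ∀ θ : ℝ, circleMap 0 1 θ * Complex.I * g (circleMap 0 1 θ) =
      Complex.I * (circleMap 0 1 θ * g (circleMap 0 1 θ)) := fun θ => by ring
  simp only [h2, intervalIntegral.integral_const_mul] at h
  exact (mul_eq_zero.1 h).resolve_left Complex.I_ne_zero

theorem integral_zpow_arcLength {k : ℤ} (hk : k ≠ 0) :
    ∫ z : Circle, (z : ℂ) ^ k ∂arcLength = 0 := by
  have hpos : ∀ n : ℕ, ∫ z : Circle, (z : ℂ) ^ (n + 1) ∂arcLength = 0 := fun n => by
    simp only [pow_succ']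
    exact integral_arcLength_mul_eq_zero (g := fun z => z ^ n) fun z _ =>
      (differentiableAt_id).pow n
  obtain ⟨n, rfl | rfl⟩ := Int.eq_nat_or_neg k
  · obtain ⟨n, rfl⟩ := Nat.exists_eq_add_of_le' (show 1 ≤ n by omega)
    exact_mod_cast hpos n
  · obtain ⟨n, rfl⟩ := Nat.exists_eq_add_of_le' (show 1 ≤ n by omega)
    have h : ∀ z : Circle, (z : ℂ) ^ (-((n + 1 : ℕ) : ℤ)) = conj ((z : ℂ) ^ (n + 1)) := fun z => by
      rw [map_pow, ← Circle.coe_inv_eq_conj, zpow_neg, zpow_natCast, Circle.coe_inv, inv_pow]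
    simp only [h]
    rw [integral_conj, hpos, map_zero]

theorem integral_one_arcLength : ∫ _ : Circle, (1 : ℂ) ∂arcLength = 2 * Real.pi := by
  rw [integral_arcLength (fun _ => 1) continuous_const]
  simp

theorem integral_character (s : ℤ × ℤ) :
    ∫ x, character s x ∂lebesgue = if s = 0 then (2 * (Real.pi : ℂ)) ^ 2 else 0 := by
  simp only [character, lebesgue]
  rw [integral_prod_mul (fun z : Circle => (z : ℂ) ^ s.1) (fun z : Circle => (z : ℂ) ^ s.2)]
  obtain ⟨a, b⟩ := s
  split_ifs with h
  · simp only [Prod.mk_eq_zero] at h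
    obtain ⟨rfl, rfl⟩ := h
    simp only [zpow_zero, integral_one_arcLength]
    ring
  · simp only [Prod.mk_eq_zero, not_and_or] at h
    rcases h with h | h
    · rw [integral_zpow_arcLength h, zero_mul]
    · rw [integral_zpow_arcLength h, mul_zero]

theorem functional_lebesgue_character (s : ℤ × ℤ) :
    functional lebesgue (character s) = if s = 0 then 1 else 0 := by
  rw [functional, integral_character]
  split_ifs
  · rw [one_div, inv_pow, inv_mul_cancel₀]
    simp [Real.pi_ne_zero]
  · rw [mul_zero]

theorem pairing_lebesgue_character (f : ℤ × ℤ →₀ ℂ) (s : ℤ × ℤ) :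
    pairing lebesgue (trigPoly f) (character s) = f s := by
  induction f using Finsupp.induction_linear with
  | zero => simp [pairing, functional]
  | add f g hf hg =>
    rw [map_add, pairing_add_left (continuous_trigPoly f) (continuous_trigPoly g)
      (continuous_character s), hf, hg, Finsupp.add_apply]
  | single t c =>
    have h1 : trigPoly (Finsupp.single t c) = c • character t := funext (trigPoly_single t c)
    have h2 : pairing lebesgue (character t) (character s) =
        functional lebesgue (character (t - s)) := by
      simp only [pairing, conj_character, ← character_add, sub_eq_add_neg]
    rw [h1, pairing_smul_left, h2, functional_lebesgue_character, Finsupp.single_apply]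
    simp only [sub_eq_zero]
    split_ifs <;> simp

/-- A trigonometric polynomial vanishing almost everywhere is zero. -/
theorem eq_zero_of_trigPoly_ae_eq_zero {f : ℤ × ℤ →₀ ℂ} (h : trigPoly f =ᵐ[lebesgue] 0) :
    f = 0 := by
  ext s
  rw [← pairing_lebesgue_character f s, pairing, functional]
  have : ∫ x, trigPoly f x * conj (character s x) ∂lebesgue = 0 := by
    refine integral_eq_zero_of_ae ?_
    filter_upwards [h] with x hx
    rw [hx]; simp
  rw [this, mul_zero]; rfl

/-! ### Measures with a continuous density -/

theorem integral_withDensity_ofReal {μ : Measure (Circle × Circle)} {h : Circle × Circle → ℝ}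
    (hc : Continuous h) (h0 : ∀ x, 0 ≤ h x) (f : Circle × Circle → ℂ) :
    ∫ x, f x ∂μ.withDensity (fun x => ENNReal.ofReal (h x)) = ∫ x, (h x : ℂ) * f x ∂μ := by
  rw [integral_withDensity_eq_integral_toReal_smul hc.measurable.ennreal_ofReal
    (Eventually.of_forall fun _ => ENNReal.ofReal_lt_top)]
  congr 1; funext x
  rw [ENNReal.toReal_ofReal (h0 x), Complex.real_smul]

theorem isFiniteMeasure_withDensity_of_continuous {μ : Measure (Circle × Circle)} [IsFiniteMeasure μ]
    {h : Circle × Circle → ℝ} (hc : Continuous h) :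
    IsFiniteMeasure (μ.withDensity fun x => ENNReal.ofReal (h x)) := by
  obtain ⟨C, hC⟩ := isCompact_univ.exists_bound_of_continuousOn (hc.continuousOn (s := Set.univ))
  refine isFiniteMeasure_withDensity (ne_of_lt ?_)
  refine (lintegral_mono (g := fun _ => ENNReal.ofReal C) fun x =>
    ENNReal.ofReal_le_ofReal ((le_abs_self _).trans (hC x trivial))).trans_lt ?_
  rw [lintegral_const]
  exact ENNReal.mul_lt_top ENNReal.ofReal_lt_top (measure_lt_top _ _)

/-- If the integral of h|p|² vanishes then p = 0 almost everywhere, and its coefficients, being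
Fourier coefficients for Lebesgue measure, are zero. -/
theorem isPosDef_withDensity {h : Circle × Circle → ℝ} (hc : Continuous h) (h0 : ∀ x, 0 < h x) :
    IsPosDef (lebesgue.withDensity fun x => ENNReal.ofReal (h x)) := by
  intro p hp
  have := isFiniteMeasure_withDensity_of_continuous (μ := lebesgue) hc
  have hcp : Continuous fun x => ‖onTorus p x‖ ^ 2 := (continuous_onTorus p).norm.pow 2
  rw [pairing_self, Complex.ofReal_re]
  refine mul_pos (by have := Real.pi_pos; positivity) (lt_of_le_of_ne
    (integral_nonneg fun x => by positivity) fun hz => hp ?_)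
  rw [integral_withDensity_eq_integral_toReal_smul hc.measurable.ennreal_ofReal
    (Eventually.of_forall fun _ => ENNReal.ofReal_lt_top)] at hz
  have hi : Integrable (fun x => (ENNReal.ofReal (h x)).toReal • ‖onTorus p x‖ ^ 2) lebesgue := by
    have h1 : Continuous fun x => (ENNReal.ofReal (h x)).toReal • ‖onTorus p x‖ ^ 2 := by
      simp only [ENNReal.toReal_ofReal (h0 _).le]
      exact hc.smul hcp
    rw [← integrableOn_univ]
    exact h1.continuousOn.integrableOn_compact isCompact_univ
  rw [eq_comm, integral_eq_zero_iff_of_nonneg (fun x => by positivity) hi] at hz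
  refine laurent_injective ?_
  rw [map_zero]
  refine eq_zero_of_trigPoly_ae_eq_zero ?_
  rw [trigPoly_laurent]
  filter_upwards [hz] with x hx
  rw [ENNReal.toReal_ofReal (h0 x).le] at hx
  simpa [(h0 x).ne'] using hx

/-! ### Uniqueness of measures with given moments -/

/-- The characters of the bicircle as bounded continuous functions. -/
noncomputable def boundedCharacter (s : ℤ × ℤ) : BoundedContinuousFunction (Circle × Circle) ℂ :=
  BoundedContinuousFunction.mkOfCompact ⟨character s, continuous_character s⟩

theorem boundedCharacter_apply (s : ℤ × ℤ) (x : Circle × Circle) :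
    boundedCharacter s x = character s x := rfl

/-- The algebra of trigonometric polynomials. -/
noncomputable def trigAlgebra : StarSubalgebra ℂ (BoundedContinuousFunction (Circle × Circle) ℂ) where
  carrier := Submodule.span ℂ (Set.range boundedCharacter)
  add_mem' := add_mem
  zero_mem' := zero_mem _
  algebraMap_mem' c := by
    have : algebraMap ℂ (BoundedContinuousFunction (Circle × Circle) ℂ) c =
        c • boundedCharacter 0 := by
      ext x
      simp [boundedCharacter_apply, character, Algebra.algebraMap_eq_smul_one]
    rw [this]
    exact Submodule.smul_mem _ _ (Submodule.subset_span ⟨0, rfl⟩)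
  one_mem' := by
    refine Submodule.subset_span ⟨0, ?_⟩
    ext x
    simp [boundedCharacter_apply, character]
  mul_mem' {f g} hf hg := by
    refine Submodule.span_induction₂ (p := fun f g _ _ =>
      f * g ∈ Submodule.span ℂ (Set.range boundedCharacter)) ?_ ?_ ?_ ?_ ?_ ?_ ?_ hf hg
    · rintro _ _ ⟨s, rfl⟩ ⟨t, rfl⟩
      refine Submodule.subset_span ⟨s + t, ?_⟩
      ext x
      simp [boundedCharacter_apply, character_add]
    · intro f _; rw [zero_mul]; exact zero_mem _
    · intro f _; rw [mul_zero]; exact zero_mem _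
    · intro f g k _ _ _ h1 h2; rw [add_mul]; exact add_mem h1 h2
    · intro f g k _ _ _ h1 h2; rw [mul_add]; exact add_mem h1 h2
    · intro c f g _ _ h1; rw [smul_mul_assoc]; exact Submodule.smul_mem _ _ h1
    · intro c f g _ _ h1; rw [mul_smul_comm]; exact Submodule.smul_mem _ _ h1
  star_mem' {f} hf := by
    refine Submodule.span_induction (p := fun f _ =>
      star f ∈ Submodule.span ℂ (Set.range boundedCharacter)) ?_ ?_ ?_ ?_ hf
    · rintro _ ⟨s, rfl⟩
      refine Submodule.subset_span ⟨-s, ?_⟩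
      ext x
      rw [BoundedContinuousFunction.star_apply, boundedCharacter_apply, boundedCharacter_apply,
        ← conj_character]
      rfl
    · rw [star_zero]; exact zero_mem _
    · intro f g _ _ h1 h2; rw [star_add]; exact add_mem h1 h2
    · intro c f _ h1; rw [star_smul]; exact Submodule.smul_mem _ _ h1

/-- Trigonometric polynomials form a star algebra that separates points, and integrals over such an
algebra determine a finite measure. -/
theorem measure_eq_of_integral_character_eq {μ ν : Measure (Circle × Circle)} [IsFiniteMeasure μ]
    [IsFiniteMeasure ν] (h : ∀ s, ∫ x, character s x ∂μ = ∫ x, character s x ∂ν) : μ = ν := by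
  refine ext_of_forall_mem_subalgebra_integral_eq_of_polish (𝕜 := ℂ) (A := trigAlgebra) ?_ ?_
  · rintro ⟨z, w⟩ ⟨z', w'⟩ hne
    have hmem : ∀ s, ∃ f ∈ (trigAlgebra.map (BoundedContinuousFunction.toContinuousMapStarₐ ℂ) :
        StarSubalgebra ℂ C(Circle × Circle, ℂ)), ∀ x, f x = character s x := fun s =>
      ⟨_, ⟨boundedCharacter s, Submodule.subset_span ⟨s, rfl⟩, rfl⟩, fun _ => rfl⟩
    by_cases hz : z = z'
    · obtain ⟨f, hf, hf'⟩ := hmem (0, 1)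
      refine ⟨f, ⟨f, hf, rfl⟩, fun heq => hne (Prod.ext hz (Circle.ext ?_))⟩
      rw [hf', hf'] at heq
      simpa [character] using heq
    · obtain ⟨f, hf, hf'⟩ := hmem (1, 0)
      refine ⟨f, ⟨f, hf, rfl⟩, fun heq => hz (Circle.ext ?_)⟩
      rw [hf', hf'] at heq
      simpa [character] using heq
  · intro g hg
    refine Submodule.span_induction (p := fun f _ => ∫ x, f x ∂μ = ∫ x, f x ∂ν) ?_ ?_ ?_ ?_ hg
    · rintro _ ⟨s, rfl⟩
      exact h s
    · simp
    · intro f g _ _ h1 h2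
      simp only [BoundedContinuousFunction.coe_add, Pi.add_apply]
      rw [integral_add (integrable_of_continuous f.continuous)
        (integrable_of_continuous g.continuous), integral_add
        (integrable_of_continuous f.continuous) (integrable_of_continuous g.continuous), h1, h2]
    · intro c f _ h1
      simp only [BoundedContinuousFunction.coe_smul, smul_eq_mul]
      rw [integral_const_mul, integral_const_mul, h1]

/-! ### Reverses on the bicircle -/

theorem eq_sum_monomial {n m : ℕ} {p : MvPolynomial (Fin 2) ℂ}
    (hp : ∀ i j, n < i ∨ m < j → cf p i j = 0) :
    p = ∑ i ∈ Finset.range (n + 1), ∑ j ∈ Finset.range (m + 1),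
      MvPolynomial.monomial (expo i j) (cf p i j) := by
  refine ext_cf fun a b => ?_
  have hab : ∀ i j, expo i j = expo a b ↔ i = a ∧ j = b := fun i j =>
    ⟨fun h => by simpa using expo_injective h, fun h => by rw [h.1, h.2]⟩
  have h1 : ∀ i j, (MvPolynomial.monomial (expo i j) (cf p i j)).coeff (expo a b) =
      if i = a then (if j = b then cf p a b else 0) else 0 := fun i j => by
    rw [MvPolynomial.coeff_monomial]
    simp only [hab]
    split_ifs <;> simp_all
  conv_rhs => rw [cf]
  simp only [MvPolynomial.coeff_sum, h1]
  by_cases h : n < a ∨ m < b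
  · rw [hp a b h]; simp
  · push Not at h
    simp [Finset.sum_ite_eq', h.1, h.2]

theorem onTorus_reverse {n m : ℕ} {p : MvPolynomial (Fin 2) ℂ}
    (hp : ∀ i j, n < i ∨ m < j → cf p i j = 0) (x : Circle × Circle) :
    onTorus (reverse n m p) x = mono n m x * conj (onTorus p x) := by
  conv_rhs => rw [eq_sum_monomial hp]
  have hval : ∀ i j c, val (MvPolynomial.monomial (expo i j) c) x.1 x.2 = c * mono i j x := by
    intro i j c
    rw [← onTorus_monomial, onTorus, val, val, MvPolynomial.eval_monomial,
      MvPolynomial.eval_monomial, one_mul]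
  have hadd : ∀ (s : Finset ℕ) (f : ℕ → MvPolynomial (Fin 2) ℂ),
      val (∑ i ∈ s, f i) x.1 x.2 = ∑ i ∈ s, val (f i) x.1 x.2 := fun s f => by
    simp only [val, map_sum]
  simp only [onTorus, reverse, hadd, hval, map_sum, Finset.mul_sum]
  refine Finset.sum_congr rfl fun i hi => Finset.sum_congr rfl fun j hj => ?_
  rw [Finset.mem_range, Nat.lt_succ_iff] at hi hj
  obtain ⟨a, rfl⟩ := Nat.exists_eq_add_of_le hi
  obtain ⟨b, rfl⟩ := Nat.exists_eq_add_of_le hj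
  have hz : ∀ z : Circle, (z : ℂ) * conj (z : ℂ) = 1 := fun z => by
    rw [Complex.mul_conj', Circle.norm_coe]; simp
  simp only [mono, map_mul, map_pow, Nat.add_sub_cancel_left, pow_add]
  have h1 : ((x.1 : ℂ) ^ i) * (conj (x.1 : ℂ)) ^ i = 1 := by rw [← mul_pow, hz, one_pow]
  have h2 : ((x.2 : ℂ) ^ j) * (conj (x.2 : ℂ)) ^ j = 1 := by rw [← mul_pow, hz, one_pow]
  calc _ = conj (cf p i j) * ((x.1 : ℂ) ^ a * (x.2 : ℂ) ^ b) * 1 * 1 := by ring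
    _ = conj (cf p i j) * ((x.1 : ℂ) ^ a * (x.2 : ℂ) ^ b) *
        (((x.1 : ℂ) ^ i) * (conj (x.1 : ℂ)) ^ i) * (((x.2 : ℂ) ^ j) * (conj (x.2 : ℂ)) ^ j) := by
      rw [h1, h2]
    _ = _ := by ring

theorem norm_onTorus_reverse {n m : ℕ} {p : MvPolynomial (Fin 2) ℂ}
    (hp : ∀ i j, n < i ∨ m < j → cf p i j = 0) (x : Circle × Circle) :
    ‖onTorus (reverse n m p) x‖ = ‖onTorus p x‖ := by
  rw [onTorus_reverse hp, norm_mul, Complex.norm_conj]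
  simp [mono, Circle.norm_coe]

/-! ### Measures with a stable denominator -/

theorem differentiable_val_left (p : MvPolynomial (Fin 2) ℂ) (w : ℂ) :
    Differentiable ℂ fun z => val p z w := by
  induction p using MvPolynomial.induction_on with
  | C a => simp [val]
  | add p q hp hq => simp only [val, map_add]; exact hp.add hq
  | mul_X p i hp =>
    simp only [val, map_mul, MvPolynomial.eval_X]
    refine hp.mul ?_
    fin_cases i
    · exact differentiable_id
    · exact differentiable_const _

theorem differentiable_val_right (p : MvPolynomial (Fin 2) ℂ) (z : ℂ) :
    Differentiable ℂ fun w => val p z w := by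
  induction p using MvPolynomial.induction_on with
  | C a => simp [val]
  | add p q hp hq => simp only [val, map_add]; exact hp.add hq
  | mul_X p i hp =>
    simp only [val, map_mul, MvPolynomial.eval_X]
    refine hp.mul ?_
    fin_cases i
    · exact differentiable_const _
    · exact differentiable_id

theorem IsStable.onTorus_ne_zero {q : MvPolynomial (Fin 2) ℂ} (hq : IsStable q)
    (x : Circle × Circle) : onTorus q x ≠ 0 :=
  hq _ _ (Circle.norm_coe _).le (Circle.norm_coe _).le

theorem integral_zpow_mul_arcLength {g : ℂ → ℂ}
    (hg : ∀ z : ℂ, ‖z‖ ≤ 1 → DifferentiableAt ℂ g z) {k : ℤ} (hk : 0 < k) :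
    ∫ z : Circle, (z : ℂ) ^ k * g z ∂arcLength = 0 := by
  obtain ⟨k, rfl⟩ := Int.eq_ofNat_of_zero_le hk.le
  obtain ⟨k, rfl⟩ := Nat.exists_eq_add_of_le' (show 1 ≤ k by omega)
  simp only [zpow_natCast, pow_succ', mul_assoc]
  exact integral_arcLength_mul_eq_zero (g := fun z => z ^ k * g z) fun z hz =>
    (differentiableAt_id.pow k).mul (hg z hz)

/-- Cauchy's theorem on the bicircle. -/
theorem IsStable.integral_character_div {q : MvPolynomial (Fin 2) ℂ} (hq : IsStable q)
    {s : ℤ × ℤ} (hs : 0 < s.1 ∨ 0 < s.2) :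
    ∫ x, character s x / onTorus q x ∂lebesgue = 0 := by
  have hi : Integrable (fun x => character s x / onTorus q x) lebesgue :=
    integrable_of_continuous
      ((continuous_character s).div₀ (continuous_onTorus q) hq.onTorus_ne_zero)
  rw [lebesgue] at hi ⊢
  rcases hs with hs | hs
  · rw [integral_prod_symm _ hi]
    refine integral_eq_zero_of_ae (Eventually.of_forall fun w => ?_)
    have h : ∀ z : Circle, character s (z, w) / onTorus q (z, w) =
        (w : ℂ) ^ s.2 * ((z : ℂ) ^ s.1 * (val q z w)⁻¹) := fun z => by
      simp only [character, onTorus]; ring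
    simp only [h, integral_const_mul]
    rw [integral_zpow_mul_arcLength (g := fun z => (val q z w)⁻¹) (fun z hz =>
      (differentiable_val_left q w z).inv (hq z w hz (Circle.norm_coe w).le)) hs, mul_zero]
    rfl
  · rw [integral_prod _ hi]
    refine integral_eq_zero_of_ae (Eventually.of_forall fun z => ?_)
    have h : ∀ w : Circle, character s (z, w) / onTorus q (z, w) =
        (z : ℂ) ^ s.1 * ((w : ℂ) ^ s.2 * (val q z w)⁻¹) := fun w => by
      simp only [character, onTorus]; ring
    simp only [h, integral_const_mul]
    rw [integral_zpow_mul_arcLength (g := fun w => (val q z w)⁻¹) (fun w hw =>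
      (differentiable_val_right q z w).inv (hq z w (Circle.norm_coe z).le hw)) hs, mul_zero]
    rfl

/-- For the weight 1/|q|², ⟨q, z^s q⟩ is a Fourier coefficient of the constant 1, while pairing q
with a character gives the conjugate of the integral of z^s/q, which Cauchy's theorem kills when an
exponent is positive. -/
theorem isBernsteinSzego_emb (μ : Measure (Circle × Circle)) [IsFiniteMeasure μ] (hμ : IsPosDef μ)
    {n m : ℕ} {p : MvPolynomial (Fin 2) ℂ} (hp : ∀ i j, n < i ∨ m < j → cf p i j = 0)
    (hq : IsStable (reverse n m p)) (h : μ = lebesgue.withDensity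
      (fun x => ENNReal.ofReal (1 / ‖onTorus p x‖ ^ 2))) :
    IsBernsteinSzego (monomialBasis μ hμ) n m (emb μ hμ (reverse n m p)) := by
  have hnorm := norm_onTorus_reverse hp
  have hp0 : ∀ x, onTorus p x ≠ 0 := fun x h0 => hq.onTorus_ne_zero x (by
    rw [← norm_eq_zero, hnorm, h0, norm_zero])
  have hint : ∀ f, functional μ f =
      functional lebesgue fun x => ((1 / ‖onTorus p x‖ ^ 2 : ℝ) : ℂ) * f x := fun f => by
    have hc : Continuous fun x => 1 / ‖onTorus p x‖ ^ 2 := continuous_const.div₀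
      ((continuous_onTorus p).norm.pow 2) fun x => by simpa using hp0 x
    rw [functional, functional, h, integral_withDensity_ofReal hc fun x => by positivity]
  have hmem : emb μ hμ p ∈ sp (monomialBasis μ hμ) (box n m) := emb_mem_sp μ hμ fun i j hij =>
    hp i j (by simp only [mem_box] at hij; omega)
  refine ⟨?_, fun s => ?_, ?_, fun w hw => ?_, fun z hz => ?_⟩
  · rw [emb_reverse μ hμ hmem]
    exact rev_mem_sp hmem fun s hs => by
      simp only [mem_box, Prod.fst_sub, Prod.snd_sub] at *
      omega
  · rw [inner_def, pairing, hint, ← functional_lebesgue_character]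
    congr 1; funext x
    have h1 : (‖onTorus p x‖ : ℂ) ≠ 0 := by simpa using hp0 x
    rw [toFun_sh, toFun_emb, mul_assoc (character s x), Complex.mul_conj', hnorm]
    push_cast
    field_simp
  · rw [mem_perp]
    intro s hs
    rw [inner_def, toFun_emb, toFun_monomialBasis, pairing, hint, functional]
    have h2 : ∀ x, ((1 / ‖onTorus p x‖ ^ 2 : ℝ) : ℂ) *
        (onTorus (reverse n m p) x * conj (character s x)) =
        conj (character s x / onTorus (reverse n m p) x) := fun x => by
      have h1 : onTorus (reverse n m p) x ≠ 0 := hq.onTorus_ne_zero x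
      have h3 : conj (onTorus (reverse n m p) x) ≠ 0 := by simpa using h1
      rw [map_div₀, ← hnorm]
      push_cast
      rw [← Complex.mul_conj']
      field_simp
    simp only [h2]
    rw [integral_conj, hq.integral_character_div hs, map_zero, mul_zero]
  · rw [evalAt_emb]; exact hq _ _ (by simp) hw
  · rw [evalAt_emb]; exact hq _ _ hz (by simp)

/-! ### The measure determined by a polynomial with orthogonal shifts -/

/-- If s has a negative coordinate, z^s p lies in the span of the monomials to which p is
orthogonal; otherwise -s has one, and conjugate symmetry applies. -/
theorem inner_sh_self_of_mem_perp {H : Type*} [NormedAddCommGroup H] [InnerProductSpace ℂ H]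
    {e : Module.Basis (ℤ × ℤ) ℂ H} (he : IsStationary e) {n m : ℤ} {p : H}
    (hp : p ∈ sp e (box n m)) (hp' : p ∈ perp e {s | s.1 < n ∨ s.2 < m}) {s : ℤ × ℤ}
    (hs : s ≠ 0) : inner ℂ p (sh e s p) = 0 := by
  have key : ∀ s : ℤ × ℤ, s.1 < 0 ∨ s.2 < 0 → inner ℂ p (sh e s p) = 0 := fun s hs =>
    inner_eq_zero_of_perp' hp' (sh_mem_sp hp fun a ha => by
      simp only [mem_box, Set.mem_ofPred_eq, Prod.fst_add, Prod.snd_add] at *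
      omega)
  by_cases h : s.1 < 0 ∨ s.2 < 0
  · exact key s h
  · rw [← inner_conj_symm, inner_sh_left he, key (-s), map_zero]
    have : ¬ (s.1 = 0 ∧ s.2 = 0) := fun h => hs (Prod.ext h.1 h.2)
    simp only [Prod.fst_neg, Prod.snd_neg]
    omega

/-- The hypothesis lists the moments of |p|² dμ, which are those of Lebesgue measure; since p has no
zeros on the bicircle, the density can be inverted. -/
theorem eq_withDensity_of_inner_sh_self (μ : Measure (Circle × Circle)) [IsFiniteMeasure μ]
    (hμ : IsPosDef μ) {p : MvPolynomial (Fin 2) ℂ} (h0 : ∀ x, onTorus p x ≠ 0)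
    (h : ∀ s, inner ℂ (emb μ hμ p) (sh (monomialBasis μ hμ) s (emb μ hμ p)) =
      if s = 0 then 1 else 0) :
    μ = lebesgue.withDensity fun x => ENNReal.ofReal (1 / ‖onTorus p x‖ ^ 2) := by
  have hc : Continuous fun x => ‖onTorus p x‖ ^ 2 := (continuous_onTorus p).norm.pow 2
  have hpos : ∀ x, 0 < ‖onTorus p x‖ ^ 2 := fun x => pow_pos (norm_pos_iff.2 (h0 x)) 2
  have hfin := isFiniteMeasure_withDensity_of_continuous (μ := μ) hc
  have hleb : μ.withDensity (fun x => ENNReal.ofReal (‖onTorus p x‖ ^ 2)) = lebesgue := by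
    refine measure_eq_of_integral_character_eq fun s => ?_
    rw [integral_withDensity_ofReal hc fun x => (hpos x).le]
    have h1 := h s
    rw [← functional_lebesgue_character, inner_def, pairing, functional, functional] at h1
    rw [← mul_left_cancel₀ (by simp [Real.pi_ne_zero]) h1]
    congr 1; funext x
    rw [toFun_sh, toFun_emb, mul_assoc (character s x), Complex.mul_conj']
    push_cast
    ring
  rw [← hleb]
  conv_lhs => rw [← withDensity_inv_same (μ := μ) (f := fun x => ENNReal.ofReal (‖onTorus p x‖ ^ 2))
    hc.measurable.ennreal_ofReal (Eventually.of_forall fun x => by simpa using h0 x)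
    (Eventually.of_forall fun x => ENNReal.ofReal_ne_top)]
  congr 1; funext x
  rw [one_div, ENNReal.ofReal_inv_of_pos (hpos x)]

theorem coefficientConditions_of_withDensity (μ : Measure (Circle × Circle)) [IsFiniteMeasure μ]
    {n m : ℕ} {p : MvPolynomial (Fin 2) ℂ} (hp : HasDegree p n m)
    (hq : IsStable (reverse n m p)) (h : μ = lebesgue.withDensity
      (fun x => ENNReal.ofReal (1 / ‖onTorus p x‖ ^ 2))) :
    IsPosDef μ ∧ CoefficientConditions μ n m := by
  have hp0 : ∀ x, 0 < ‖onTorus p x‖ ^ 2 := fun x => by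
    rw [← norm_onTorus_reverse hp.1]
    exact pow_pos (norm_pos_iff.2 (hq.onTorus_ne_zero x)) 2
  have hμ : IsPosDef μ := by
    rw [h]
    exact isPosDef_withDensity (continuous_const.div₀ ((continuous_onTorus p).norm.pow 2)
      fun x => (hp0 x).ne') fun x => one_div_pos.2 (hp0 x)
  exact ⟨hμ, (isBernsteinSzego_emb μ hμ hp.1 hq h).coefficientConditions μ hμ⟩

/-- The denominator is the top orthonormal polynomial φ^m_{n,m}: its orthogonality to all lower
columns and rows determines the measure, and 𝒦_{n,m} = 0 makes its reverse stable. -/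
theorem CoefficientConditions.exists_withDensity (μ : Measure (Circle × Circle))
    [IsFiniteMeasure μ] (hμ : IsPosDef μ) {n m : ℕ} (h : CoefficientConditions μ n m) :
    ∃ p : MvPolynomial (Fin 2) ℂ, HasDegree p n m ∧ IsStable (reverse n m p) ∧
      μ = lebesgue.withDensity (fun x => ENNReal.ofReal (1 / ‖onTorus p x‖ ^ 2)) := by
  have he := isStationary_monomialBasis μ hμ
  have hn : (0 : ℤ) ≤ n := Int.natCast_nonneg n
  have hm : (0 : ℤ) ≤ m := Int.natCast_nonneg m
  have hv := h.vanishingConditions μ hμ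
  have hspec := phi_spec μ hμ n m m
  have hfam := isLexFamily_phi μ hμ n m
  have hlead := hfam.mem_leadSpace
  have hperp := hv.mem_perp he hn hm hlead (hfam.ne_zero le_rfl)
  have hinner : inner ℂ (emb μ hμ (phi μ n m m)) (emb μ hμ (phi μ n m m)) = (1 : ℂ) := by
    rw [inner_emb]; exact hspec.2.2.2
  have hnorm : ‖emb μ hμ (phi μ n m m)‖ = 1 := by
    have h1 := inner_self_eq_norm_sq_to_K (𝕜 := ℂ) (emb μ hμ (phi μ n m m))
    rw [hinner] at h1
    have h2 : ‖emb μ hμ (phi μ n m m)‖ ^ 2 = 1 := by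
      rw [← Complex.ofReal_inj, Complex.ofReal_pow, Complex.ofReal_one]
      exact h1.symm
    exact (pow_eq_one_iff_of_nonneg (norm_nonneg _) two_ne_zero).1 h2
  have hcf : ∀ i j, n < i ∨ m < j → cf (phi μ n m m) i j = 0 := fun i j hij =>
    hspec.1 i j (by simp [lexBelow]; omega) (by simp; omega)
  have hst : IsStable (reverse n m (phi μ n m m)) := fun z w hz hw => by
    rw [← evalAt_emb μ hμ, emb_reverse μ hμ hlead.1]
    exact (hv.decoupled_right m le_rfl).evalAt_rev_ne_zero he hn hm hlead hnorm hz hw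
  refine ⟨phi μ n m m, ⟨hcf, ?_⟩, hst, eq_withDensity_of_inner_sh_self μ hμ (fun x h0 => ?_)
    fun s => ?_⟩
  · obtain ⟨k, hk, hk'⟩ := hspec.2.1
    rw [hk']
    exact_mod_cast hk.ne'
  · refine hst.onTorus_ne_zero x ?_
    rw [← norm_eq_zero, norm_onTorus_reverse hcf, h0, norm_zero]
  · split_ifs with hs
    · rw [hs, sh_zero, hinner]
    · exact inner_sh_self_of_mem_perp he hlead.1 hperp hs

end Bicircle

theorem mainTheorem4 (μ : Measure (Circle × Circle)) [IsFiniteMeasure μ] (n m : ℕ) :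
    (μ ≪ Bicircle.lebesgue ∧
      ∃ p : MvPolynomial (Fin 2) ℂ, Bicircle.HasDegree p n m ∧
        Bicircle.IsStable (Bicircle.reverse n m p) ∧
        μ = Bicircle.lebesgue.withDensity
          (fun x => ENNReal.ofReal (1 / ‖Bicircle.onTorus p x‖ ^ 2))) ↔
    (Bicircle.IsPosDef μ ∧
      (∀ j, m ≤ j → Bicircle.K μ n j = 0 ∧
        (0 < n → Bicircle.EhatTilde μ (n - 1) (j + 1) = 0) ∧
        Bicircle.u μ n (j + 1) = 0) ∧
      (∀ i, n < i → Bicircle.K μ i m = 0 ∧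
        (0 < m → Bicircle.Ehat μ i (m - 1) = 0) ∧
        Bicircle.u μ i m = 0) ∧
      (∀ (i : ℤ) (j : ℕ), (n : ℤ) < |i| → m < j → Bicircle.u μ i j = 0)) := by
  constructor
  · rintro ⟨_, p, hp, hq, h⟩
    exact Bicircle.coefficientConditions_of_withDensity μ hp hq h
  · rintro ⟨hμ, h⟩
    obtain ⟨p, hp, hq, hd⟩ := Bicircle.CoefficientConditions.exists_withDensity μ hμ h
    refine ⟨?_, p, hp, hq, hd⟩
    rw [hd]
    exact withDensity_absolutelyContinuous _ _
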